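/- Let $Q(\mathbb A_D) \,{:-}\, R_1(\mathbb A_1),\dots,R_m(\mathbb A_m)$ be a full conjunctive query without self-joins with $k=|\bigcup_i \mathbb A_i|$ attributes, evaluated under bag semantics on a database $D$ with $n$ tuples in total. A hyperedge $h$ of a hypergraph is an ear if its vertices that belong to some other hyperedge all lie in one other hyperedge; a hypergraph (a join of relations, with the attribute sets as hyperedges) is acyclic if removing ears one after the other (a GYO decomposition) reduces it to the empty hypergraph. Attaching each removed relation to a remaining relation that contains all attributes it shares with the remaining ones gives a rooted join tree $\mathcal T$, with $p(R_i)$ the parent and $C(R_i)$ the set of children of $R_i$. The query is doubly acyclic if it is acyclic and has such a join tree $\mathcal T$ in which, for every node $R_i$, the join of its parent and its children is acyclic. For a tuple $t$ over $\mathbb A_i$, its tuple sensitivity is the larger of the sizes of the (bag) symmetric differences of $Q(D)$ with the query results after inserting $t$ into $R_i$ (upward) and after deleting one copy of $t$ from $R_i$ (downward). The local sensitivity $LS(Q,D)$ is the maximum of the tuple sensitivities over all $i$ and all tuples $t$ over $\mathbb A_i$. The algorithm is given $\mathcal T$ and $D$. With $\gamma_{\mathbb A}$ the group-by on $\mathbb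 A$ that adds counts and $\tilde\bowtie$ the natural join that multiplies counts, it computes, from the leaves to the root, the botjoins $\bot(R_i)=\gamma_{\mathbb A_i\cap\mathbb A_{p(R_i)}}\tilde\bowtie(R_i,\{\bot(R_j): R_j\in C(R_i)\})$ (grouped by $\mathbb A_i$ at the root) and, from the root to the leaves, the topjoins $\top(R_i)=\gamma_{\mathbb A_i\cap\mathbb A_{p(R_i)}}\tilde\bowtie(p(R_i),\top(p(R_i)),\{\bot(R_j): R_j\in C(p(R_i)),\,j\ne i\})$ (without $\top(p(R_i))$ if $p(R_i)$ is the root). The multiplicity table $T^i$ assigns to a tuple $t$ over $\mathbb A_i$ its multiplicity in $\tilde\bowtie(\top(R_i),\{\bot(R_j):R_j\in C(R_i)\})$ (without $\top(R_i)$ at the root), where attributes that occur in no other relation are ignored. The tables $T^i$ are kept in the form of these joins and are not written out; the algorithm finds a largest entry of all the $T^i$ along GYO decompositions of these joins, and returns it with its tuple $t^*$. Sorting is by merge sort and joins with botjoins and topjoins are sort-merge joins. One step is one operation on tuples or attribute sets, one arithmetic operation on two counts or one access to a table or node. Let $\mathcal T$ be a join tree of $Q$ that witnesses that $Q$ is doubly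 acyclic. Then: 1. For each node $R_i$ the join that defines $T^i$ is acyclic, i.e. the hypergraph with hyperedges $\mathbb A_i\cap\mathbb A_j$, where $R_j$ is the parent or a child of $R_i$, is acyclic. 2. For every database $D$ the algorithm returns $LS(Q,D)$ and a tuple $t^*$ whose tuple sensitivity is $LS(Q,D)$, and $T^i(t)$ is the upward tuple sensitivity of $t$, for all $i$ and all $t$ over $\mathbb A_i$. There is an absolute constant $K$ such that for $n\ge 2$ the whole algorithm takes at most $K\,m\,n\log n$ steps; if each node of $\mathcal T$ has degree at most $d$ and $m\le n$, it also takes at most $K(d+1)^2\,n\log n$ steps. The algorithm is polynomial in combined complexity: even if each operation on tuples or attribute sets is charged the number of attributes involved and each arithmetic operation the product of the bit lengths of its operands, the cost is bounded by a fixed polynomial in $m$, $k$ and $n$. 3. For $m\ge1$ the path query $R_1(A_0,A_1),R_2(A_1,A_2),\dots,R_m(A_{m-1},A_m)$ is doubly acyclic, with a join tree of degree at most $2$. -/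

import Mathlib

namespace JoinLS

/-! ## Programs with an explicit cost

A `Timed` computation carries its result together with two counters: `steps` is the number of
elementary operations (one tuple operation, one comparison of two tuples, one arithmetic operation
on two counts, one access to a table or to a node of the tree), and `work` is the finer cost
in which an operation on tuples is charged the number of attributes that it touches
and an operation on two counts is charged the product of their bit lengths. -/

structure Timed (β : Type) where
  val : β
  steps : ℕ
  work : ℕ

instance : Monad Timed where
  pure x := ⟨x, 0, 0⟩
  bind x f := ⟨(f x.val).val, x.steps + (f x.val).steps, x.work + (f x.val).work⟩

/-- One elementary operation, of finer cost `w + 1`. -/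
def tick (w : ℕ) : Timed Unit := ⟨(), 1, w + 1⟩

/-- `q` elementary operations, of finer cost `1` each. -/
def ticks (q : ℕ) : Timed Unit := ⟨(), q, q⟩

/-- The finer cost of one addition, multiplication or comparison of two counts. -/
def arith (a b : ℕ) : ℕ := (Nat.size a + 1) * (Nat.size b + 1)

/-- Apply `f` to every entry of a list. -/
def mapT {β γ : Type} (f : β → Timed γ) : List β → Timed (List γ)
  | [] => do
      tick 0
      pure []
  | b :: l => do
      tick 0
      let c ← f b
      let r ← mapT f l
      pure (c :: r)

/-- A loop over a list that updates a state. -/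
def foldT {β σ : Type} (f : σ → β → Timed σ) : List β → σ → Timed σ
  | [], s => do
      tick 0
      pure s
  | b :: l, s => do
      tick 0
      let s' ← f s b
      foldT f l s'

/-! ## Hypergraphs and GYO decompositions -/

section Hypergraph

variable {α ι : Type} [DecidableEq α] [DecidableEq ι]

/-- Among the hyperedges `E j`, `j ∈ s`, the hyperedge `E i` is an ear: each of its vertices
belongs to no other hyperedge, or else lies in one fixed other hyperedge `E w`
(in the first case there may be no vertices of the second kind at all, and no `w`). -/
def IsEar (E : ι → Finset α) (s : Finset ι) (i : ι) : Prop :=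
  i ∈ s ∧ ((∀ j ∈ s, j ≠ i → Disjoint (E i) (E j)) ∨
    ∃ w ∈ s, w ≠ i ∧ ∀ j ∈ s, j ≠ i → E i ∩ E j ⊆ E w)

/-- The hypergraph with hyperedges `E j`, `j ∈ s`, is reduced to the empty hypergraph by
repeatedly removing ears. -/
inductive GYOAcyclic (E : ι → Finset α) : Finset ι → Prop
  | empty : GYOAcyclic E ∅
  | ear (s : Finset ι) (i : ι) (hi : IsEar E s i) (h : GYOAcyclic E (s.erase i)) : GYOAcyclic E s

end Hypergraph

/-! ## Queries and join trees

A full conjunctive query without self-joins, `Q :- R_1(A_1), ..., R_m(A_m)`, is the family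
`A : Fin m → Finset α` of the attribute sets of its relations. -/

/-- A rooted join tree constructed from a GYO decomposition: `elim s` is the relation that is
removed in step `s`; the parent of a removed relation is a relation that is still
present and contains all the attributes that it shares with the relations still present. -/
structure JoinTree {α : Type} [DecidableEq α] {m : ℕ} (A : Fin m → Finset α) where
  elim : Equiv.Perm (Fin m)
  root : Fin m
  parent : Fin m → Option (Fin m)
  parent_eq_none : ∀ i, parent i = none ↔ i = root
  parent_later : ∀ i p, parent i = some p → elim.symm i < elim.symm p
  ear : ∀ i p, parent i = some p → ∀ j, elim.symm i < elim.symm j → A i ∩ A j ⊆ A p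

namespace JoinTree

variable {α : Type} [DecidableEq α] {m : ℕ} {A : Fin m → Finset α}

/-- The nodes from the leaves to the root: children come before their parent. -/
def postOrder (T : JoinTree A) : List (Fin m) := List.ofFn T.elim

/-- The children of a node. -/
def children (T : JoinTree A) (i : Fin m) : List (Fin m) :=
  T.postOrder.filter fun c => T.parent c = some i

/-- The parent (if any) and the children of a node. -/
def nbrs (T : JoinTree A) (i : Fin m) : List (Fin m) := (T.parent i).toList ++ T.children i

/-- The attributes of the botjoin and of the topjoin of node `i`: those shared with its parent,
and all attributes of `i` if `i` is the root. -/
def sep (T : JoinTree A) (i : Fin m) : Finset α :=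
  match T.parent i with
  | some p => A i ∩ A p
  | none => A i

/-- For every node, the join of its parent and its children is acyclic. -/
def NbrsAcyclic (T : JoinTree A) : Prop := ∀ i, GYOAcyclic A (T.nbrs i).toFinset

end JoinTree

/-- Doubly acyclic join queries. -/
def DoublyAcyclic {α : Type} [DecidableEq α] {m : ℕ} (A : Fin m → Finset α) : Prop :=
  GYOAcyclic A Finset.univ ∧ ∃ T : JoinTree A, T.NbrsAcyclic

/-- The path query `R_1(A_0, A_1), R_2(A_1, A_2), ..., R_m(A_{m-1}, A_m)`. -/
def pathQuery (m : ℕ) (i : Fin m) : Finset (Fin (m + 1)) := {i.castSucc, i.succ}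

/-! ## Bag semantics and local sensitivity -/

/-- Tuples over the attribute set `S`. -/
abbrev Tup {α : Type} (dom : α → Type) (S : Finset α) : Type := ∀ a : S, dom a

section Semantics

variable {α : Type} [DecidableEq α] {dom : α → Type} [∀ a, DecidableEq (dom a)] {m : ℕ}
  {A : Fin m → Finset α}

/-- All attributes of the query. -/
def allAttrs (A : Fin m → Finset α) : Finset α := Finset.univ.biUnion A

theorem subset_allAttrs (A : Fin m → Finset α) (i : Fin m) : A i ⊆ allAttrs A :=
  Finset.subset_biUnion_of_mem A (Finset.mem_univ i)

/-- The query result `Q(D)` as a bag: the multiplicity of an output tuple `s` is the product over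
the relations of the multiplicity of the projection of `s`. -/
def result (D : ∀ i, Multiset (Tup dom (A i))) (s : Tup dom (allAttrs A)) : ℕ :=
  ∏ i, (D i).count (Finset.restrict₂ (subset_allAttrs A i) s)

/-- The query result is a finite bag, so that the sum in `symmDiffCard` is a finite one. -/
theorem finite_support_result (D : ∀ i, Multiset (Tup dom (A i))) :
    (Function.support (result D)).Finite := by
  have hfin : (Set.univ.pi fun i => {t : Tup dom (A i) | t ∈ D i}).Finite :=
    Set.Finite.pi fun i => (D i).toFinset.finite_toSet.subset fun t ht => by simpa using ht
  refine Set.Finite.of_finite_image (f := fun s i => Finset.restrict₂ (subset_allAttrs A i) s)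
    (hfin.subset ?_) ?_
  · rintro _ ⟨s, hs, rfl⟩ i -
    by_contra h
    exact hs (Finset.prod_eq_zero (Finset.mem_univ i) (Multiset.count_eq_zero.2 h))
  · intro s _ s' _ h
    funext ⟨a, ha⟩
    obtain ⟨i, -, hi⟩ := Finset.mem_biUnion.1 ha
    exact congrFun (congrFun h i) ⟨a, hi⟩

/-- The size of the symmetric difference of two bags. -/
noncomputable def symmDiffCard {β : Type} (f g : β → ℕ) : ℕ :=
  ∑ᶠ s, ((f s - g s) + (g s - f s))

/-- Upward tuple sensitivity of the tuple `t` of the domain of relation `i`. -/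
noncomputable def upSens (D : ∀ i, Multiset (Tup dom (A i))) (i : Fin m) (t : Tup dom (A i)) : ℕ :=
  symmDiffCard (result (Function.update D i (t ::ₘ D i))) (result D)

/-- Downward tuple sensitivity. -/
noncomputable def downSens (D : ∀ i, Multiset (Tup dom (A i))) (i : Fin m)
    (t : Tup dom (A i)) : ℕ :=
  symmDiffCard (result D) (result (Function.update D i ((D i).erase t)))

/-- Tuple sensitivity. -/
noncomputable def tupleSens (D : ∀ i, Multiset (Tup dom (A i))) (i : Fin m)
    (t : Tup dom (A i)) : ℕ :=
  max (upSens D i t) (downSens D i t)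

/-- `ls` is the local sensitivity: the maximum of the tuple sensitivities over all tuples of the
domains of all relations. -/
def IsLocalSensitivity (D : ∀ i, Multiset (Tup dom (A i))) (ls : ℕ) : Prop :=
  IsGreatest {x | ∃ (i : Fin m) (t : Tup dom (A i)), tupleSens D i t = x} ls

end Semantics

/-! ## Tables

A table over the attribute set `S` is a list of rows `(v, c)` with a count `c`; the tuple is stored
as an assignment `v` of values to all attributes, of which only those to `S` are ever read. -/

noncomputable section Tables

variable {α : Type} [LinearOrder α] {dom : α → Type} [∀ a, LinearOrder (dom a)]

/-- The projection of `v` to `S`, in the lexicographic order. -/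
def key (S : Finset α) (v : ∀ a, dom a) : Lex (∀ a : S, dom a) := toLex (S.restrict v)

/-- Merge two lists of rows that are sorted by their projections to `S`. -/
def mergeRows {X : Type} (S : Finset α) :
    List ((∀ a, dom a) × X) → List ((∀ a, dom a) × X) → Timed (List ((∀ a, dom a) × X))
  | [], l => do
      tick 0
      pure l
  | x :: l, [] => do
      tick 0
      pure (x :: l)
  | x :: l, y :: l' => do
      tick S.card
      if key S x.1 ≤ key S y.1 then
        let r ← mergeRows S l (y :: l')
        pure (x :: r)
      else
        let r ← mergeRows S (x :: l) l'
        pure (y :: r)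
termination_by l l' => l.length + l'.length

/-- Merge sort of a list of rows by their projections to `S`. -/
def sortRows {X : Type} (S : Finset α) (l : List ((∀ a, dom a) × X)) :
    Timed (List ((∀ a, dom a) × X)) :=
  if _h : l.length ≤ 1 then do
    tick 0
    pure l
  else do
    ticks l.length
    let x ← sortRows S (l.take (l.length / 2))
    let y ← sortRows S (l.drop (l.length / 2))
    mergeRows S x y
termination_by l.length
decreasing_by
  · simp only [List.length_take]; omega
  · simp only [List.length_drop]; omega

/-- Combine neighbouring rows with the same projection to `S` by means of `f`. -/
def collapse (S : Finset α) (f : (∀ a, dom a) × ℕ → (∀ a, dom a) × ℕ → (∀ a, dom a) × ℕ) :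
    List ((∀ a, dom a) × ℕ) → Timed (List ((∀ a, dom a) × ℕ))
  | [] => do
      tick 0
      pure []
  | r :: l => do
      let out ← collapse S f l
      match out with
      | [] => do
          tick 0
          pure [r]
      | r' :: o => do
          tick (S.card + arith r.2 r'.2)
          if key S r.1 = key S r'.1 then pure (f r r' :: o) else pure (r :: r' :: o)

/-- Group by the attributes in `S`, where rows of the same group are combined by `f`. -/
def groupBy (S : Finset α) (f : (∀ a, dom a) × ℕ → (∀ a, dom a) × ℕ → (∀ a, dom a) × ℕ)
    (l : List ((∀ a, dom a) × ℕ)) : Timed (List ((∀ a, dom a) × ℕ)) := do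
  let l' ← sortRows S l
  collapse S f l'

/-- Add the counts. -/
def addRow (r r' : (∀ a, dom a) × ℕ) : (∀ a, dom a) × ℕ := (r.1, r.2 + r'.2)

/-- Keep a row with the larger count. -/
def maxRow (r r' : (∀ a, dom a) × ℕ) : (∀ a, dom a) × ℕ := if r'.2 ≤ r.2 then r else r'

/-- One pass over two lists of rows sorted by their projections to `S`, the projections of the
second list being distinct: each row of the first list is paired with the row of the second list
that joins with it, if there is one. -/
def mergeLookup {X : Type} (S : Finset α) :
    List ((∀ a, dom a) × X) → List ((∀ a, dom a) × ℕ) →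
      Timed (List (((∀ a, dom a) × X) × Option ((∀ a, dom a) × ℕ)))
  | [], _ => do
      tick 0
      pure []
  | x :: l, [] => do
      tick 0
      let r ← mergeLookup S l []
      pure ((x, none) :: r)
  | x :: l, y :: tbl => do
      tick S.card
      if key S x.1 = key S y.1 then
        let r ← mergeLookup S l (y :: tbl)
        pure ((x, some y) :: r)
      else if key S x.1 ≤ key S y.1 then
        let r ← mergeLookup S l (y :: tbl)
        pure ((x, none) :: r)
      else
        mergeLookup S (x :: l) tbl
termination_by l tbl => l.length + tbl.length

/-- Sort-merge join of arbitrary rows with the output of a group-by over `S`. -/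
def lookupJoin {X : Type} (S : Finset α) (rows : List ((∀ a, dom a) × X))
    (tbl : List ((∀ a, dom a) × ℕ)) :
    Timed (List (((∀ a, dom a) × X) × Option ((∀ a, dom a) × ℕ))) := do
  let rows' ← sortRows S rows
  mergeLookup S rows' tbl

/-- The count of the joining row, `0` if there is none. -/
def countOf (r : Option ((∀ a, dom a) × ℕ)) : ℕ :=
  match r with
  | none => 0
  | some y => y.2

/-- The multiplicity of the projection of `v` to `S` in a table over `S`. -/
def tableCount (S : Finset α) (tbl : List ((∀ a, dom a) × ℕ)) (v : ∀ a, dom a) : ℕ :=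
  ((tbl.filter fun r => key S r.1 = key S v).map fun r => r.2).sum

/-- For counts `x_1, ..., x_d`: the list of the products of `pre` and of all `x_i` but one,
and the product of all `x_i`. -/
def others (pre : ℕ) : List ℕ → Timed (List ℕ × ℕ)
  | [] => do
      tick 0
      pure ([], 1)
  | x :: l => do
      tick (arith pre x)
      let r ← others (pre * x) l
      tick (arith pre r.2)
      tick (arith x r.2)
      pure (pre * r.2 :: r.1, x * r.2)

/-- A row with the largest count. -/
def bestRow : List ((∀ a, dom a) × ℕ) → Timed (Option ((∀ a, dom a) × ℕ))
  | [] => do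
      tick 0
      pure none
  | r :: l => do
      let b ← bestRow l
      match b with
      | none => do
          tick 0
          pure (some r)
      | some r' => do
          tick (arith r.2 r'.2)
          pure (some (maxRow r r'))

/-! ## Computing a GYO decomposition -/

section Gyo

variable {ι : Type} [DecidableEq ι]

/-- The vertices of `e` that lie in one of the listed hyperedges. -/
def sharedPart (E : ι → Finset α) (e : Finset α) : List ι → Timed (Finset α)
  | [] => do
      tick 0
      pure ∅
  | w :: l => do
      tick (e.card + (E w).card)
      let r ← sharedPart E e l
      pure ((e ∩ E w) ∪ r)

/-- One of the listed hyperedges that contains `s`. -/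
def findWitness (E : ι → Finset α) (s : Finset α) : List ι → Timed (Option ι)
  | [] => do
      tick 0
      pure none
  | w :: l => do
      tick (s.card + (E w).card)
      if s ⊆ E w then pure (some w) else findWitness E s l

/-- If the hyperedge `j` is an ear, the other hyperedges being those listed: the hyperedge that
contains its shared vertices, or `some none` if it has no shared vertices. -/
def earWitness (E : ι → Finset α) (j : ι) (l : List ι) : Timed (Option (Option ι)) := do
  let s ← sharedPart E (E j) l
  if s = ∅ then pure (some none)
  else do
    let w ← findWitness E s l
    match w with
    | none => pure none
    | some w => pure (some (some w))

/-- A GYO decomposition of the hyperedges in `L`, as the list of the ears in the order of their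
removal together with their witnesses. The first list holds the hyperedges that have still
to be tested; the removal of an ear can turn only its witness into a new ear.
The number bounds the number of tests. -/
def gyo (E : ι → Finset α) : ℕ → List ι → List ι → Timed (List (ι × Option ι))
  | 0, _, _ => do
      tick 0
      pure []
  | _ + 1, [], _ => do
      tick 0
      pure []
  | q + 1, j :: cs, L => do
      ticks (L.length + 1)
      if j ∈ L then do
        let x ← earWitness E j (L.erase j)
        match x with
        | none => gyo E q cs L
        | some w => do
            let rest ← gyo E q (w.toList ++ cs) (L.erase j)
            pure ((j, w) :: rest)
      else gyo E q cs L

end Gyo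

variable {m : ℕ} {A : Fin m → Finset α}

/-! ## The algorithm -/

section Algorithm

variable [∀ a, Inhabited (dom a)]

/-- A tuple over `S` as a row. -/
def extend (S : Finset α) (t : Tup dom S) : ∀ a, dom a :=
  fun a => if h : a ∈ S then t ⟨a, h⟩ else default

/-- The tuples of relation `i`, each with count `1` and an empty list of further counts. -/
def readRel (D : ∀ i, List (Tup dom (A i))) (i : Fin m) :
    Timed (List ((∀ a, dom a) × (ℕ × List ℕ))) :=
  mapT (fun t => do
    tick (A i).card
    pure (extend (A i) t, (1, []))) (D i)

/-- Join the rows of a relation with the botjoins of the listed children one by one, recording in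
each row the list of the counts found. -/
def joinChildren (T : JoinTree A) (bot : Fin m → List ((∀ a, dom a) × ℕ)) :
    List (Fin m) → List ((∀ a, dom a) × (ℕ × List ℕ)) →
      Timed (List ((∀ a, dom a) × (ℕ × List ℕ)))
  | [], rows => do
      tick 0
      pure rows
  | c :: cs, rows => do
      let rows' ← joinChildren T bot cs rows
      let j ← lookupJoin (T.sep c) rows' (bot c)
      mapT (fun r => do
        tick 0
        pure (r.1.1, (r.1.2.1, countOf r.2 :: r.1.2.2))) j

/-- Step I at node `i`: the botjoin of `i`, from the botjoins of its children. -/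
def botStep (T : JoinTree A) (D : ∀ i, List (Tup dom (A i)))
    (bot : Fin m → List ((∀ a, dom a) × ℕ)) (i : Fin m) :
    Timed (Fin m → List ((∀ a, dom a) × ℕ)) := do
  let rows ← readRel D i
  let rows ← joinChildren T bot (T.children i) rows
  let rows ← mapT (fun r => do
    let x ← others r.2.1 r.2.2
    pure (r.1, x.2)) rows
  let b ← groupBy (T.sep i) addRow rows
  tick 0
  pure (Function.update bot i b)

/-- The `q`-th count of each row belongs to the `q`-th child: group by, for each of the children. -/
def distribute (T : JoinTree A) :
    List (Fin m) → List ((∀ a, dom a) × List ℕ) → (Fin m → List ((∀ a, dom a) × ℕ)) →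
      Timed (Fin m → List ((∀ a, dom a) × ℕ))
  | [], _, top => do
      tick 0
      pure top
  | c :: cs, rows, top => do
      let col ← mapT (fun r => do
        tick 0
        pure (r.1, r.2.headD 0)) rows
      let rest ← mapT (fun r => do
        tick 0
        pure (r.1, r.2.tail)) rows
      let g ← groupBy (T.sep c) addRow col
      distribute T cs rest (Function.update top c g)

/-- Step II at node `p`: the topjoins of all the children of `p`, from `p`, the topjoin of `p`
(unless `p` is the root) and the botjoins of the children of `p` other than the one at hand. -/
def topStep (T : JoinTree A) (D : ∀ i, List (Tup dom (A i)))
    (bot top : Fin m → List ((∀ a, dom a) × ℕ)) (p : Fin m) :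
    Timed (Fin m → List ((∀ a, dom a) × ℕ)) := do
  let rows ← readRel D p
  let rows ← match T.parent p with
    | none => do
        tick 0
        pure rows
    | some _ => do
        let j ← lookupJoin (T.sep p) rows (top p)
        mapT (fun r => do
          tick 0
          pure (r.1.1, (countOf r.2, r.1.2.2))) j
  let rows ← joinChildren T bot (T.children p) rows
  let rows ← mapT (fun r => do
    let x ← others r.2.1 r.2.2
    pure (r.1, x.1)) rows
  distribute T (T.children p) rows top

/-- The state of step III at a node: the tables that are still to be joined with the attributes
that their rows assign, and a partial result with the attributes that it assigns. -/
structure MaxState (m : ℕ) (dom : α → Type) where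
  tbl : Fin m → List ((∀ a, dom a) × ℕ)
  reg : Fin m → Finset α
  best : (∀ a, dom a) × ℕ
  bestReg : Finset α

/-- Step III at node `i`, one ear `e` of the acyclic join of the topjoin of `i` and the botjoins of
its children: for each value of the attributes shared with its witness only the row of `e`
with the largest count matters, and it is joined into the table of the witness. -/
def maxStep (A : Fin m → Finset α) (i : Fin m) (s : MaxState m dom)
    (e : Fin m × Option (Fin m)) : Timed (MaxState m dom) :=
  match e.2 with
  | some w => do
      let msg ← groupBy (A i ∩ A e.1 ∩ A w) maxRow (s.tbl e.1)
      let j ← lookupJoin (A i ∩ A e.1 ∩ A w) (s.tbl w) msg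
      let rows ← mapT (fun r => do
        match r.2 with
        | none => do
            tick 0
            pure none
        | some y => do
            tick ((A i).card + arith r.1.2 y.2)
            pure (some ((s.reg w).piecewise r.1.1 y.1, r.1.2 * y.2))) j
      ticks rows.length
      tick (A i).card
      pure { s with
        tbl := Function.update s.tbl w rows.reduceOption
        reg := Function.update s.reg w (s.reg w ∪ s.reg e.1) }
  | none => do
      let b ← bestRow (s.tbl e.1)
      match b with
      | none => do
          tick 0
          pure { s with best := (s.best.1, 0) }
      | some y => do
          tick ((A i).card + arith s.best.2 y.2)
          pure { s with
            best := (s.bestReg.piecewise s.best.1 y.1, s.best.2 * y.2)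
            bestReg := s.bestReg ∪ s.reg e.1 }

/-- Step III at node `i`: a row of the multiplicity table of `i` with the largest count. The
multiplicity table itself is not written out, it is kept as the join of the topjoin of `i` and the
botjoins of the children of `i`; this join is over the attribute sets `A i ∩ A j`, where `j`
is the parent or a child of `i`, and is processed along a GYO decomposition. -/
def nodeMax (T : JoinTree A) (bot top : Fin m → List ((∀ a, dom a) × ℕ)) (i : Fin m) :
    Timed ((∀ a, dom a) × ℕ) := do
  ticks (T.nbrs i).length
  let P ← gyo (fun j => A i ∩ A j) (2 * (T.nbrs i).length) (T.nbrs i) (T.nbrs i)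
  let s ← foldT (maxStep A i) P
    { tbl := fun j => if T.parent i = some j then top i else bot j
      reg := fun j => A i ∩ A j
      best := (fun _ => default, 1)
      bestReg := ∅ }
  pure s.best

/-- The result of the algorithm: the local sensitivity, a most sensitive tuple and its relation,
and the botjoins and topjoins. -/
structure Output (A : Fin m → Finset α) (dom : α → Type) where
  ls : ℕ
  rel : Fin m
  tuple : Tup dom (A rel)
  bot : Fin m → List ((∀ a, dom a) × ℕ)
  top : Fin m → List ((∀ a, dom a) × ℕ)

/-- Steps III and IV: the largest entry of all the multiplicity tables, with its relation. -/
def selectMax (T : JoinTree A) (bot top : Fin m → List ((∀ a, dom a) × ℕ)) :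
    Timed (Fin m × ((∀ a, dom a) × ℕ)) :=
  foldT (fun b i => do
    let r ← nodeMax T bot top i
    tick (arith b.2.2 r.2)
    if b.2.2 < r.2 then pure (i, r) else pure b)
    T.postOrder (T.root, ((fun _ => default), 0))

/-- The algorithm: botjoins from the leaves to the root, topjoins from the root to the leaves,
then the largest entry of the multiplicity tables. If there are fewer than `m - 1` tuples, then two
relations are empty, and all the multiplicity tables are. -/
def lsAcyclicJoin (T : JoinTree A) (D : ∀ i, List (Tup dom (A i))) : Timed (Output A dom) := do
  let bot ← foldT (botStep T D) T.postOrder fun _ => []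
  let top ← foldT (topStep T D bot) T.postOrder.reverse fun _ => []
  ticks (m + ∑ i, (D i).length)
  let b ← if m ≤ (∑ i, (D i).length) + 1 then selectMax T bot top
    else pure (T.root, ((fun _ => default), 0))
  tick (A b.1).card
  pure ⟨b.2.2, b.1, (A b.1).restrict b.2.1, bot, top⟩

/-- The multiplicity table of node `i`: the multiplicity of the tuple `t` in the join of the topjoin
of `i` (unless `i` is the root) and the botjoins of the children of `i`. -/
def multTable (T : JoinTree A) (bot top : Fin m → List ((∀ a, dom a) × ℕ)) (i : Fin m)
    (t : Tup dom (A i)) : ℕ :=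
  (if T.parent i = none then 1 else tableCount (T.sep i) (top i) (extend (A i) t)) *
    ((T.children i).map fun c => tableCount (T.sep c) (bot c) (extend (A i) t)).prod

end Algorithm

end Tables

end JoinLS

/-!
Inserting a copy of a tuple `t` into `R_i` adds one result for every way to join `t` with one tuple
of each other relation, and deleting a copy removes as many, or nothing; so both sensitivities are
governed by the number of these ways. As the relations that contain a given attribute form a subtree
of the join tree, the parts of the tree on the two sides of an edge share only the attributes of
that edge. Hence the number of ways is the product of the topjoin of `R_i` and of the botjoins of
its children at `t`, and the same factorization computes botjoins and topjoins from each other.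

This product is maximized by eliminating variables along a GYO decomposition of the hyperedges
`A i ∩ A j`: an ear shares only attributes of its witness with the rest, so it may be replaced by
its maximum for each value of these shared attributes, multiplied into the witness.

The tuples of `R_j`, and the rows of the tables that come from them, are sorted a bounded number of
times for each neighbour `R_i` of `R_j` in the tree and each neighbour of `R_i`. There are less than
`2 m` such pairs, and at most `d ^ 2` of them if the degrees are at most `d`.
-/

namespace JoinLS

open Timed

/-! ### Cost bounds for timed programs -/

/-- A Hoare triple with costs: the result of `x` satisfies `P`, `x` takes at most `t` steps, and its
finer cost is at most `W` per step. -/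
structure Timed.Spec {β : Type} (x : Timed β) (P : β → Prop) (t W : ℕ) : Prop where
  val : P x.val
  steps : x.steps ≤ t
  work : x.work ≤ W * x.steps

namespace Timed.Spec

variable {β γ σ : Type} {W : ℕ}

theorem mono {x : Timed β} {P Q : β → Prop} {t t' : ℕ} (h : x.Spec P t W)
    (hPQ : ∀ b, P b → Q b) (ht : t ≤ t') : x.Spec Q t' W :=
  ⟨hPQ _ h.val, h.steps.trans ht, h.work⟩

theorem mono_steps {x : Timed β} {P : β → Prop} {t t' : ℕ} (h : x.Spec P t W)
    (ht : t ≤ t') : x.Spec P t' W := h.mono (fun _ => id) ht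

theorem pure {b : β} {P : β → Prop} (h : P b) : (pure b : Timed β).Spec P 0 W :=
  ⟨h, le_rfl, Nat.zero_le _⟩

theorem bind {x : Timed β} {f : β → Timed γ} {P : β → Prop} {Q : γ → Prop} {t t' : ℕ}
    (hx : x.Spec P t W) (hf : ∀ b, P b → (f b).Spec Q t' W) : (x >>= f).Spec Q (t + t') W where
  val := (hf _ hx.val).val
  steps := Nat.add_le_add hx.steps (hf _ hx.val).steps
  work := (Nat.add_le_add hx.work (hf _ hx.val).work).trans_eq (mul_add _ _ _).symm

theorem bind_assoc {x : Timed β} {f : β → Timed γ} {g : γ → Timed σ} {P : σ → Prop} {t : ℕ}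
    (h : ((x >>= f) >>= g).Spec P t W) : (x >>= fun b => f b >>= g).Spec P t W where
  val := h.val
  steps := (add_assoc _ _ _).symm.trans_le h.steps
  work := (add_assoc _ _ _).symm.trans_le (h.work.trans_eq (congrArg (W * ·) (add_assoc _ _ _)))

theorem tick {w : ℕ} (h : w + 1 ≤ W) : (tick w).Spec (fun _ => True) 1 W :=
  ⟨trivial, le_rfl, h.trans_eq (mul_one W).symm⟩

theorem tick_pure {w : ℕ} {b : β} {P : β → Prop} (h : w + 1 ≤ W) (hb : P b) :
    (do JoinLS.tick w; Pure.pure b : Timed β).Spec P 1 W :=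
  (tick h).bind fun _ _ => pure hb

theorem ticks {q : ℕ} (h : 1 ≤ W) : (ticks q).Spec (fun _ => True) q W :=
  ⟨trivial, le_rfl, Nat.le_mul_of_pos_left q h⟩

theorem mapT {f : β → Timed γ} {g : β → γ} {t : ℕ} (hW : 1 ≤ W) :
    ∀ l : List β, (∀ b ∈ l, (f b).Spec (· = g b) t W) →
      (mapT f l).Spec (· = l.map g) (l.length * (t + 1) + 1) W
  | [], _ => (tick_pure (P := (· = [])) hW rfl).mono_steps (Nat.le_add_left _ _)
  | b :: l, h => by
      rw [List.forall_mem_cons] at h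
      refine ((tick hW).bind fun _ _ => h.1.bind fun c hc =>
        (mapT hW l h.2).bind fun r hr => pure ?_).mono_steps ?_
      · rw [hc, hr, List.map_cons]
      · rw [List.length_cons]; linarith

theorem foldT {f : σ → β → Timed σ} {cost : β → ℕ} (hW : 1 ≤ W) :
    ∀ {I : List β → σ → Prop} {s : σ} (l : List β),
      (∀ p b r, l = p ++ b :: r → ∀ s, I p s → (f s b).Spec (I (p ++ [b])) (cost b) W) →
      I [] s → (foldT f l s).Spec (I l) ((l.map fun b => cost b + 1).sum + 1) W
  | _, _, [], _, h0 => tick_pure hW h0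
  | I, _, b :: l, h, h0 => by
      have hrest := fun s' (hs' : I [b] s') => foldT (I := fun p => I (b :: p)) hW l
        (fun p b' r hl => h (b :: p) b' r (by rw [hl, List.cons_append])) hs'
      refine ((tick hW).bind fun _ _ => (h [] b l rfl _ h0).bind hrest).mono_steps ?_
      simp only [List.map_cons, List.sum_cons]
      omega

end Timed.Spec

/-! ### Acyclic hypergraphs -/

section Hypergraph

variable {α ι κ : Type} [DecidableEq α] {E : ι → Finset α} {s : Finset ι} {i j : ι} {w : Option ι}

/-- Among the hyperedges `E j`, `j ∈ s`, the hyperedge `E i` is an ear with witness `w`: it shares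
no vertices if `w` is `none`, and only vertices of `E u` if `w` is `some u`. -/
structure IsEarWitness (E : ι → Finset α) (s : Finset ι) (i : ι) (w : Option ι) : Prop where
  mem : i ∈ s
  witness_mem : ∀ u ∈ w, u ∈ s
  witness_ne : ∀ u ∈ w, u ≠ i
  inter_subset : ∀ j ∈ s, j ≠ i → E i ∩ E j ⊆ w.elim ∅ E

theorem isEar_iff_exists_witness : IsEar E s i ↔ ∃ w, IsEarWitness E s i w := by
  constructor
  · rintro ⟨hi, h | ⟨u, hu, hui, h⟩⟩
    · exact ⟨none, hi, by simp, by simp, fun j hj hji =>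
        (Finset.disjoint_iff_inter_eq_empty.1 (h j hj hji)).subset⟩
    · exact ⟨some u, hi, by simpa, by simpa, h⟩
  · rintro ⟨_ | u, hi, hu, hui, h⟩
    · exact ⟨hi, .inl fun j hj hji =>
        Finset.disjoint_iff_inter_eq_empty.2 (Finset.subset_empty.1 (h j hj hji))⟩
    · exact ⟨hi, .inr ⟨u, hu u rfl, hui u rfl, h⟩⟩

theorem IsEarWitness.isEar (h : IsEarWitness E s i w) : IsEar E s i :=
  isEar_iff_exists_witness.2 ⟨w, h⟩

theorem IsEarWitness.inter_left (h : IsEarWitness E s i w) (X : Finset α) :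
    IsEarWitness (fun j => X ∩ E j) s i w where
  mem := h.mem
  witness_mem := h.witness_mem
  witness_ne := h.witness_ne
  inter_subset j hj hji := by
    have hX : X ∩ w.elim ∅ E = w.elim ∅ fun j => X ∩ E j := by cases w <;> simp
    rw [← Finset.inter_inter_distrib_left, ← hX]
    exact Finset.inter_subset_inter_left (h.inter_subset j hj hji)

theorem IsEarWitness.image [DecidableEq κ] {F : κ → Finset α} {f : ι → κ} (hf : Set.InjOn f s)
    (hEF : ∀ j ∈ s, ∀ k ∈ s, j ≠ k → F (f j) ∩ F (f k) = E j ∩ E k)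
    (h : IsEarWitness E s i w) : IsEarWitness F (s.image f) (f i) (w.map f) where
  mem := Finset.mem_image_of_mem f h.mem
  witness_mem := by
    simpa using fun u hu => Finset.mem_image_of_mem f (h.witness_mem u hu)
  witness_ne := by
    simpa using fun u hu => hf.ne (h.witness_mem u hu) h.mem (h.witness_ne u hu)
  inter_subset := by
    simp only [Finset.forall_mem_image]
    intro j hj hji
    have hji' : j ≠ i := ne_of_apply_ne f hji
    have hsub := h.inter_subset j hj hji'
    rw [hEF i h.mem j hj hji'.symm]
    match w, h with
    | none, _ => exact hsub
    | some u, h =>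
      refine (Finset.subset_inter Finset.inter_subset_left hsub).trans ?_
      rw [Option.elim_some, ← hEF i h.mem u (h.witness_mem u rfl) (h.witness_ne u rfl).symm]
      exact Finset.inter_subset_right

section Removal

variable [DecidableEq ι]

theorem GYOAcyclic.inter_left (h : GYOAcyclic E s) (X : Finset α) :
    GYOAcyclic (fun j => X ∩ E j) s := by
  induction h with
  | empty => exact .empty
  | ear s i hi _ ih =>
    obtain ⟨w, hw⟩ := isEar_iff_exists_witness.1 hi
    exact .ear s i (hw.inter_left X).isEar ih

theorem GYOAcyclic.image [DecidableEq κ] {F : κ → Finset α} {f : ι → κ} (h : GYOAcyclic E s)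
    (hf : Set.InjOn f s) (hEF : ∀ j ∈ s, ∀ k ∈ s, j ≠ k → F (f j) ∩ F (f k) = E j ∩ E k) :
    GYOAcyclic F (s.image f) := by
  induction h with
  | empty => exact .empty
  | ear s i hi _ ih =>
    obtain ⟨w, hw⟩ := isEar_iff_exists_witness.1 hi
    have hsub : s.erase i ⊆ s := Finset.erase_subset i s
    refine .ear _ (f i) (hw.image hf hEF).isEar ?_
    rw [Finset.erase_eq, ← Finset.image_singleton,
      ← Finset.image_sdiff_of_injOn hf (Finset.singleton_subset_iff.2 hi.1), ← Finset.erase_eq]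
    exact ih (hf.mono hsub) fun j hj k hk => hEF j (hsub hj) k (hsub hk)

theorem IsEarWitness.erase {k : ι} (h : IsEarWitness E s i w) (hik : i ≠ k) (hwk : k ∉ w) :
    IsEarWitness E (s.erase k) i w where
  mem := Finset.mem_erase.2 ⟨hik, h.mem⟩
  witness_mem u hu := Finset.mem_erase.2 ⟨ne_of_mem_of_not_mem hu hwk, h.witness_mem u hu⟩
  witness_ne := h.witness_ne
  inter_subset j hj := h.inter_subset j (Finset.mem_of_mem_erase hj)

theorem IsEar.erase_or_inter_eq (hi : IsEar E s i) (hj : IsEar E s j) (hij : i ≠ j) :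
    IsEar E (s.erase j) i ∨ ∀ k ∈ s, k ≠ i → k ≠ j → E i ∩ E k = E j ∩ E k := by
  obtain ⟨w, hi⟩ := isEar_iff_exists_witness.1 hi
  obtain ⟨w', hj⟩ := isEar_iff_exists_witness.1 hj
  by_cases hw : j ∈ w
  · obtain rfl : w = some j := hw
    by_cases hw' : i ∈ w'
    · obtain rfl : w' = some i := hw'
      exact .inr fun k hk hki hkj => Finset.Subset.antisymm
        (Finset.subset_inter (hi.inter_subset k hk hki) Finset.inter_subset_right)
        (Finset.subset_inter (hj.inter_subset k hk hkj) Finset.inter_subset_right)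
    · refine .inl (isEar_iff_exists_witness.2 ⟨w', Finset.mem_erase.2 ⟨hij, hi.mem⟩,
        fun u hu => Finset.mem_erase.2 ⟨hj.witness_ne u hu, hj.witness_mem u hu⟩,
        fun u hu => ne_of_mem_of_not_mem hu hw', fun k hk hki => ?_⟩)
      obtain ⟨hkj, hk⟩ := Finset.mem_erase.1 hk
      exact (Finset.subset_inter (hi.inter_subset k hk hki) Finset.inter_subset_right).trans
        (hj.inter_subset k hk hkj)
  · exact .inl (hi.erase hij hw).isEar

theorem GYOAcyclic.erase_of_erase (h : GYOAcyclic E (s.erase j)) (hi : i ∈ s) (hj : j ∈ s)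
    (heq : ∀ k ∈ s, k ≠ i → k ≠ j → E i ∩ E k = E j ∩ E k) : GYOAcyclic E (s.erase i) := by
  have himage : (s.erase j).image (Equiv.swap i j) = s.erase i := by
    ext k
    simp only [Finset.mem_image, Finset.mem_erase]
    constructor
    · rintro ⟨l, ⟨hlj, hl⟩, rfl⟩
      rw [Equiv.swap_apply_def]
      grind
    · exact fun h => ⟨Equiv.swap i j k, by rw [Equiv.swap_apply_def]; grind,
        Equiv.swap_apply_self i j k⟩
  refine himage ▸ h.image (Equiv.swap i j).injective.injOn fun k hk l hl hkl => ?_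
  obtain ⟨hkj, hk⟩ := Finset.mem_erase.1 hk
  obtain ⟨hlj, hl⟩ := Finset.mem_erase.1 hl
  rcases eq_or_ne k i with rfl | hki
  · rw [Equiv.swap_apply_left, Equiv.swap_apply_of_ne_of_ne hkl.symm hlj, heq l hl hkl.symm hlj]
  · rcases eq_or_ne l i with rfl | hli
    · rw [Equiv.swap_apply_left, Equiv.swap_apply_of_ne_of_ne hki hkj, Finset.inter_comm,
        ← heq k hk hki hkj, Finset.inter_comm]
    · rw [Equiv.swap_apply_of_ne_of_ne hki hkj, Equiv.swap_apply_of_ne_of_ne hli hlj]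

theorem GYOAcyclic.erase (h : GYOAcyclic E s) (hi : IsEar E s i) :
    GYOAcyclic E (s.erase i) := by
  induction h with
  | empty => exact absurd hi.1 (Finset.notMem_empty i)
  | ear s j hj hs ih =>
    rcases eq_or_ne i j with rfl | hij
    · exact hs
    by_cases heq : ∀ k ∈ s, k ≠ i → k ≠ j → E i ∩ E k = E j ∩ E k
    · exact hs.erase_of_erase hi.1 hj.1 heq
    · have hi' := (hi.erase_or_inter_eq hj hij).resolve_right heq
      have hj' := (hj.erase_or_inter_eq hi hij.symm).resolve_right fun h =>
        heq fun k hk hki hkj => (h k hk hkj hki).symm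
      exact .ear _ j hj' (by rw [Finset.erase_right_comm]; exact ih hi')

theorem GYOAcyclic.exists_isEar (h : GYOAcyclic E s) (hs : s.Nonempty) : ∃ i, IsEar E s i := by
  cases h with
  | empty => exact absurd hs Finset.not_nonempty_empty
  | ear s i hi _ => exact ⟨i, hi⟩

theorem gyoAcyclic_of_card_le_two (h : s.card ≤ 2) : GYOAcyclic E s := by
  induction s using Finset.strongInduction with
  | H s ih =>
    rcases s.eq_empty_or_nonempty with rfl | ⟨i, hi⟩
    · exact .empty
    refine .ear s i ⟨hi, ?_⟩ (ih _ (Finset.erase_ssubset hi)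
      ((Finset.card_le_card (Finset.erase_subset i s)).trans h))
    have hcard : (s.erase i).card ≤ 1 := by rw [Finset.card_erase_of_mem hi]; omega
    rcases (s.erase i).eq_empty_or_nonempty with hempty | ⟨w, hw⟩
    · exact .inl fun j hj hji =>
        absurd (hempty ▸ Finset.mem_erase.2 ⟨hji, hj⟩) (Finset.notMem_empty j)
    · refine .inr ⟨w, Finset.mem_of_mem_erase hw, Finset.ne_of_mem_erase hw, fun j hj hji => ?_⟩
      rw [Finset.card_le_one.1 hcard j (Finset.mem_erase.2 ⟨hji, hj⟩) w hw]
      exact Finset.inter_subset_right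

theorem IsEarWitness.isEar_of_isEar_erase (hj : IsEarWitness E s j w) (hiw : i ∉ w)
    (hi : IsEar E (s.erase j) i) : IsEar E s i := by
  obtain ⟨u, hi⟩ := isEar_iff_exists_witness.1 hi
  obtain ⟨hij, his⟩ := Finset.mem_erase.1 hi.mem
  refine isEar_iff_exists_witness.2 ⟨u, his, fun v hv => Finset.mem_of_mem_erase
    (hi.witness_mem v hv), hi.witness_ne, fun k hk hki => ?_⟩
  rcases eq_or_ne k j with rfl | hkj
  · have hsub := hj.inter_subset i his hij
    match w, hj with
    | none, _ =>
      rw [Finset.inter_comm]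
      exact hsub.trans (Finset.empty_subset _)
    | some v, hj =>
      rw [Finset.inter_comm] at hsub
      exact (Finset.subset_inter Finset.inter_subset_left hsub).trans
        (hi.inter_subset v (Finset.mem_erase.2 ⟨hj.witness_ne v rfl, hj.witness_mem v rfl⟩)
          fun h => hiw (h ▸ rfl))
  · exact hi.inter_subset k (Finset.mem_erase.2 ⟨hkj, hk⟩) hki

end Removal

end Hypergraph

/-! ### Computing a GYO decomposition -/

section Gyo

variable {α : Type} [LinearOrder α] {ι : Type} {E : ι → Finset α}

/-- A GYO decomposition of the hyperedges in `s`: the ears in the order of their removal, with their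
witnesses. -/
inductive GYOSeq [DecidableEq ι] (E : ι → Finset α) :
    Finset ι → List (ι × Option ι) → Prop
  | nil : GYOSeq E ∅ []
  | cons {s : Finset ι} {j : ι} {w : Option ι} {P : List (ι × Option ι)}
      (hj : IsEarWitness E s j w) (hP : GYOSeq E (s.erase j) P) : GYOSeq E s ((j, w) :: P)

theorem GYOSeq.length_eq [DecidableEq ι] {s : Finset ι} {P : List (ι × Option ι)}
    (h : GYOSeq E s P) :
    P.length = s.card := by
  induction h with
  | nil => rfl
  | cons hj _ ih => rw [List.length_cons, ih, Finset.card_erase_add_one hj.mem]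

variable {k W : ℕ} (hk : ∀ j, (E j).card ≤ k) (hW : 2 * k + 1 ≤ W)

include hk hW

theorem sharedPart_spec [DecidableEq ι] {e : Finset α} (he : e.card ≤ k) : ∀ l : List ι,
    (sharedPart E e l).Spec (· = e ∩ l.toFinset.biUnion E) (l.length + 1) W
  | [] => by
      rw [sharedPart]
      exact (Spec.tick_pure (P := (· = e ∩ ∅)) (by omega) (Finset.inter_empty e).symm).mono_steps
        (Nat.le_add_left _ _)
  | w :: l => by
      rw [sharedPart]
      refine ((Spec.tick (by have := hk w; omega)).bind fun _ _ =>
        (sharedPart_spec he l).bind fun r hr => Spec.pure ?_).mono_steps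
          (by rw [List.length_cons]; omega)
      rw [hr, List.toFinset_cons, Finset.biUnion_insert, Finset.inter_union_distrib_left]

theorem findWitness_spec {e : Finset α} (he : e.card ≤ k) : ∀ l : List ι,
    (findWitness E e l).Spec
      (fun r => (r = none ∧ ∀ w ∈ l, ¬ e ⊆ E w) ∨ ∃ w ∈ l, r = some w ∧ e ⊆ E w)
      (l.length + 1) W
  | [] => by
      rw [findWitness]
      exact (Spec.tick_pure (by omega) (.inl ⟨rfl, List.forall_mem_nil _⟩)).mono_steps
        (Nat.le_add_left _ _)
  | w :: l => by
      rw [findWitness]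
      refine ((Spec.tick (by have := hk w; omega)).bind (t' := l.length + 1)
        fun _ _ => ?_).mono_steps (by rw [List.length_cons]; omega)
      split_ifs with h
      · exact (Spec.pure (.inr ⟨w, List.mem_cons_self, rfl, h⟩)).mono_steps (Nat.zero_le _)
      · refine (findWitness_spec he l).mono ?_ le_rfl
        rintro r (⟨rfl, hr⟩ | ⟨u, hu, rfl, hr⟩)
        · exact .inl ⟨rfl, List.forall_mem_cons.2 ⟨h, hr⟩⟩
        · exact .inr ⟨u, List.mem_cons_of_mem w hu, rfl, hr⟩

theorem earWitness_spec {s : Finset ι} {j : ι} {l : List ι} (hj : j ∈ s)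
    (hl : ∀ x, x ∈ l ↔ x ∈ s ∧ x ≠ j) :
    (earWitness E j l).Spec
      (fun r => (r = none ∧ ¬ IsEar E s j) ∨ ∃ w, r = some w ∧ IsEarWitness E s j w)
      (2 * l.length + 2) W := by
  classical
  have hshared : ∀ X, E j ∩ l.toFinset.biUnion E ⊆ X ↔ ∀ x ∈ s, x ≠ j → E j ∩ E x ⊆ X := by
    simp only [Finset.inter_biUnion, Finset.biUnion_subset, List.mem_toFinset, hl, and_imp,
      implies_true]
  rw [earWitness]
  refine ((sharedPart_spec hk hW (hk j) l).bind (t' := l.length + 1) ?_).mono_steps (by omega)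
  rintro _ rfl
  split_ifs with hempty
  · exact (Spec.pure (.inr ⟨none, rfl, hj, nofun, nofun, (hshared ∅).1 hempty.subset⟩)).mono_steps
      (Nat.zero_le _)
  refine (findWitness_spec hk hW ((Finset.card_le_card Finset.inter_subset_left).trans (hk j))
    l).bind (t' := 0) ?_
  rintro _ (⟨rfl, hnone⟩ | ⟨w, hw, rfl, hsub⟩)
  · refine Spec.pure (.inl ⟨rfl, fun hear => ?_⟩)
    obtain ⟨_ | w, hear⟩ := isEar_iff_exists_witness.1 hear
    · exact hempty (Finset.subset_empty.1 ((hshared _).2 hear.inter_subset))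
    · exact hnone w ((hl w).2 ⟨hear.witness_mem w rfl, hear.witness_ne w rfl⟩)
        ((hshared _).2 hear.inter_subset)
  · obtain ⟨hws, hwj⟩ := (hl w).1 hw
    refine Spec.pure (.inr ⟨some w, rfl, hj, ?_, ?_, (hshared _).1 hsub⟩)
    · rintro _ ⟨⟩
      exact hws
    · rintro _ ⟨⟩
      exact hwj

/-- The sum `cs.length + L.length` drops in each step, since the removal of an ear can turn only its
witness into a new ear. -/
theorem gyo_spec [DecidableEq ι] {ℓ : ℕ} : ∀ (q : ℕ) (cs L : List ι), L.Nodup → L.length ≤ ℓ →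
    cs.length + L.length ≤ q → (∀ j, IsEar E L.toFinset j → j ∈ cs) → GYOAcyclic E L.toFinset →
      (gyo E q cs L).Spec (GYOSeq E L.toFinset) (q * (3 * ℓ + 1) + 1) W
  | 0, cs, L, _, _, hq, _, _ => by
      rw [gyo, List.eq_nil_of_length_eq_zero (l := L) (by omega)]
      exact (Spec.tick_pure (by omega) .nil).mono_steps (Nat.le_add_left _ _)
  | q + 1, [], L, _, _, _, hear, hac => by
      rw [gyo]
      refine (Spec.tick_pure (by omega) ?_).mono_steps (Nat.le_add_left _ _)
      rw [Finset.not_nonempty_iff_eq_empty.1 fun hne =>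
        (hac.exists_isEar hne).elim fun i hi => List.not_mem_nil (hear i hi)]
      exact .nil
  | q + 1, j :: cs, L, hL, hℓ, hq, hear, hac => by
      have hq' : cs.length + L.length ≤ q := by rw [List.length_cons] at hq; omega
      have hear' : ∀ i, IsEar E L.toFinset i → i ≠ j → i ∈ cs := fun i hi hij =>
        (List.mem_cons.1 (hear i hi)).resolve_left hij
      rw [gyo]
      refine ((Spec.ticks (by omega)).bind (t' := 2 * ℓ + (q * (3 * ℓ + 1) + 1))
        fun _ _ => ?_).mono_steps (by rw [add_mul]; omega)
      split_ifs with hj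
      · have hlen := List.length_erase_add_one hj
        have herase : (L.erase j).toFinset = L.toFinset.erase j := by
          ext x
          rw [List.mem_toFinset, hL.mem_erase_iff, Finset.mem_erase, List.mem_toFinset]
        refine ((earWitness_spec hk hW (List.mem_toFinset.2 hj) (l := L.erase j) fun x => by
          rw [hL.mem_erase_iff, List.mem_toFinset, and_comm]).bind (t' := q * (3 * ℓ + 1) + 1)
          ?_).mono_steps (by omega)
        rintro _ (⟨rfl, hnear⟩ | ⟨w, rfl, hw⟩)
        · exact gyo_spec q cs L hL hℓ hq' (fun i hi => hear' i hi fun h => hnear (h ▸ hi)) hac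
        · have hwlen : w.toList.length ≤ 1 := by cases w <;> simp
          refine ((gyo_spec q (w.toList ++ cs) (L.erase j) (hL.erase j) (by omega)
            (by rw [List.length_append]; omega) (fun i hi => ?_)
            (herase ▸ hac.erase hw.isEar)).bind (t' := 0) fun P hP =>
              Spec.pure (.cons hw (herase ▸ hP)))
          rw [List.mem_append, Option.mem_toList]
          rw [herase] at hi
          exact or_iff_not_imp_left.2 fun hiw =>
            hear' i (hw.isEar_of_isEar_erase hiw hi) (Finset.ne_of_mem_erase hi.1)
      · exact (gyo_spec q cs L hL hℓ hq' (fun i hi => hear' i hi fun h =>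
          hj (List.mem_toFinset.1 (h ▸ hi.1))) hac).mono_steps (by omega)

end Gyo

/-! ### Sorting and grouping tables -/

section Tables

variable {α : Type} {dom : α → Type} {X : Type} {S : Finset α} {W Z : ℕ}

/-- Rows carrying data of type `X`. -/
abbrev Row (dom : α → Type) (X : Type) : Type := (∀ a, dom a) × X

theorem key_eq_iff {v v' : ∀ a, dom a} : key S v = key S v' ↔ ∀ a ∈ S, v a = v' a :=
  ⟨fun h a ha => congrFun (toLex.injective h) ⟨a, ha⟩, fun h => congrArg toLex (funext fun a =>
    h a a.2)⟩

theorem key_eq_mono {S' : Finset α} (hS : S ⊆ S') {v v' : ∀ a, dom a}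
    (h : key S' v = key S' v') : key S v = key S v' :=
  key_eq_iff.2 fun a ha => key_eq_iff.1 h a (hS ha)

theorem maxRow_eq_or (r r' : Row dom ℕ) : maxRow r r' = r ∨ maxRow r r' = r' :=
  ite_eq_or_eq _ _ _

theorem snd_maxRow (r r' : Row dom ℕ) : (maxRow r r').2 = max r.2 r'.2 := by
  rw [maxRow]
  split_ifs with h
  · exact (max_eq_left h).symm
  · exact (max_eq_right (le_of_not_ge h)).symm

theorem key_maxRow {r r' : Row dom ℕ} (h : key S r.1 = key S r'.1) :
    key S (maxRow r r').1 = key S r'.1 := by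
  rcases maxRow_eq_or r r' with hmax | hmax <;> rw [hmax]
  exact h

theorem arith_le {a b : ℕ} (ha : a.size ≤ Z) (hb : b.size ≤ Z) : arith a b ≤ (Z + 1) ^ 2 := by
  rw [arith, sq]
  gcongr

theorem size_mul_le (a b : ℕ) : (a * b).size ≤ a.size + b.size := by
  rw [Nat.size_le, pow_add]
  exact Nat.mul_lt_mul'' (Nat.lt_size_self a) (Nat.lt_size_self b)

theorem size_prod_le {z : ℕ} : ∀ {l : List ℕ}, (∀ x ∈ l, x.size ≤ z) →
    l.prod.size ≤ l.length * z + 1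
  | [], _ => by simp
  | x :: l, h => by
      rw [List.forall_mem_cons] at h
      have hmul := size_mul_le x l.prod
      have hprod := size_prod_le h.2
      rw [List.prod_cons, List.length_cons, add_one_mul]
      omega

theorem others_spec {z : ℕ} (hW : (Z + 1) ^ 2 + 1 ≤ W) {ι : Type} [DecidableEq ι] (f : ι → ℕ) :
    ∀ (cs : List ι) (pre : ℕ), cs.Nodup → (∀ c ∈ cs, (f c).size ≤ z) →
      pre.size + cs.length * z + 1 ≤ Z →
      (others pre (cs.map f)).Spec
        (· = (cs.map fun c => pre * ((cs.erase c).map f).prod, (cs.map f).prod))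
        (3 * cs.length + 1) W
  | [], _, _, _, _ => by
      rw [List.map_nil, others]
      exact (Spec.tick_pure (P := (· = ([], 1))) (by omega) rfl).mono_steps (Nat.le_add_left _ _)
  | c :: cs, pre, hnd, hf, hZ => by
      obtain ⟨hc, hnd⟩ := List.nodup_cons.1 hnd
      obtain ⟨hcz, hf⟩ := List.forall_mem_cons.1 hf
      have hprod : ((cs.map f).prod).size ≤ cs.length * z + 1 := by
        simpa only [List.length_map] using size_prod_le (List.forall_mem_map.2 hf)
      have hpre := size_mul_le pre (f c)
      simp only [List.length_cons, add_one_mul] at hZ ⊢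
      have harith : ∀ {a b : ℕ}, a.size ≤ Z → b.size ≤ Z → arith a b + 1 ≤ W := fun ha hb =>
        (Nat.succ_le_succ (arith_le ha hb)).trans hW
      rw [List.map_cons, others]
      refine ((Spec.tick (harith (by omega) (by omega))).bind fun _ _ =>
        (others_spec hW f cs (pre * f c) hnd hf (by omega)).bind (t' := 2) ?_).mono_steps (by omega)
      rintro _ rfl
      refine (Spec.tick (harith (b := (cs.map f).prod) (by omega) (by omega))).bind fun _ _ =>
        Spec.tick_pure (harith (b := (cs.map f).prod) (by omega) (by omega)) ?_
      have hothers : ∀ x ∈ cs, pre * f c * ((cs.erase x).map f).prod =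
          pre * (((c :: cs).erase x).map f).prod := fun x hx => by
        rw [List.erase_cons_tail (by simpa using ne_of_mem_of_not_mem hx hc |>.symm),
          List.map_cons, List.prod_cons, mul_assoc]
      rw [List.map_cons, List.erase_cons_head, List.map_congr_left hothers, List.prod_cons]

theorem bestRow_spec (hW : (Z + 1) ^ 2 + 1 ≤ W) : ∀ l : List (Row dom ℕ),
    (∀ r ∈ l, r.2.size ≤ Z) →
      (bestRow l).Spec
        (fun b => (b = none ∧ l = []) ∨ ∃ r ∈ l, b = some r ∧ ∀ r' ∈ l, r'.2 ≤ r.2)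
        (l.length + 1) W
  | [], _ => by
      rw [bestRow]
      exact (Spec.tick_pure (by omega) (.inl ⟨rfl, rfl⟩)).mono_steps (Nat.le_add_left _ _)
  | r :: l, hs => by
      obtain ⟨hr, hs⟩ := List.forall_mem_cons.1 hs
      rw [bestRow]
      refine (bestRow_spec hW l hs).bind (t' := 1) ?_
      rintro _ (⟨rfl, rfl⟩ | ⟨r', hr', rfl, hmax⟩)
      · exact Spec.tick_pure (by omega) (.inr ⟨r, List.mem_cons_self, rfl, by simp⟩)
      · have harith := arith_le hr (hs r' hr')
        refine Spec.tick_pure (by omega) (.inr ⟨_, ?_, rfl, List.forall_mem_cons.2 ?_⟩)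
        · rcases maxRow_eq_or r r' with h | h <;> rw [h]
          · exact List.mem_cons_self
          · exact List.mem_cons_of_mem r hr'
        · rw [snd_maxRow]
          exact ⟨le_max_left _ _, fun x hx => (hmax x hx).trans (le_max_right _ _)⟩

variable [∀ a, LinearOrder (dom a)]

theorem tableCount_cons (r : Row dom ℕ) (l : List (Row dom ℕ)) (v : ∀ a, dom a) :
    tableCount S (r :: l) v = (if key S r.1 = key S v then r.2 else 0) + tableCount S l v := by
  unfold tableCount
  by_cases h : key S r.1 = key S v <;> simp [h]

theorem tableCount_perm {l l' : List (Row dom ℕ)} (h : l.Perm l') (v : ∀ a, dom a) :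
    tableCount S l v = tableCount S l' v :=
  ((h.filter _).map _).sum_eq

theorem tableCount_map {τ : Type} (S : Finset α) (e : τ → ∀ a, dom a) (h : τ → ℕ)
    (v : ∀ a, dom a) : ∀ l : List τ, tableCount S (l.map fun t => (e t, h t)) v =
      (l.map fun t => if key S (e t) = key S v then h t else 0).sum
  | [] => rfl
  | t :: l => by
      rw [List.map_cons, tableCount_cons, tableCount_map S e h v l, List.map_cons, List.sum_cons]

theorem tableCount_map_of_perm {τ : Type} {vs : List (∀ a, dom a)} {e : τ → ∀ a, dom a}
    {l : List τ} (hvs : vs.Perm (l.map e)) (S : Finset α) (h : (∀ a, dom a) → ℕ) (v : ∀ a, dom a) :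
    tableCount S (vs.map fun v => (v, h v)) v =
      (l.map fun t => if key S (e t) = key S v then h (e t) else 0).sum := by
  rw [tableCount_perm (hvs.map _), List.map_map]
  exact tableCount_map S e (h ∘ e) v l

theorem tableCount_eq_zero {l : List (Row dom ℕ)} {v : ∀ a, dom a}
    (h : ∀ r ∈ l, key S r.1 ≠ key S v) : tableCount S l v = 0 := by
  unfold tableCount
  rw [List.filter_eq_nil_iff.2 (by simpa using h), List.map_nil, List.sum_nil]

/-- The row of `tbl` that joins with `v`. -/
noncomputable def lookup (S : Finset α) (tbl : List (Row dom ℕ)) (v : ∀ a, dom a) :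
    Option (Row dom ℕ) :=
  tbl.find? fun y => key S v = key S y.1

theorem mem_of_lookup_eq_some {tbl : List (Row dom ℕ)} {v : ∀ a, dom a} {y : Row dom ℕ}
    (h : lookup S tbl v = some y) : y ∈ tbl ∧ key S v = key S y.1 :=
  ⟨List.mem_of_find?_eq_some h, of_decide_eq_true (List.find?_some h :)⟩

theorem lookup_eq_none_iff {tbl : List (Row dom ℕ)} {v : ∀ a, dom a} :
    lookup S tbl v = none ↔ ∀ y ∈ tbl, key S v ≠ key S y.1 := by
  simp only [lookup, List.find?_eq_none, decide_eq_true_eq, ne_eq]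

/-- One step of `collapse`, without its cost. -/
noncomputable def insertRow (S : Finset α) (f : Row dom ℕ → Row dom ℕ → Row dom ℕ)
    (r : Row dom ℕ) : List (Row dom ℕ) → List (Row dom ℕ)
  | [] => [r]
  | r' :: o => if key S r.1 = key S r'.1 then f r r' :: o else r :: r' :: o

/-- The output of `collapse`, without its cost. -/
noncomputable def collapsed (S : Finset α) (f : Row dom ℕ → Row dom ℕ → Row dom ℕ)
    (l : List (Row dom ℕ)) : List (Row dom ℕ) :=
  l.foldr (insertRow S f) []

variable {f : Row dom ℕ → Row dom ℕ → Row dom ℕ}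

theorem collapse_spec (hW : S.card + (Z + 1) ^ 2 + 1 ≤ W) : ∀ l : List (Row dom ℕ),
    (∀ r ∈ l, r.2.size ≤ Z) → (∀ l', l' <:+ l → ∀ r ∈ collapsed S f l', r.2.size ≤ Z) →
      (collapse S f l).Spec (· = collapsed S f l) (l.length + 1) W
  | [], _, _ => by
      rw [collapse]
      exact (Spec.tick_pure (P := (· = [])) (by omega) rfl).mono_steps (Nat.le_add_left _ _)
  | r :: l, hl, hsuf => by
      rw [collapse]
      refine (collapse_spec hW l (fun x hx => hl x (List.mem_cons_of_mem r hx))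
        fun l' hl' => hsuf l' (hl'.trans (List.suffix_cons r l))).bind (t' := 1) fun out hout => ?_
      rw [collapsed, List.foldr_cons, ← collapsed, ← hout]
      match out, hout with
      | [], _ => exact Spec.tick_pure (by omega) rfl
      | r' :: o, hout =>
        have harith := arith_le (hl r List.mem_cons_self)
          (hsuf l (List.suffix_cons r l) r' (hout ▸ List.mem_cons_self))
        refine (Spec.tick (by omega)).bind (t' := 0) fun _ _ => ?_
        rw [insertRow]
        split_ifs <;> exact Spec.pure rfl

theorem tableCount_collapsed_addRow (l : List (Row dom ℕ)) (v : ∀ a, dom a) :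
    tableCount S (collapsed S addRow l) v = tableCount S l v := by
  induction l with
  | nil => rfl
  | cons r l ih =>
    rw [collapsed, List.foldr_cons, ← collapsed, tableCount_cons, ← ih]
    match collapsed S addRow l with
    | [] => rw [insertRow, tableCount_cons]
    | r' :: o =>
      rw [insertRow]
      by_cases h : key S r.1 = key S r'.1
      · rw [if_pos h]
        simp only [tableCount_cons, addRow, h]
        split_ifs <;> omega
      · rw [if_neg h, tableCount_cons]

theorem sum_collapsed_addRow (l : List (Row dom ℕ)) :
    ((collapsed S addRow l).map Prod.snd).sum = (l.map Prod.snd).sum := by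
  induction l with
  | nil => rfl
  | cons r l ih =>
    rw [collapsed, List.foldr_cons, ← collapsed, List.map_cons, List.sum_cons, ← ih]
    match collapsed S addRow l with
    | [] => rfl
    | r' :: o =>
      rw [insertRow]
      split_ifs
      · simp only [List.map_cons, List.sum_cons, addRow, add_assoc]
      · rfl

theorem mem_of_mem_collapsed_maxRow {l : List (Row dom ℕ)} {x : Row dom ℕ}
    (hx : x ∈ collapsed S maxRow l) : x ∈ l := by
  induction l generalizing x with
  | nil => exact hx
  | cons r l ih =>
    rw [collapsed, List.foldr_cons, ← collapsed] at hx
    match hout : collapsed S maxRow l with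
    | [] =>
      rw [hout, insertRow, List.mem_singleton] at hx
      exact hx ▸ List.mem_cons_self
    | r' :: o =>
      rw [hout] at hx ih
      rw [insertRow] at hx
      have := maxRow_eq_or r r'
      grind

theorem exists_mem_collapsed_maxRow {l : List (Row dom ℕ)} {x : Row dom ℕ} (hx : x ∈ l) :
    ∃ y ∈ collapsed S maxRow l, key S y.1 = key S x.1 ∧ x.2 ≤ y.2 := by
  induction l with
  | nil => exact absurd hx List.not_mem_nil
  | cons r l ih =>
    rw [collapsed, List.foldr_cons, ← collapsed]
    match hout : collapsed S maxRow l with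
    | [] =>
      rw [hout] at ih
      rw [insertRow]
      grind
    | r' :: o =>
      rw [hout] at ih
      rw [insertRow]
      have hmax := snd_maxRow r r'
      have hkey := key_maxRow (S := S) (r := r) (r' := r')
      grind

variable [LinearOrder α]

/-- The rows are sorted by their projections to `S`. -/
def SortedBy (S : Finset α) (l : List (Row dom X)) : Prop :=
  l.Pairwise fun x y => key S x.1 ≤ key S y.1

/-- The rows are sorted by their projections to `S`, which are distinct. -/
def StrictBy (S : Finset α) (l : List (Row dom X)) : Prop :=
  l.Pairwise fun x y => key S x.1 < key S y.1

theorem mergeRows_spec (hW : S.card + 1 ≤ W) : ∀ l l' : List (Row dom X),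
    (mergeRows S l l').Spec (· = l.merge l' fun x y => key S x.1 ≤ key S y.1)
      (l.length + l'.length + 1) W
  | [], l => by
      rw [mergeRows]
      exact (Spec.tick_pure (P := (· = [].merge l _)) (by omega)
        (List.nil_merge l).symm).mono_steps (Nat.le_add_left _ _)
  | x :: l, [] => by
      rw [mergeRows]
      exact (Spec.tick_pure (P := (· = (x :: l).merge [] _)) (by omega)
        (List.merge_right _).symm).mono_steps (Nat.le_add_left _ _)
  | x :: l, y :: l' => by
      simp only [mergeRows, List.cons_merge_cons, decide_eq_true_eq, List.length_cons]
      refine ((Spec.tick hW).bind (t' := l.length + l'.length + 2) fun _ _ => ?_).mono_steps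
        (by omega)
      split_ifs
      · refine ((mergeRows_spec hW l (y :: l')).bind (t' := 0) fun r hr =>
          Spec.pure (congrArg _ hr)).mono_steps (by rw [List.length_cons]; omega)
      · refine ((mergeRows_spec hW (x :: l) l').bind (t' := 0) fun r hr =>
          Spec.pure (congrArg _ hr)).mono_steps (by rw [List.length_cons]; omega)
termination_by l l' => l.length + l'.length

theorem SortedBy.merge {l l' : List (Row dom X)} (hl : SortedBy S l) (hl' : SortedBy S l') :
    SortedBy S (l.merge l' fun x y => key S x.1 ≤ key S y.1) := by
  have htotal : Std.Total fun x y : Row dom X => key S x.1 ≤ key S y.1 := ⟨fun _ _ => le_total _ _⟩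
  have htrans : IsTrans _ fun x y : Row dom X => key S x.1 ≤ key S y.1 :=
    ⟨fun _ _ _ => le_trans⟩
  exact List.Pairwise.merge hl hl'

theorem mul_clog_halves_add_le {n : ℕ} (hn : 2 ≤ n) :
    n / 2 * Nat.clog 2 (n / 2) + (n - n / 2) * Nat.clog 2 (n - n / 2) + n ≤ n * Nat.clog 2 n := by
  have hhalf : n - n / 2 = (n + 1) / 2 := by omega
  have hle : Nat.clog 2 (n / 2) ≤ Nat.clog 2 (n - n / 2) := Nat.clog_mono_right _ (by omega)
  have hclog : Nat.clog 2 n = Nat.clog 2 (n - n / 2) + 1 := by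
    rw [Nat.clog_of_two_le (by omega) hn, hhalf]
    congr 3
  calc n / 2 * Nat.clog 2 (n / 2) + (n - n / 2) * Nat.clog 2 (n - n / 2) + n
      ≤ n / 2 * Nat.clog 2 (n - n / 2) + (n - n / 2) * Nat.clog 2 (n - n / 2) + n := by gcongr
    _ = (n / 2 + (n - n / 2)) * Nat.clog 2 (n - n / 2) + n := by ring
    _ = n * Nat.clog 2 n := by rw [Nat.add_sub_cancel' (Nat.div_le_self n 2), hclog, mul_add_one]

theorem sortRows_spec_clog (hW : S.card + 1 ≤ W) (l : List (Row dom X)) :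
    (sortRows S l).Spec (fun r => r.Perm l ∧ SortedBy S r)
      (4 * (l.length * Nat.clog 2 l.length) + 1) W := by
  rw [sortRows]
  split_ifs with h
  · refine (Spec.tick_pure (by omega) ⟨.refl _, ?_⟩).mono_steps (Nat.le_add_left _ _)
    match l, h with
    | [], _ => exact .nil
    | [x], _ => exact List.pairwise_singleton _ _
  · have htake : (l.take (l.length / 2)).length = l.length / 2 := by
      rw [List.length_take]; omega
    have hdrop : (l.drop (l.length / 2)).length = l.length - l.length / 2 := List.length_drop
    have hclog := mul_clog_halves_add_le (n := l.length) (by omega)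
    refine ((Spec.ticks (by omega)).bind fun _ _ =>
      (sortRows_spec_clog hW (l.take (l.length / 2))).bind fun x hx =>
      (sortRows_spec_clog hW (l.drop (l.length / 2))).bind (t' := l.length + 1) fun y hy =>
      ((mergeRows_spec hW x y).mono ?_ ?_)).mono_steps (by rw [htake, hdrop]; omega)
    · rintro _ rfl
      refine ⟨(List.merge_perm_append _).trans ?_, hx.2.merge hy.2⟩
      exact (hx.1.append hy.1).trans (List.Perm.of_eq (List.take_append_drop _ l))
    · rw [hx.1.length_eq, hy.1.length_eq, htake, hdrop]; omega
termination_by l.length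
decreasing_by
  · simp only [List.length_take]; omega
  · simp only [List.length_drop]; omega

theorem sortRows_spec (hW : S.card + 1 ≤ W) (l : List (Row dom X)) {Λ : ℕ}
    (hΛ : Nat.clog 2 l.length ≤ Λ) :
    (sortRows S l).Spec (fun r => r.Perm l ∧ SortedBy S r) (4 * (l.length * Λ) + 1) W :=
  (sortRows_spec_clog hW l).mono_steps (by gcongr)

theorem StrictBy.tableCount_eq {l : List (Row dom ℕ)} (hl : StrictBy S l) {r : Row dom ℕ}
    (hr : r ∈ l) {v : ∀ a, dom a} (h : key S r.1 = key S v) : tableCount S l v = r.2 := by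
  induction l with
  | nil => exact absurd hr List.not_mem_nil
  | cons x l ih =>
    obtain ⟨hx, hl⟩ := List.pairwise_cons.1 hl
    rw [tableCount_cons]
    rcases List.mem_cons.1 hr with rfl | hr
    · rw [if_pos h, tableCount_eq_zero fun y hy => h ▸ (hx y hy).ne', add_zero]
    · rw [if_neg (h ▸ (hx r hr).ne), zero_add, ih hl hr]

theorem StrictBy.countOf_lookup {tbl : List (Row dom ℕ)} (h : StrictBy S tbl) (v : ∀ a, dom a) :
    countOf (lookup S tbl v) = tableCount S tbl v := by
  cases hv : lookup S tbl v with
  | none => exact (tableCount_eq_zero fun r hr => (lookup_eq_none_iff.1 hv r hr).symm).symm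
  | some y =>
    obtain ⟨hy, hkey⟩ := mem_of_lookup_eq_some hv
    exact (h.tableCount_eq hy hkey.symm).symm

/-- `g` has one row for each projection of the rows of `l` to `S` at most, and these are sorted. -/
structure Grouped (S : Finset α) (l g : List (Row dom ℕ)) : Prop where
  strict : StrictBy S g
  length_le : g.length ≤ l.length
  exists_key_eq : ∀ r ∈ g, ∃ r' ∈ l, key S r.1 = key S r'.1

theorem Grouped.of_perm {l l' g : List (Row dom ℕ)} (h : Grouped S l g) (hl : l.Perm l') :
    Grouped S l' g where
  strict := h.strict
  length_le := hl.length_eq ▸ h.length_le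
  exists_key_eq r hr := by simpa only [hl.mem_iff] using h.exists_key_eq r hr

theorem Grouped.insertRow {r : Row dom ℕ} {l g : List (Row dom ℕ)} (h : Grouped S l g)
    (hf : ∀ r r', key S r.1 = key S r'.1 → key S (f r r').1 = key S r'.1)
    (hr : ∀ r' ∈ l, key S r.1 ≤ key S r'.1) : Grouped S (r :: l) (insertRow S f r g) := by
  obtain ⟨hstrict, hlen, hkey⟩ := h
  match g with
  | [] => exact ⟨List.pairwise_singleton _ _, Nat.le_add_left _ _, List.forall_mem_singleton.2
      ⟨r, List.mem_cons_self, rfl⟩⟩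
  | r' :: o =>
    obtain ⟨hr', ho⟩ := List.pairwise_cons.1 hstrict
    have hkey' : ∀ x ∈ r' :: o, ∃ y ∈ r :: l, key S x.1 = key S y.1 := fun x hx =>
      (hkey x hx).imp fun y hy => ⟨List.mem_cons_of_mem r hy.1, hy.2⟩
    rw [JoinLS.insertRow]
    split_ifs with heq
    · refine ⟨List.pairwise_cons.2 ⟨fun x hx => hf r r' heq ▸ hr' x hx, ho⟩,
        hlen.trans (Nat.le_succ _), List.forall_mem_cons.2
          ⟨⟨r, List.mem_cons_self, (hf r r' heq).trans heq.symm⟩,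
            fun x hx => hkey' x (List.mem_cons_of_mem r' hx)⟩⟩
    · have hlt : key S r.1 < key S r'.1 := by
        obtain ⟨y, hy, hr'y⟩ := hkey r' List.mem_cons_self
        exact lt_of_le_of_ne (hr'y ▸ hr y hy) heq
      exact ⟨List.pairwise_cons.2 ⟨List.forall_mem_cons.2 ⟨hlt, fun x hx => hlt.trans (hr' x hx)⟩,
        hstrict⟩, Nat.succ_le_succ hlen, List.forall_mem_cons.2
          ⟨⟨r, List.mem_cons_self, rfl⟩, hkey'⟩⟩

theorem SortedBy.grouped_collapsed {l : List (Row dom ℕ)} (hl : SortedBy S l)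
    (hf : ∀ r r', key S r.1 = key S r'.1 → key S (f r r').1 = key S r'.1) :
    Grouped S l (collapsed S f l) := by
  induction l with
  | nil => exact ⟨.nil, le_rfl, List.forall_mem_nil _⟩
  | cons r l ih =>
    obtain ⟨hr, hl⟩ := List.pairwise_cons.1 hl
    exact (ih hl).insertRow hf hr

theorem groupBy_addRow_spec (hW : S.card + (Z + 1) ^ 2 + 1 ≤ W) (l : List (Row dom ℕ))
    (hsum : (l.map Prod.snd).sum.size ≤ Z) {Λ : ℕ} (hΛ : Nat.clog 2 l.length ≤ Λ) :
    (groupBy S addRow l).Spec (fun g => Grouped S l g ∧ ∀ v, tableCount S g v = tableCount S l v)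
      (4 * (l.length * Λ) + l.length + 2) W := by
  refine ((sortRows_spec (by omega) l hΛ).bind fun l' hl' =>
    (collapse_spec hW l' (fun r hr => ?_) fun l'' hl'' r hr => ?_).mono
      (t' := l.length + 1) ?_ ?_).mono_steps (by omega)
  · rw [← (hl'.1.map Prod.snd).sum_eq] at hsum
    exact (Nat.size_le_size (List.le_sum_of_mem (List.mem_map_of_mem hr))).trans hsum
  · rw [← (hl'.1.map Prod.snd).sum_eq] at hsum
    refine (Nat.size_le_size ((List.le_sum_of_mem (List.mem_map_of_mem hr)).trans ?_)).trans hsum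
    rw [sum_collapsed_addRow]
    exact (hl''.sublist.map Prod.snd).sum_le_sum fun _ _ => Nat.zero_le _
  · rintro _ rfl
    exact ⟨(hl'.2.grouped_collapsed (f := addRow) fun _ _ h => h).of_perm hl'.1,
      fun v => (tableCount_collapsed_addRow l' v).trans (tableCount_perm hl'.1 v)⟩
  · rw [hl'.1.length_eq]

theorem groupBy_maxRow_spec (hW : S.card + (Z + 1) ^ 2 + 1 ≤ W) (l : List (Row dom ℕ))
    (hsize : ∀ r ∈ l, r.2.size ≤ Z) {Λ : ℕ} (hΛ : Nat.clog 2 l.length ≤ Λ) :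
    (groupBy S maxRow l).Spec (fun g => Grouped S l g ∧ (∀ r ∈ g, r ∈ l) ∧
        ∀ r ∈ l, ∃ r' ∈ g, key S r'.1 = key S r.1 ∧ r.2 ≤ r'.2)
      (4 * (l.length * Λ) + l.length + 2) W := by
  refine ((sortRows_spec (by omega) l hΛ).bind fun l' hl' =>
    (collapse_spec hW l' (fun r hr => hsize r (hl'.1.mem_iff.1 hr)) fun l'' hl'' r hr => ?_).mono
      (t' := l.length + 1) ?_ ?_).mono_steps (by omega)
  · exact hsize r (hl'.1.mem_iff.1 (hl''.subset (mem_of_mem_collapsed_maxRow hr)))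
  · rintro _ rfl
    exact ⟨(hl'.2.grouped_collapsed fun _ _ => key_maxRow).of_perm hl'.1,
      fun r hr => hl'.1.mem_iff.1 (mem_of_mem_collapsed_maxRow hr),
      fun r hr => exists_mem_collapsed_maxRow (hl'.1.mem_iff.2 hr)⟩
  · rw [hl'.1.length_eq]

theorem mergeLookup_spec (hW : S.card + 1 ≤ W) :
    ∀ (l : List (Row dom X)) (tbl : List (Row dom ℕ)), SortedBy S l → StrictBy S tbl →
      (mergeLookup S l tbl).Spec (· = l.map fun x => (x, lookup S tbl x.1))
        (l.length + tbl.length + 1) W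
  | [], _, _, _ => by
      rw [mergeLookup]
      exact (Spec.tick_pure (P := (· = [])) (by omega) rfl).mono_steps (Nat.le_add_left _ _)
  | x :: l, [], hl, ht => by
      rw [mergeLookup]
      refine ((Spec.tick (by omega)).bind fun _ _ =>
        (mergeLookup_spec hW l [] (List.pairwise_cons.1 hl).2 ht).bind (t' := 0) fun r hr =>
          Spec.pure ?_).mono_steps (by simp only [List.length_cons]; omega)
      rw [hr, List.map_cons, lookup, List.find?_nil]
  | x :: l, y :: tbl, hl, ht => by
      obtain ⟨hx, hl'⟩ := List.pairwise_cons.1 hl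
      obtain ⟨hy, ht'⟩ := List.pairwise_cons.1 ht
      have hcons : ∀ {o}, lookup S (y :: tbl) x.1 = o →
          (do let r ← mergeLookup S l (y :: tbl); pure ((x, o) :: r) : Timed _).Spec
            (· = (x :: l).map fun z => (z, lookup S (y :: tbl) z.1))
            (l.length + tbl.length + 2) W := fun h =>
        ((mergeLookup_spec hW l (y :: tbl) hl' ht).bind (t' := 0) fun r hr =>
          Spec.pure (by rw [hr, List.map_cons, h])).mono_steps
            (by rw [List.length_cons]; omega)
      rw [mergeLookup]
      refine ((Spec.tick hW).bind (t' := l.length + tbl.length + 2) fun _ _ => ?_).mono_steps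
        (by simp only [List.length_cons]; omega)
      split_ifs with h h'
      · exact hcons (List.find?_cons_of_pos (decide_eq_true h))
      · have hlt := lt_of_le_of_ne h' h
        exact hcons (lookup_eq_none_iff.2
          (List.forall_mem_cons.2 ⟨h, fun z hz => (hlt.trans (hy z hz)).ne⟩))
      · refine (mergeLookup_spec hW (x :: l) tbl hl ht').mono ?_
          (by rw [List.length_cons]; omega)
        rintro _ rfl
        refine List.map_congr_left fun z hz => ?_
        have hne : key S z.1 ≠ key S y.1 := by
          rcases List.mem_cons.1 hz with rfl | hz
          · exact h
          · exact ((not_le.1 h').trans_le (hx z hz)).ne'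
        rw [lookup, lookup, List.find?_cons_of_neg (by simpa only [decide_eq_true_eq])]
termination_by l tbl => l.length + tbl.length

theorem lookupJoin_spec (hW : S.card + 1 ≤ W) (rows : List (Row dom X)) {tbl : List (Row dom ℕ)}
    (ht : StrictBy S tbl) {Λ : ℕ} (hΛ : Nat.clog 2 rows.length ≤ Λ) :
    (lookupJoin S rows tbl).Spec (fun r => r.Perm (rows.map fun x => (x, lookup S tbl x.1)))
      (4 * (rows.length * Λ) + rows.length + tbl.length + 2) W := by
  refine ((sortRows_spec hW rows hΛ).bind fun l hl => (mergeLookup_spec hW l tbl hl.2 ht).mono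
    (t' := rows.length + tbl.length + 1) ?_ ?_).mono_steps (by omega)
  · rintro _ rfl
    exact hl.1.map _
  · rw [hl.1.length_eq]

end Tables

/-! ### Tuple sensitivities as numbers of joining tuples -/

section Glue

variable {α : Type} [DecidableEq α] {dom : α → Type} {S T U : Finset α} {u v w : ∀ a, dom a}

theorem key_inter_piecewise_iff (h : key (S ∩ T) w = key (S ∩ T) v) :
    key ((S ∪ T) ∩ U) u = key ((S ∪ T) ∩ U) (S.piecewise v w) ↔
      key (S ∩ U) u = key (S ∩ U) v ∧ key (T ∩ U) u = key (T ∩ U) w := by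
  simp only [key_eq_iff, Finset.mem_inter, Finset.mem_union, Finset.piecewise] at *
  grind

theorem key_eq_and_key_eq_iff :
    key S u = key S v ∧ key T u = key T w ↔
      key (S ∩ T) w = key (S ∩ T) v ∧ key (S ∪ T) u = key (S ∪ T) (S.piecewise v w) := by
  simp only [key_eq_iff, Finset.mem_inter, Finset.mem_union, Finset.piecewise] at *
  grind

end Glue

section JoinCount

variable {α : Type} [LinearOrder α] {dom : α → Type} [∀ a, Inhabited (dom a)]

theorem extend_apply {S : Finset α} (t : Tup dom S) {a : α} (h : a ∈ S) :
    extend S t a = t ⟨a, h⟩ :=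
  dif_pos h

theorem key_extend {S T : Finset α} (h : S ⊆ T) (t : Tup dom T) :
    key S (extend T t) = toLex (Finset.restrict₂ h t) :=
  congrArg toLex (funext fun a => extend_apply t (h a.2))

theorem restrict₂_eq_iff {S T : Finset α} (h : S ⊆ T) (s : Tup dom T) (t : Tup dom S) :
    Finset.restrict₂ h s = t ↔ key S (extend T s) = key S (extend S t) := by
  rw [key_extend h, key_extend subset_rfl, toLex_inj]
  rfl

variable [∀ a, LinearOrder (dom a)] {ι : Type} {A : ι → Finset α}

/-- The number of ways to choose one tuple from each of the listed relations such that these tuples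
agree with each other, and with `v` on `S`. -/
noncomputable def joinCount (D : ∀ i, List (Tup dom (A i))) :
    List ι → Finset α → (∀ a, dom a) → ℕ
  | [], _, _ => 1
  | j :: U, S, v => ((D j).map fun t =>
      if key (S ∩ A j) (extend (A j) t) = key (S ∩ A j) v then
        joinCount D U (S ∪ A j) (S.piecewise v (extend (A j) t)) else 0).sum

variable {D : ∀ i, List (Tup dom (A i))}

theorem joinCount_congr : ∀ {U : List ι} {S S' : Finset α} {v v' : ∀ a, dom a},
    (∀ j ∈ U, S ∩ A j = S' ∩ A j) → (∀ j ∈ U, key (S ∩ A j) v = key (S ∩ A j) v') →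
      joinCount D U S v = joinCount D U S' v'
  | [], _, _, _, _, _, _ => rfl
  | j :: U, S, S', v, v', hS, hv => by
      obtain ⟨hSj, hS⟩ := List.forall_mem_cons.1 hS
      obtain ⟨hvj, hv⟩ := List.forall_mem_cons.1 hv
      unfold joinCount
      refine congrArg List.sum (List.map_congr_left fun t _ => ?_)
      rw [hvj, hSj, joinCount_congr (S' := S' ∪ A j) (v' := S'.piecewise v' (extend (A j) t))
        (fun k hk => by rw [Finset.union_inter_distrib_right, hS k hk,
          ← Finset.union_inter_distrib_right]) fun k hk => ?_]
      have hmem : ∀ a ∈ A k, (a ∈ S ↔ a ∈ S') := fun a ha => by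
        simpa only [Finset.mem_inter, ha, and_true] using Finset.ext_iff.1 (hS k hk) a
      have hkey := key_eq_iff.1 (hv k hk)
      simp only [key_eq_iff, Finset.mem_inter, Finset.piecewise] at hkey ⊢
      grind

theorem joinCount_cons_cons (j k : ι) (U : List ι) (S : Finset α) (v : ∀ a, dom a) :
    joinCount D (j :: k :: U) S v = ((D j).map fun t => ((D k).map fun t' =>
      if key (S ∩ A j) (extend (A j) t) = key (S ∩ A j) v ∧
          key (S ∩ A k) (extend (A k) t') = key (S ∩ A k) v ∧
          key (A j ∩ A k) (extend (A k) t') = key (A j ∩ A k) (extend (A j) t) then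
        joinCount D U (S ∪ A j ∪ A k)
          ((S ∪ A j).piecewise (S.piecewise v (extend (A j) t)) (extend (A k) t'))
      else 0).sum).sum := by
  rw [joinCount]
  refine congrArg List.sum (List.map_congr_left fun t _ => ?_)
  split_ifs with h
  · simp only [joinCount, key_inter_piecewise_iff h, h, true_and]
  · simp only [h, false_and, if_false, List.map_const', List.sum_replicate, smul_zero]

theorem joinCount_swap (j k : ι) (U : List ι) (S : Finset α) (v : ∀ a, dom a) :
    joinCount D (j :: k :: U) S v = joinCount D (k :: j :: U) S v := by
  rw [joinCount_cons_cons, joinCount_cons_cons]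
  simp only [← Multiset.sum_coe, ← Multiset.map_coe]
  rw [Multiset.sum_map_sum_map]
  refine congrArg Multiset.sum (Multiset.map_congr rfl fun t' _ =>
    congrArg Multiset.sum (Multiset.map_congr rfl fun t _ => ?_))
  refine if_ctx_congr ?_ (fun h => ?_) fun _ => rfl
  · rw [Finset.inter_comm (A k), and_left_comm, eq_comm (a := key (A j ∩ _) _)]
  have hagree := key_eq_iff.1 h.2.2
  refine joinCount_congr (fun _ _ => by rw [Finset.union_right_comm]) fun i _ => ?_
  simp only [key_eq_iff, Finset.mem_inter, Finset.mem_union, Finset.piecewise] at hagree ⊢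
  grind

theorem joinCount_perm {U U' : List ι} (h : U.Perm U') :
    ∀ (S : Finset α) (v : ∀ a, dom a), joinCount D U S v = joinCount D U' S v := by
  induction h with
  | nil => exact fun _ _ => rfl
  | cons j _ ih => intro S v; simp only [joinCount, ih]
  | swap j k U => exact joinCount_swap k j U
  | trans _ _ ih ih' => exact fun S v => (ih S v).trans (ih' S v)

theorem joinCount_append : ∀ (U U' : List ι) {S : Finset α} (v : ∀ a, dom a),
    (∀ j ∈ U, ∀ k ∈ U', A j ∩ A k ⊆ S) →
      joinCount D (U ++ U') S v = joinCount D U S v * joinCount D U' S v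
  | [], _, _, _, _ => (one_mul _).symm
  | j :: U, U', S, v, h => by
      obtain ⟨hj, h⟩ := List.forall_mem_cons.1 h
      rw [List.cons_append, joinCount, joinCount, ← List.sum_map_mul_right]
      refine congrArg List.sum (List.map_congr_left fun t _ => ?_)
      rw [ite_mul, zero_mul, joinCount_append U U' _ fun j hj k hk =>
        (h j hj k hk).trans Finset.subset_union_left]
      congr 2
      refine joinCount_congr (fun k hk => ?_) fun k hk => ?_
      · rw [Finset.union_inter_distrib_right, Finset.union_eq_left]
        exact Finset.subset_inter (hj k hk) Finset.inter_subset_right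
      · refine key_eq_iff.2 fun a ha => Finset.piecewise_eq_of_mem _ _ _ ?_
        rw [Finset.union_inter_distrib_right] at ha
        exact (Finset.mem_union.1 ha).elim (Finset.mem_of_mem_inter_left ·) (hj k hk ·)

theorem joinCount_flatMap {κ : Type} (f : κ → List ι) {S : Finset α} (v : ∀ a, dom a) :
    ∀ cs : List κ, cs.Pairwise (fun c c' => ∀ j ∈ f c, ∀ k ∈ f c', A j ∩ A k ⊆ S) →
      joinCount D (cs.flatMap f) S v = (cs.map fun c => joinCount D (f c) S v).prod
  | [], _ => rfl
  | c :: cs, h => by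
      obtain ⟨hc, hcs⟩ := List.pairwise_cons.1 h
      rw [List.flatMap_cons, joinCount_append, joinCount_flatMap f v cs hcs, List.map_cons,
        List.prod_cons]
      intro j hj k hk
      obtain ⟨c', hc', hk⟩ := List.mem_flatMap.1 hk
      exact hc c' hc' j hj k hk

theorem joinCount_cons_of_subset (j : ι) (U : List ι) {S : Finset α} (v : ∀ a, dom a)
    (hS : S ⊆ A j) :
    joinCount D (j :: U) S v = ((D j).map fun t =>
      if key S (extend (A j) t) = key S v then
        joinCount D U (A j) (extend (A j) t) else 0).sum := by
  rw [joinCount, Finset.inter_eq_left.2 hS, Finset.union_eq_right.2 hS]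
  refine congrArg List.sum (List.map_congr_left fun t _ =>
    if_ctx_congr Iff.rfl (fun h => joinCount_congr (fun _ _ => rfl) fun k _ =>
      key_eq_iff.2 fun a _ => ?_) fun _ => rfl)
  by_cases ha : a ∈ S
  · rw [Finset.piecewise_eq_of_mem _ _ _ ha, key_eq_iff.1 h a ha]
  · rw [Finset.piecewise_eq_of_notMem _ _ _ ha]

theorem joinCount_le {n : ℕ} (hn : ∀ j, (D j).length ≤ n) :
    ∀ (U : List ι) (S : Finset α) (v : ∀ a, dom a), joinCount D U S v ≤ n ^ U.length
  | [], _, _ => le_rfl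
  | j :: U, S, v => by
      rw [joinCount, List.length_cons, pow_succ']
      refine (List.sum_le_card_nsmul _ (n ^ U.length) ?_).trans ?_
      · simp only [List.forall_mem_map]
        intro t _
        split_ifs
        · exact joinCount_le hn U _ _
        · exact Nat.zero_le _
      · rw [List.length_map, smul_eq_mul]
        exact Nat.mul_le_mul_right _ (hn j)

theorem joinCount_eq_zero {j : ι} (hj : D j = []) : ∀ {U : List ι}, j ∈ U →
    ∀ (S : Finset α) (v : ∀ a, dom a), joinCount D U S v = 0
  | k :: U, h, S, v => by
      rw [joinCount]
      rcases List.mem_cons.1 h with rfl | h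
      · rw [hj, List.map_nil, List.sum_nil]
      · simp only [joinCount_eq_zero hj h, ite_self, List.map_const', List.sum_replicate,
          smul_zero]

end JoinCount

section Sensitivity

variable {α : Type} [LinearOrder α] {dom : α → Type} [∀ a, LinearOrder (dom a)] {m : ℕ}
  {A : Fin m → Finset α}

section Bags

variable (bag : ∀ i, Multiset (Tup dom (A i)))

theorem result_update (i : Fin m) (x : Multiset (Tup dom (A i))) (s : Tup dom (allAttrs A)) :
    result (Function.update bag i x) s =
      x.count (Finset.restrict₂ (subset_allAttrs A i) s) * ∏ j ∈ Finset.univ.erase i,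
        (bag j).count (Finset.restrict₂ (subset_allAttrs A j) s) := by
  rw [result, ← Finset.mul_prod_erase _ _ (Finset.mem_univ i), Function.update_self]
  refine congrArg _ (Finset.prod_congr rfl fun j hj => ?_)
  rw [Function.update_of_ne (Finset.ne_of_mem_erase hj)]

theorem result_eq_mul (i : Fin m) (s : Tup dom (allAttrs A)) :
    result bag s = (bag i).count (Finset.restrict₂ (subset_allAttrs A i) s) *
      ∏ j ∈ Finset.univ.erase i, (bag j).count (Finset.restrict₂ (subset_allAttrs A j) s) := by
  rw [← result_update, Function.update_eq_self]

theorem upSens_eq_finsum (i : Fin m) (t : Tup dom (A i)) :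
    upSens bag i t = ∑ᶠ s : Tup dom (allAttrs A),
      if Finset.restrict₂ (subset_allAttrs A i) s = t then ∏ j ∈ Finset.univ.erase i,
        (bag j).count (Finset.restrict₂ (subset_allAttrs A j) s) else 0 := by
  refine finsum_congr fun s => ?_
  rw [result_update, result_eq_mul bag i, Multiset.count_cons, add_mul, ite_mul, one_mul, zero_mul,
    Nat.add_sub_cancel_left, Nat.sub_add_eq, Nat.sub_self, Nat.zero_sub, add_zero]

theorem downSens_le_upSens (i : Fin m) (t : Tup dom (A i)) :
    downSens bag i t ≤ upSens bag i t := by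
  by_cases ht : t ∈ bag i
  · rw [upSens_eq_finsum]
    refine (finsum_congr fun s => ?_).le
    rw [result_update, result_eq_mul bag i, ← Nat.sub_mul, ← Nat.sub_mul, ← add_mul]
    split_ifs with h
    · have hpos := Multiset.count_pos.2 ht
      rw [h, Multiset.count_erase_self, Nat.sub_sub_self hpos,
        Nat.sub_eq_zero_of_le (Nat.sub_le _ _), Nat.succ_eq_one_add, add_zero, add_zero, one_mul]
    · rw [Multiset.count_erase_of_ne h, Nat.sub_self, add_zero, zero_mul]
  · rw [downSens, Multiset.erase_of_notMem ht, Function.update_eq_self, symmDiffCard]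
    simp only [Nat.sub_self, add_zero, finsum_zero, Nat.zero_le]

theorem tupleSens_eq_upSens (i : Fin m) (t : Tup dom (A i)) :
    tupleSens bag i t = upSens bag i t :=
  max_eq_left (downSens_le_upSens bag i t)

end Bags

theorem hasSum_list_sum {β τ : Type} {g : τ → β → ℕ} {N : τ → ℕ} :
    ∀ {l : List τ}, (∀ t ∈ l, HasSum (g t) (N t)) →
      HasSum (fun s => (l.map fun t => g t s).sum) (l.map N).sum
  | [], _ => hasSum_zero
  | _ :: _, h => (List.forall_mem_cons.1 h).1.add (hasSum_list_sum (List.forall_mem_cons.1 h).2)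

theorem count_mul_eq_sum {β : Type} [DecidableEq β] (b : β) (c : ℕ) (l : List β) :
    l.count b * c = (l.map fun x => if x = b then c else 0).sum := by
  induction l with
  | nil => rw [List.count_nil, zero_mul, List.map_nil, List.sum_nil]
  | cons x l ih =>
    rw [List.count_cons, add_mul, ih, List.map_cons, List.sum_cons, add_comm, ite_mul, one_mul,
      zero_mul]
    simp only [beq_iff_eq]

variable [∀ a, Inhabited (dom a)] (D : ∀ i, List (Tup dom (A i)))

/-- The query result over the listed relations, restricted to the tuples that agree with `v`
on `S`. -/
noncomputable def partialResult (U : List (Fin m)) (S : Finset α) (v : ∀ a, dom a)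
    (s : Tup dom (allAttrs A)) : ℕ :=
  if key S (extend (allAttrs A) s) = key S v then
    (U.map fun j => (D j).count (Finset.restrict₂ (subset_allAttrs A j) s)).prod else 0

theorem partialResult_cons (j : Fin m) (U : List (Fin m)) (S : Finset α) (v : ∀ a, dom a)
    (s : Tup dom (allAttrs A)) :
    partialResult D (j :: U) S v s = ((D j).map fun t =>
      if key (S ∩ A j) (extend (A j) t) = key (S ∩ A j) v then
        partialResult D U (S ∪ A j) (S.piecewise v (extend (A j) t)) s else 0).sum := by
  rw [partialResult, List.map_cons, List.prod_cons, count_mul_eq_sum]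
  simp only [partialResult, ← ite_and, eq_comm (b := Finset.restrict₂ _ s), restrict₂_eq_iff,
    ← key_eq_and_key_eq_iff]
  split_ifs with h
  · simp only [h, true_and]
  · simp only [h, false_and, if_false, List.map_const', List.sum_replicate, smul_zero]

theorem hasSum_partialResult : ∀ {U : List (Fin m)} {S : Finset α} (v : ∀ a, dom a),
    S ⊆ allAttrs A → (∀ a ∈ allAttrs A, a ∈ S ∨ ∃ j ∈ U, a ∈ A j) →
      HasSum (partialResult D U S v) (joinCount D U S v)
  | [], S, v, hS, hall => by
      obtain rfl : S = allAttrs A := hS.antisymm fun a ha => by simpa using hall a ha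
      have hkey (s : Tup dom (allAttrs A)) : key (allAttrs A) (extend (allAttrs A) s) =
          key (allAttrs A) v ↔ s = (allAttrs A).restrict v := by
        rw [key_extend subset_rfl, key, toLex_inj]
        rfl
      have hresult : partialResult D [] (allAttrs A) v = fun s =>
          if s = (allAttrs A).restrict v then 1 else 0 := funext fun s => by
        simp only [partialResult, hkey, List.map_nil, List.prod_nil]
      rw [hresult]
      exact hasSum_ite_eq _ _
  | j :: U, S, v, hS, hall => by
      rw [joinCount, funext (partialResult_cons D j U S v)]
      refine hasSum_list_sum fun t _ => ?_
      split_ifs with h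
      · refine hasSum_partialResult _ (Finset.union_subset hS (subset_allAttrs A j)) fun a ha => ?_
        have := hall a ha
        simp only [List.mem_cons, exists_eq_or_imp] at this
        rwa [Finset.mem_union, or_assoc]
      · exact hasSum_zero

theorem upSens_eq_joinCount (i : Fin m) (t : Tup dom (A i)) :
    upSens (fun i => (D i : Multiset (Tup dom (A i)))) i t =
      joinCount D (Finset.univ.erase i).toList (A i) (extend (A i) t) := by
  have hresult : partialResult D (Finset.univ.erase i).toList (A i) (extend (A i) t) = fun s =>
      if Finset.restrict₂ (subset_allAttrs A i) s = t then ∏ j ∈ Finset.univ.erase i,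
        (D j).count (Finset.restrict₂ (subset_allAttrs A j) s) else 0 := by
    funext s
    simp only [partialResult, restrict₂_eq_iff, Finset.prod_map_toList]
  have hall : ∀ a ∈ allAttrs A, a ∈ A i ∨ ∃ j ∈ (Finset.univ.erase i).toList, a ∈ A j := by
    intro a ha
    obtain ⟨j, -, hj⟩ := Finset.mem_biUnion.1 ha
    by_cases hji : j = i
    · exact .inl (hji ▸ hj)
    · exact .inr ⟨j, by simp [hji], hj⟩
  have hsum := hasSum_partialResult D (extend (A i) t) (subset_allAttrs A i) hall
  rw [upSens_eq_finsum, ← hsum.tsum_eq, tsum_eq_finsum, hresult]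
  · simp only [Multiset.coe_count]
  · refine (finite_support_result (Function.update (fun i => (D i : Multiset (Tup dom (A i)))) i
      {t})).subset fun s hs => ?_
    rw [hresult, Function.mem_support, ite_ne_right_iff] at hs
    simpa only [Function.mem_support, result_update, hs.1, Multiset.count_singleton_self, one_mul,
      Multiset.coe_count] using hs.2

end Sensitivity

/-! ### Join trees -/

namespace JoinTree

variable {α : Type} [DecidableEq α] {m : ℕ} {A : Fin m → Finset α} {T : JoinTree A}

section Order

variable (T)

theorem mem_postOrder (i : Fin m) : i ∈ T.postOrder :=
  List.mem_ofFn.2 ⟨T.elim.symm i, T.elim.apply_symm_apply i⟩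

theorem nodup_postOrder : T.postOrder.Nodup :=
  List.nodup_ofFn.2 T.elim.injective

theorem pairwise_postOrder : T.postOrder.Pairwise fun i j => T.elim.symm i < T.elim.symm j :=
  List.pairwise_ofFn.2 fun i j h => by simpa only [Equiv.symm_apply_apply] using h

variable {T} in
theorem mem_left_iff {i j : Fin m} {l r : List (Fin m)} (h : T.postOrder = l ++ i :: r) :
    j ∈ l ↔ T.elim.symm j < T.elim.symm i := by
  have hpw := T.pairwise_postOrder
  have hj := T.mem_postOrder j
  rw [h, List.pairwise_append, List.pairwise_cons] at hpw
  grind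

variable {T} in
theorem mem_right_iff {i j : Fin m} {l r : List (Fin m)} (h : T.postOrder = l ++ i :: r) :
    j ∈ r ↔ T.elim.symm i < T.elim.symm j := by
  have hpw := T.pairwise_postOrder
  have hj := T.mem_postOrder j
  rw [h, List.pairwise_append, List.pairwise_cons] at hpw
  grind

theorem sum_map_postOrder (f : Fin m → ℕ) : (T.postOrder.map f).sum = ∑ i, f i := by
  rw [postOrder, List.map_ofFn, List.sum_ofFn]
  exact Equiv.sum_comp T.elim f

theorem mem_children {i c : Fin m} : c ∈ T.children i ↔ T.parent c = some i := by
  simp only [children, List.mem_filter, T.mem_postOrder, true_and, decide_eq_true_eq]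

theorem nodup_children (i : Fin m) : (T.children i).Nodup :=
  T.nodup_postOrder.filter _

theorem mem_nbrs {i j : Fin m} : j ∈ T.nbrs i ↔ T.parent i = some j ∨ T.parent j = some i := by
  simp only [nbrs, List.mem_append, Option.mem_toList, mem_children]

theorem nodup_nbrs (i : Fin m) : (T.nbrs i).Nodup := by
  have hparent : (T.parent i).toList.Nodup := by cases T.parent i <;> simp
  refine hparent.append (T.nodup_children i) fun j hj hj' => ?_
  exact lt_asymm (T.parent_later i j (Option.mem_toList.1 hj))
    (T.parent_later j i (T.mem_children.1 hj'))

theorem sep_eq {i p : Fin m} (h : T.parent i = some p) : T.sep i = A i ∩ A p := by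
  rw [sep, h]

theorem sep_subset (i : Fin m) : T.sep i ⊆ A i := by
  rw [sep]
  split
  · exact Finset.inter_subset_left
  · exact subset_rfl

theorem parent_induction {P : Fin m → Prop}
    (h : ∀ i, (∀ p, T.parent i = some p → P p) → P i) (i : Fin m) : P i :=
  (InvImage.wf T.elim.symm (wellFounded_gt (α := Fin m))).induction i fun i ih =>
    h i fun p hp => ih p (T.parent_later i p hp)

end Order

section Desc

variable (T) in
/-- `T.Desc c x`: the node `x` is `c` or a descendant of `c`. -/
def Desc (c x : Fin m) : Prop :=
  Relation.ReflTransGen (fun y z => T.parent y = some z) x c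

theorem Desc.refl (c : Fin m) : T.Desc c c :=
  Relation.ReflTransGen.refl

variable (T) in
theorem desc_root : ∀ x, T.Desc T.root x :=
  T.parent_induction fun x ih => by
    cases hp : T.parent x with
    | none => exact (T.parent_eq_none x).1 hp ▸ .refl _
    | some p => exact .head hp (ih p hp)

variable {c c' p x y : Fin m}

theorem Desc.elim_symm_le (h : T.Desc c x) : T.elim.symm x ≤ T.elim.symm c := by
  induction h with
  | refl => exact le_rfl
  | tail _ h ih => exact ih.trans (T.parent_later _ _ h).le

theorem Desc.eq_or_exists_child (h : T.Desc c x) : x = c ∨ ∃ y, T.parent y = some c ∧ T.Desc y x :=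
  (Relation.ReflTransGen.cases_tail h).imp Eq.symm fun ⟨y, hy, hc⟩ => ⟨y, hc, hy⟩

theorem Desc.parent (h : T.Desc c x) (hne : x ≠ c) (hx : T.parent x = some y) : T.Desc c y := by
  obtain ⟨z, hz, h⟩ := (Relation.ReflTransGen.cases_head h).resolve_left hne
  exact Option.some.inj (hx.symm.trans hz) ▸ h

theorem not_desc_of_parent (h : T.parent c = some p) : ¬ T.Desc c p :=
  fun hd => hd.elim_symm_le.not_gt (T.parent_later c p h)

theorem Desc.total (h : T.Desc c x) (h' : T.Desc c' x) : T.Desc c c' ∨ T.Desc c' c :=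
  (Relation.ReflTransGen.total_of_right_unique
    (fun _ _ _ hy hz => Option.some.inj (hy.symm.trans hz)) h h').symm

theorem not_desc_of_siblings (hc : T.parent c = some p) (hc' : T.parent c' = some p)
    (hne : c ≠ c') (h : T.Desc c x) : ¬ T.Desc c' x := by
  intro h'
  rcases h.total h' with h | h
  · exact not_desc_of_parent hc (h.parent hne.symm hc')
  · exact not_desc_of_parent hc' (h.parent hne hc)

/-- The common ancestor `r` is the last removed of the nodes whose relations contain `a`. -/
theorem exists_forall_reflTransGen {a : α} (ha : a ∈ A x) :
    ∃ r, ∀ y, a ∈ A y →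
      Relation.ReflTransGen (fun y z => T.parent y = some z ∧ a ∈ A z) y r := by
  obtain ⟨r, hr, hmax⟩ := (Finset.univ.filter fun y => a ∈ A y).exists_max_image T.elim.symm
    ⟨x, Finset.mem_filter.2 ⟨Finset.mem_univ x, ha⟩⟩
  simp only [Finset.mem_filter, Finset.mem_univ, true_and] at hr hmax
  refine ⟨r, T.parent_induction fun y ih hy => ?_⟩
  by_cases hyr : y = r
  · exact hyr ▸ .refl
  have hlt := lt_of_le_of_ne (hmax y hy) (T.elim.symm.injective.ne hyr)
  cases hp : T.parent y with
  | none =>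
    rw [(T.parent_eq_none y).1 hp] at hlt
    exact absurd hlt (T.desc_root r).elim_symm_le.not_gt
  | some q =>
    have haq := T.ear y q hp r hlt (Finset.mem_inter.2 ⟨hy, hr⟩)
    exact .head ⟨hp, haq⟩ (ih q hp haq)

theorem inter_subset_of_desc (hc : T.parent c = some p) (hx : T.Desc c x) (hy : ¬ T.Desc c y) :
    A x ∩ A y ⊆ A c ∩ A p := by
  intro a ha
  obtain ⟨hax, hay⟩ := Finset.mem_inter.1 ha
  obtain ⟨r, hr⟩ := T.exists_forall_reflTransGen hax
  have hrc : ¬ T.Desc c r := fun h =>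
    have hyr : T.Desc r y := Relation.ReflTransGen.mono (fun _ _ => And.left) _ _ (hr y hay)
    hy (hyr.trans h)
  have hpath := hr x hax
  clear ha
  induction hpath using Relation.ReflTransGen.head_induction_on with
  | refl => exact absurd hx hrc
  | @head x z hxz _ ih =>
    by_cases hxc : x = c
    · subst hxc
      exact Finset.mem_inter.2 ⟨hax, Option.some.inj (hxz.1.symm.trans hc) ▸ hxz.2⟩
    · exact ih (hx.parent hxc hxz.1) hxz.2

end Desc

section Subtrees

variable (T)

/-- The nodes of the subtree with root `c`, whose relations make up the botjoin of `c`. -/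
noncomputable def sub (c : Fin m) : List (Fin m) :=
  open Classical in (Finset.univ.filter (T.Desc c)).toList

/-- The nodes outside the subtree with root `c`, whose relations make up the topjoin of `c`. -/
noncomputable def subCompl (c : Fin m) : List (Fin m) :=
  open Classical in (Finset.univ.filter fun x => ¬ T.Desc c x).toList

theorem mem_sub {c x : Fin m} : x ∈ T.sub c ↔ T.Desc c x := by
  simp only [sub, Finset.mem_toList, Finset.mem_filter, Finset.mem_univ, true_and]

theorem mem_subCompl {c x : Fin m} : x ∈ T.subCompl c ↔ ¬ T.Desc c x := by
  simp only [subCompl, Finset.mem_toList, Finset.mem_filter, Finset.mem_univ, true_and]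

theorem nodup_sub (c : Fin m) : (T.sub c).Nodup :=
  Finset.nodup_toList _

theorem nodup_subCompl (c : Fin m) : (T.subCompl c).Nodup :=
  Finset.nodup_toList _

theorem subCompl_root : T.subCompl T.root = [] :=
  List.eq_nil_iff_forall_not_mem.2 fun x hx => T.mem_subCompl.1 hx (T.desc_root x)

variable {T}

theorem nodup_flatMap_sub {p : Fin m} {cs : List (Fin m)} (hcs : cs.Nodup)
    (h : ∀ c ∈ cs, T.parent c = some p) : (cs.flatMap T.sub).Nodup := by
  refine List.nodup_flatMap.2 ⟨fun c _ => T.nodup_sub c, ?_⟩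
  refine List.Pairwise.imp_of_mem (fun {c c'} hc hc' hne x hx hx' => ?_) hcs
  exact not_desc_of_siblings (h c hc) (h c' hc') hne (T.mem_sub.1 hx) (T.mem_sub.1 hx')

theorem desc_of_mem_flatMap_sub {p x : Fin m} {cs : List (Fin m)}
    (h : ∀ c ∈ cs, T.parent c = some p) (hx : x ∈ cs.flatMap T.sub) : T.Desc p x ∧ x ≠ p := by
  obtain ⟨c, hc, hx⟩ := List.mem_flatMap.1 hx
  rw [mem_sub] at hx
  exact ⟨hx.tail (h c hc), fun h' => not_desc_of_parent (h c hc) (h' ▸ hx)⟩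

theorem nodup_subCompl_append_flatMap_sub {p : Fin m} {cs : List (Fin m)} (hcs : cs.Nodup)
    (h : ∀ c ∈ cs, T.parent c = some p) : (T.subCompl p ++ cs.flatMap T.sub).Nodup :=
  (T.nodup_subCompl p).append (nodup_flatMap_sub hcs h) fun _ hx hx' =>
    T.mem_subCompl.1 hx (desc_of_mem_flatMap_sub h hx').1

variable (T)

theorem sub_perm (c : Fin m) : (T.sub c).Perm (c :: (T.children c).flatMap T.sub) := by
  have hch : ∀ c' ∈ T.children c, T.parent c' = some c := fun c' => T.mem_children.1
  refine (List.perm_ext_iff_of_nodup (T.nodup_sub c) (List.nodup_cons.2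
    ⟨fun h => (desc_of_mem_flatMap_sub hch h).2 rfl,
      nodup_flatMap_sub (T.nodup_children c) hch⟩)).2 fun x => ?_
  simp only [mem_sub, List.mem_cons, List.mem_flatMap, mem_children]
  refine ⟨Desc.eq_or_exists_child, ?_⟩
  rintro (rfl | ⟨y, hy, hx⟩)
  · exact .refl x
  · exact hx.tail hy

theorem erase_perm (i : Fin m) : (Finset.univ.erase i).toList.Perm
    (T.subCompl i ++ (T.children i).flatMap T.sub) := by
  have hch : ∀ c ∈ T.children i, T.parent c = some i := fun c => T.mem_children.1
  refine (List.perm_ext_iff_of_nodup (Finset.nodup_toList _)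
    (nodup_subCompl_append_flatMap_sub (T.nodup_children i) hch)).2 fun x => ?_
  simp only [Finset.mem_toList, Finset.mem_erase, Finset.mem_univ, and_true, List.mem_append]
  refine ⟨fun hx => or_iff_not_imp_left.2 fun h => ?_, fun h hx => ?_⟩
  · rw [mem_subCompl, not_not] at h
    obtain ⟨y, hy, h⟩ := h.eq_or_exists_child.resolve_left hx
    exact List.mem_flatMap.2 ⟨y, T.mem_children.2 hy, T.mem_sub.2 h⟩
  · subst hx
    exact h.elim (fun h => T.mem_subCompl.1 h (.refl x))
      fun h => (desc_of_mem_flatMap_sub hch h).2 rfl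

theorem subCompl_perm {i p : Fin m} (hi : T.parent i = some p) :
    (T.subCompl i).Perm (p :: (T.subCompl p ++ ((T.children p).erase i).flatMap T.sub)) := by
  have hch : ∀ c ∈ (T.children p).erase i, T.parent c = some p := fun c hc =>
    T.mem_children.1 (List.mem_of_mem_erase hc)
  refine (List.perm_ext_iff_of_nodup (T.nodup_subCompl i) (List.nodup_cons.2 ⟨fun h => ?_,
    nodup_subCompl_append_flatMap_sub ((T.nodup_children p).erase i) hch⟩)).2 fun x => ?_
  · exact (List.mem_append.1 h).elim (fun h => T.mem_subCompl.1 h (.refl p))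
      fun h => (desc_of_mem_flatMap_sub hch h).2 rfl
  simp only [mem_subCompl, List.mem_cons, List.mem_append, List.mem_flatMap, mem_sub]
  constructor
  · intro hx
    by_cases hp : T.Desc p x
    · refine hp.eq_or_exists_child.imp_right fun ⟨y, hy, h⟩ => .inr ⟨y, ?_, h⟩
      refine (List.mem_erase_of_ne ?_).2 (T.mem_children.2 hy)
      rintro rfl
      exact hx h
    · exact .inr (.inl hp)
  · rintro (rfl | h | ⟨c, hc, h⟩)
    · exact not_desc_of_parent hi
    · exact fun hx => h (hx.tail hi)
    · exact not_desc_of_siblings (hch c hc) hi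
        ((T.nodup_children p).mem_erase_iff.1 hc).1 h

end Subtrees

section Degrees

variable (T)

theorem sum_nbrs_comm (f : Fin m → Fin m → ℕ) :
    ∑ i, ((T.nbrs i).map fun j => f i j).sum = ∑ j, ((T.nbrs j).map fun i => f i j).sum := by
  have hsum : ∀ (g : Fin m → ℕ) (i : Fin m), ((T.nbrs i).map g).sum =
      ∑ j, if j ∈ T.nbrs i then g j else 0 := fun g i => by
    rw [← List.sum_toFinset _ (T.nodup_nbrs i), ← Finset.sum_filter]
    refine Finset.sum_congr (Finset.ext fun j => ?_) fun _ _ => rfl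
    rw [List.mem_toFinset, Finset.mem_filter, and_iff_right (Finset.mem_univ j)]
  simp only [hsum]
  rw [Finset.sum_comm]
  simp only [mem_nbrs, or_comm]

theorem sum_length_children_le : ∑ i, (T.children i).length ≤ m := by
  have hlen : ∀ i, (T.children i).length = (Finset.univ.filter fun c => T.parent c = some i).card :=
    fun i => by
      rw [← List.toFinset_card_of_nodup (T.nodup_children i)]
      refine congrArg _ (Finset.ext fun c => ?_)
      rw [List.mem_toFinset, mem_children, Finset.mem_filter, and_iff_right (Finset.mem_univ c)]
  have hdisj : (Set.univ : Set (Fin m)).PairwiseDisjoint fun i =>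
      Finset.univ.filter fun c => T.parent c = some i := fun i _ j _ hij =>
    Finset.disjoint_filter.2 fun c _ hi hj => hij (Option.some.inj (hi.symm.trans hj))
  simp only [hlen]
  rw [← Finset.card_biUnion fun i _ j _ hij => hdisj (Set.mem_univ i) (Set.mem_univ j) hij]
  exact (Finset.card_le_univ _).trans_eq (Fintype.card_fin m)

theorem sum_length_nbrs_le : ∑ i, (T.nbrs i).length ≤ 2 * m := by
  have hle : ∀ i, (T.nbrs i).length ≤ 1 + (T.children i).length := fun i => by
    rw [nbrs, List.length_append]
    exact Nat.add_le_add_right Option.length_toList_le _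
  calc ∑ i, (T.nbrs i).length ≤ ∑ i, (1 + (T.children i).length) :=
        Finset.sum_le_sum fun i _ => hle i
    _ = m + ∑ i, (T.children i).length := by
        rw [Finset.sum_add_distrib, Finset.sum_const, Finset.card_univ, Fintype.card_fin,
          smul_eq_mul, mul_one]
    _ ≤ 2 * m := by rw [two_mul]; exact Nat.add_le_add_left T.sum_length_children_le m

theorem length_children_le (i : Fin m) : (T.children i).length ≤ (T.nbrs i).length := by
  rw [nbrs, List.length_append]
  exact Nat.le_add_left _ _

theorem length_nbrs_lt (i : Fin m) : (T.nbrs i).length < m := by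
  have hnd : (i :: T.nbrs i).Nodup := List.nodup_cons.2 ⟨fun h =>
    (T.mem_nbrs.1 h).elim (fun h => (T.parent_later i i h).false)
      fun h => (T.parent_later i i h).false, T.nodup_nbrs i⟩
  exact hnd.length_le_card.trans_eq (Fintype.card_fin m)

theorem length_children_lt (i : Fin m) : (T.children i).length < m :=
  (T.length_children_le i).trans_lt (T.length_nbrs_lt i)

theorem sum_children_le (i : Fin m) (f : Fin m → ℕ) :
    ((T.children i).map f).sum ≤ ((T.nbrs i).map f).sum := by
  rw [nbrs, List.map_append, List.sum_append]
  exact Nat.le_add_left _ _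

end Degrees

theorem isEarWitness_of_suffix {i : Fin m} {l : List (Fin m)} (h : i :: l <:+ T.postOrder) :
    IsEarWitness A (i :: l).toFinset i (T.parent i) := by
  obtain ⟨pre, hpre⟩ := h
  have hlater (j) : j ∈ l ↔ T.elim.symm i < T.elim.symm j := mem_right_iff hpre.symm
  have hmem (j) (hj : j ∈ (i :: l).toFinset) (hji : j ≠ i) : T.elim.symm i < T.elim.symm j :=
    (hlater j).1 ((List.mem_cons.1 (List.mem_toFinset.1 hj)).resolve_left hji)
  refine ⟨List.mem_toFinset.2 List.mem_cons_self, fun p hp => ?_, fun p hp => ?_,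
    fun j hj hji => ?_⟩
  · exact List.mem_toFinset.2 (List.mem_cons_of_mem i ((hlater p).2 (T.parent_later i p hp)))
  · rintro rfl
    exact (T.parent_later p p hp).false
  · cases hp : T.parent i with
    | none =>
      have hle := (T.desc_root j).elim_symm_le
      rw [← (T.parent_eq_none i).1 hp] at hle
      exact absurd (hmem j hj hji) hle.not_gt
    | some p => exact T.ear i p hp j (hmem j hj hji)

theorem gyoAcyclic_of_suffix : ∀ {l : List (Fin m)}, l <:+ T.postOrder → GYOAcyclic A l.toFinset
  | [], _ => .empty
  | i :: l, h => by
      have hi : i ∉ l := (List.nodup_cons.1 (h.sublist.nodup T.nodup_postOrder)).1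
      refine .ear _ i (isEarWitness_of_suffix h).isEar ?_
      rw [List.toFinset_cons, Finset.erase_insert (List.mem_toFinset.not.2 hi)]
      exact gyoAcyclic_of_suffix ((List.suffix_cons i l).trans h)

theorem gyoAcyclic_univ (T : JoinTree A) : GYOAcyclic A Finset.univ := by
  rw [← Finset.eq_univ_of_forall fun i => List.mem_toFinset.2 (T.mem_postOrder i)]
  exact gyoAcyclic_of_suffix List.suffix_rfl

end JoinTree

section Path

/-- The join tree of the path query whose root is the last relation. -/
def pathTree (m : ℕ) (hm : 1 ≤ m) : JoinTree (pathQuery m) where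
  elim := Equiv.refl _
  root := ⟨m - 1, by omega⟩
  parent i := if h : (i : ℕ) + 1 < m then some ⟨i + 1, h⟩ else none
  parent_eq_none i := by
    have := i.2
    simp only [dite_eq_right_iff, reduceCtorEq, imp_false, Fin.ext_iff]
    omega
  parent_later i p h := by
    split_ifs at h
    obtain rfl := Option.some.inj h
    exact Nat.lt_succ_self i
  ear i p h j hij := by
    split_ifs at h
    obtain rfl := Option.some.inj h
    intro a ha
    have hij : (i : ℕ) < j := hij
    simp only [pathQuery, Finset.mem_inter, Finset.mem_insert, Finset.mem_singleton, Fin.ext_iff,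
      Fin.val_castSucc, Fin.val_succ] at ha ⊢
    omega

variable {m : ℕ} (hm : 1 ≤ m)

theorem parent_pathTree_inj {i c c' : Fin m} (hc : (pathTree m hm).parent c = some i)
    (hc' : (pathTree m hm).parent c' = some i) : c = c' := by
  simp only [pathTree, Option.dite_none_right_eq_some, Option.some.injEq, Fin.ext_iff] at hc hc' ⊢
  obtain ⟨-, hc⟩ := hc
  obtain ⟨-, hc'⟩ := hc'
  omega

theorem length_nbrs_pathTree (i : Fin m) : ((pathTree m hm).nbrs i).length ≤ 2 := by
  rw [JoinTree.nbrs, List.length_append]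
  refine Nat.add_le_add (b := 1) (d := 1) Option.length_toList_le ?_
  rw [← List.toFinset_card_of_nodup ((pathTree m hm).nodup_children i), Finset.card_le_one]
  simp only [List.mem_toFinset, JoinTree.mem_children]
  exact fun c hc c' hc' => parent_pathTree_inj hm hc hc'

theorem nbrsAcyclic_pathTree : (pathTree m hm).NbrsAcyclic := fun i =>
  gyoAcyclic_of_card_le_two ((List.toFinset_card_le _).trans (length_nbrs_pathTree hm i))

end Path

/-! ### Botjoins and topjoins -/

theorem length_le_sum_length {m : ℕ} {β : Fin m → Type} (l : ∀ i, List (β i)) (i : Fin m) :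
    (l i).length ≤ ∑ i, (l i).length :=
  Finset.single_le_sum (f := fun i => (l i).length) (fun _ _ => Nat.zero_le _) (Finset.mem_univ i)

section Messages

variable {α : Type} [LinearOrder α] {dom : α → Type} [∀ a, LinearOrder (dom a)]
  {m : ℕ} {A : Fin m → Finset α}

/-- The number of steps for sorting `q` rows and passing over them, up to a constant factor, if
`Λ` bounds the logarithm of `q`. -/
def sortCost (q Λ : ℕ) : ℕ := (q + 1) * (Λ + 1)

theorem le_sortCost (q Λ : ℕ) : q * Λ + q + 1 ≤ sortCost q Λ := by
  rw [sortCost]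
  linarith

theorem succ_le_sortCost (q Λ : ℕ) : q + 1 ≤ sortCost q Λ :=
  (Nat.succ_le_succ (Nat.le_add_left q (q * Λ))).trans (le_sortCost q Λ)

theorem joinChildren_spec {T : JoinTree A} {W Λ : ℕ} (hW : ∀ c, (T.sep c).card + 1 ≤ W)
    {bot : Fin m → List (Row dom ℕ)} {q : Fin m → ℕ} {rows : List (Row dom (ℕ × List ℕ))}
    (hΛ : Nat.clog 2 rows.length ≤ Λ) :
    ∀ cs : List (Fin m), (∀ c ∈ cs, StrictBy (T.sep c) (bot c) ∧ (bot c).length ≤ q c) →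
      (joinChildren T bot cs rows).Spec
        (fun r => r.Perm (rows.map fun x => (x.1, (x.2.1,
          cs.map (fun c => tableCount (T.sep c) (bot c) x.1) ++ x.2.2))))
        (cs.length * (4 * sortCost rows.length Λ) + (cs.map q).sum + 1) W
  | [], _ => by
      rw [joinChildren]
      exact (Spec.tick_pure (Nat.le_of_add_left_le (hW T.root)) (by simp)).mono_steps (by simp)
  | c :: cs, h => by
      obtain ⟨hc, h⟩ := List.forall_mem_cons.1 h
      have hW1 : 1 ≤ W := Nat.le_of_add_left_le (hW c)
      rw [joinChildren]
      refine ((joinChildren_spec hW hΛ cs h).bind (t' := 4 * sortCost rows.length Λ + q c)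
        fun r hr => ?_).mono_steps ?_
      · have hlen : r.length = rows.length := by rw [hr.length_eq, List.length_map]
        refine ((lookupJoin_spec (hW c) r hc.1 (hlen ▸ hΛ)).bind (t' := rows.length * 2 + 1)
          fun j hj => (Spec.mapT (t := 1)
            (g := fun r => (r.1.1, (r.1.2.1, countOf r.2 :: r.1.2.2))) hW1 j
            fun b _ => Spec.tick_pure hW1 rfl).mono ?_ ?_).mono_steps ?_
        · rintro _ rfl
          refine (hj.map _).trans ?_
          rw [List.map_map]
          refine (hr.map _).trans (.of_eq ?_)
          rw [List.map_map]
          exact List.map_congr_left fun x _ => by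
            simp only [Function.comp_apply, hc.1.countOf_lookup, List.map_cons, List.cons_append]
        · rw [hj.length_eq, List.length_map, hlen]
        · have := le_sortCost rows.length Λ
          have := hc.2
          rw [hlen]
          omega
      · simp only [List.length_cons, List.map_cons, List.sum_cons]
        linarith

variable [∀ a, Inhabited (dom a)]

section Recursion

variable (D : ∀ i, List (Tup dom (A i))) (T : JoinTree A)

/-- The count of `v` in the botjoin of `i`: the multiplicity of its projection in the join of the
relations of the subtree with root `i`. -/
noncomputable def botCount (i : Fin m) (v : ∀ a, dom a) : ℕ :=
  joinCount D (T.sub i) (T.sep i) v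

/-- The count of `v` in the topjoin of `i`: the multiplicity of its projection in the join of the
relations outside the subtree with root `i`; it is `1` at the root, which has no topjoin. -/
noncomputable def topCount (i : Fin m) (v : ∀ a, dom a) : ℕ :=
  joinCount D (T.subCompl i) (T.sep i) v

theorem topCount_root (v : ∀ a, dom a) : topCount D T T.root v = 1 := by
  rw [topCount, T.subCompl_root, joinCount]

variable {T}

theorem joinCount_sub_parent {c i : Fin m} (hc : T.parent c = some i) (v : ∀ a, dom a) :
    joinCount D (T.sub c) (A i) v = botCount D T c v := by
  refine joinCount_congr (fun j hj => ?_) fun _ _ => rfl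
  rw [T.sep_eq hc]
  have := JoinTree.inter_subset_of_desc hc (T.mem_sub.1 hj) (JoinTree.not_desc_of_parent hc)
  grind

theorem joinCount_subCompl_self (i : Fin m) (v : ∀ a, dom a) :
    joinCount D (T.subCompl i) (A i) v = topCount D T i v := by
  refine joinCount_congr (fun j hj => ?_) fun _ _ => rfl
  cases hi : T.parent i with
  | none => rw [JoinTree.sep, hi]
  | some p =>
    rw [T.sep_eq hi]
    have := JoinTree.inter_subset_of_desc hi (.refl i) (T.mem_subCompl.1 hj)
    grind

theorem joinCount_flatMap_sub {i : Fin m} {cs : List (Fin m)} (hcs : cs.Nodup)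
    (h : ∀ c ∈ cs, T.parent c = some i) (v : ∀ a, dom a) :
    joinCount D (cs.flatMap T.sub) (A i) v = (cs.map (botCount D T · v)).prod := by
  rw [joinCount_flatMap]
  · exact congrArg List.prod (List.map_congr_left fun c hc => joinCount_sub_parent D (h c hc) v)
  · refine List.Pairwise.imp_of_mem (fun {c c'} hc hc' hne j hj k hk => ?_) hcs
    refine (JoinTree.inter_subset_of_desc (h c hc) (T.mem_sub.1 hj) fun hk' => ?_).trans
      Finset.inter_subset_right
    exact JoinTree.not_desc_of_siblings (h c hc) (h c' hc') hne hk' (T.mem_sub.1 hk)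

theorem joinCount_subCompl_append {i : Fin m} {cs : List (Fin m)} (hcs : cs.Nodup)
    (h : ∀ c ∈ cs, T.parent c = some i) (v : ∀ a, dom a) :
    joinCount D (T.subCompl i ++ cs.flatMap T.sub) (A i) v =
      topCount D T i v * (cs.map (botCount D T · v)).prod := by
  rw [joinCount_append, joinCount_subCompl_self, joinCount_flatMap_sub D hcs h]
  intro j hj k hk
  have hk := (JoinTree.desc_of_mem_flatMap_sub h hk).1
  cases hi : T.parent i with
  | none => exact absurd ((T.parent_eq_none i).1 hi ▸ T.desc_root j) (T.mem_subCompl.1 hj)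
  | some p =>
    rw [Finset.inter_comm]
    exact (JoinTree.inter_subset_of_desc hi hk (T.mem_subCompl.1 hj)).trans
      Finset.inter_subset_left

theorem botCount_eq_sum (i : Fin m) (v : ∀ a, dom a) :
    botCount D T i v = ((D i).map fun t =>
      if key (T.sep i) (extend (A i) t) = key (T.sep i) v then
        ((T.children i).map (botCount D T · (extend (A i) t))).prod else 0).sum := by
  rw [botCount, joinCount_perm (T.sub_perm i), joinCount_cons_of_subset _ _ _ (T.sep_subset i)]
  simp_rw [joinCount_flatMap_sub D (T.nodup_children i) fun _ hc => T.mem_children.1 hc]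

theorem topCount_eq_sum {i p : Fin m} (hi : T.parent i = some p) (v : ∀ a, dom a) :
    topCount D T i v = ((D p).map fun t =>
      if key (T.sep i) (extend (A p) t) = key (T.sep i) v then
        topCount D T p (extend (A p) t) *
          (((T.children p).erase i).map (botCount D T · (extend (A p) t))).prod else 0).sum := by
  have hsep : T.sep i ⊆ A p := T.sep_eq hi ▸ Finset.inter_subset_right
  rw [topCount, joinCount_perm (T.subCompl_perm hi), joinCount_cons_of_subset _ _ _ hsep]
  simp_rw [joinCount_subCompl_append D ((T.nodup_children p).erase i)
    fun _ hc => T.mem_children.1 (List.mem_of_mem_erase hc)]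

variable (T) in
theorem joinCount_univ_erase (i : Fin m) (v : ∀ a, dom a) :
    joinCount D (Finset.univ.erase i).toList (A i) v =
      topCount D T i v * ((T.children i).map (botCount D T · v)).prod := by
  rw [joinCount_perm (T.erase_perm i), joinCount_subCompl_append D (T.nodup_children i)
    fun _ hc => T.mem_children.1 hc]

end Recursion

/-- The parameters of the cost estimates: `z` bounds the bit lengths of the multiplicities in the
joins of the relations, `Z` those of all counts that the algorithm computes, `W` the finer
cost of a step, and `Λ` the logarithms of the numbers of tuples of the relations. -/
structure CostBounds (D : ∀ i, List (Tup dom (A i))) (z Z W Λ : ℕ) : Prop where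
  size_joinCount_le : ∀ U : List (Fin m), U.Nodup → ∀ S v, (joinCount D U S v).size ≤ z
  le_size : z * (m + 1) + ∑ i, (D i).length + 2 ≤ Z
  le_work : 2 * (allAttrs A).card + (Z + 1) ^ 2 + 1 ≤ W
  clog_le : ∀ i, Nat.clog 2 (D i).length ≤ Λ

variable {D : ∀ i, List (Tup dom (A i))} {z Z W Λ : ℕ} {T : JoinTree A}

namespace CostBounds

theorem one_le (hB : CostBounds D z Z W Λ) : 1 ≤ W :=
  (Nat.le_add_left _ _).trans hB.le_work

theorem size_one_le (hB : CostBounds D z Z W Λ) : Nat.size 1 ≤ z := by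
  simpa only [joinCount] using hB.size_joinCount_le [] List.nodup_nil ∅ fun _ => default

theorem card_le (hB : CostBounds D z Z W Λ) {S : Finset α} {i : Fin m} (h : S ⊆ A i) :
    S.card + (Z + 1) ^ 2 + 1 ≤ W := by
  have := Finset.card_le_card (h.trans (subset_allAttrs A i))
  have := hB.le_work
  omega

theorem card_sep_le (hB : CostBounds D z Z W Λ) (T : JoinTree A) (i : Fin m) :
    (T.sep i).card + (Z + 1) ^ 2 + 1 ≤ W :=
  hB.card_le (T.sep_subset i)

theorem size_botCount_le (hB : CostBounds D z Z W Λ) (i : Fin m) (v : ∀ a, dom a) :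
    (botCount D T i v).size ≤ z :=
  hB.size_joinCount_le _ (T.nodup_sub i) _ _

theorem size_topCount_le (hB : CostBounds D z Z W Λ) (i : Fin m) (v : ∀ a, dom a) :
    (topCount D T i v).size ≤ z :=
  hB.size_joinCount_le _ (T.nodup_subCompl i) _ _

end CostBounds

theorem size_sum_le {s : ℕ} {l : List ℕ} (h : ∀ x ∈ l, x.size ≤ s) :
    l.sum.size ≤ l.length + s := by
  have hsum : l.sum ≤ l.length * 2 ^ s := by
    simpa using List.sum_le_card_nsmul l (2 ^ s) fun x hx => (Nat.size_le.1 (h x hx)).le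
  rw [Nat.size_le, pow_add]
  exact hsum.trans_lt (Nat.mul_lt_mul_of_pos_right Nat.lt_two_pow_self (by positivity))

theorem CostBounds.size_sum_prod_le (hB : CostBounds D z Z W Λ) {V : Type} {vs : List V}
    {i : Fin m} (hvs : vs.length = (D i).length) {g : V → List ℕ}
    (hlen : ∀ v, (g v).length ≤ m + 1) (hg : ∀ v, ∀ x ∈ g v, x.size ≤ z) :
    (vs.map fun v => (g v).prod).sum.size ≤ Z := by
  refine (size_sum_le (s := (m + 1) * z + 1) ?_).trans ?_
  · simp only [List.forall_mem_map]
    exact fun v _ => (size_prod_le (hg v)).trans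
      (Nat.succ_le_succ (Nat.mul_le_mul_right z (hlen v)))
  · have hlength := length_le_sum_length D i
    have hsize := hB.le_size
    rw [List.length_map, hvs, mul_comm]
    omega

/-- `tbl` is the result of grouping the join of the relations in `U` by the attributes in `S`,
it is sorted, and it has at most `q` rows. -/
structure IsGroupedJoin (D : ∀ i, List (Tup dom (A i))) (U : List (Fin m)) (S : Finset α) (q : ℕ)
    (tbl : List (Row dom ℕ)) : Prop where
  strict : StrictBy S tbl
  length_le : tbl.length ≤ q
  count : ∀ v, tableCount S tbl v = joinCount D U S v

/-- `tbl` is the botjoin of `i`. -/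
def IsBot (T : JoinTree A) (D : ∀ i, List (Tup dom (A i))) (i : Fin m)
    (tbl : List (Row dom ℕ)) : Prop :=
  IsGroupedJoin D (T.sub i) (T.sep i) (D i).length tbl

/-- `tbl` is the topjoin of `i`; there is no condition if `i` is the root, since the algorithm
does not compute a topjoin there. -/
def IsTop (T : JoinTree A) (D : ∀ i, List (Tup dom (A i))) (i : Fin m)
    (tbl : List (Row dom ℕ)) : Prop :=
  ∀ p, T.parent i = some p → IsGroupedJoin D (T.subCompl i) (T.sep i) (D p).length tbl

section Grouping

variable {i : Fin m} {vs : List (∀ a, dom a)} (hvs : vs.Perm ((D i).map (extend (A i))))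
include hvs

theorem isBot_of_grouped {g : List (Row dom ℕ)}
    (hg : Grouped (T.sep i) (vs.map fun v => (v, ((T.children i).map (botCount D T · v)).prod)) g)
    (hcount : ∀ v, tableCount (T.sep i) g v = tableCount (T.sep i)
      (vs.map fun v => (v, ((T.children i).map (botCount D T · v)).prod)) v) :
    IsBot T D i g where
  strict := hg.strict
  length_le := by simpa [hvs.length_eq] using hg.length_le
  count v := by rw [hcount, tableCount_map_of_perm hvs, ← botCount, botCount_eq_sum]

theorem isTop_of_grouped {c : Fin m} (hc : T.parent c = some i) {g : List (Row dom ℕ)}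
    (hg : Grouped (T.sep c) (vs.map fun v =>
      (v, topCount D T i v * (((T.children i).erase c).map (botCount D T · v)).prod)) g)
    (hcount : ∀ v, tableCount (T.sep c) g v = tableCount (T.sep c) (vs.map fun v =>
      (v, topCount D T i v * (((T.children i).erase c).map (botCount D T · v)).prod)) v) :
    IsTop T D c g := by
  intro p hp
  obtain rfl : i = p := Option.some.inj (hc.symm.trans hp)
  exact {
    strict := hg.strict
    length_le := by simpa [hvs.length_eq] using hg.length_le
    count := fun v => by rw [hcount, tableCount_map_of_perm hvs, ← topCount, topCount_eq_sum D hc] }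

end Grouping

theorem readRel_spec (hB : CostBounds D z Z W Λ) (i : Fin m) :
    (readRel D i).Spec (· = (D i).map fun t => (extend (A i) t, (1, [])))
      (2 * (D i).length + 1) W := by
  have hcard : (A i).card + 1 ≤ W := by
    have := hB.card_le (subset_refl (A i))
    omega
  exact (Spec.mapT (t := 1) hB.one_le _ fun t _ => Spec.tick_pure hcard rfl).mono_steps (by omega)

section Node

variable (hB : CostBounds D z Z W Λ) {i : Fin m}
include hB

theorem joinChildren_children_spec {bot : Fin m → List (Row dom ℕ)}
    (hbot : ∀ c, T.parent c = some i → IsBot T D c (bot c)) {pre : (∀ a, dom a) → ℕ}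
    {rows : List (Row dom (ℕ × List ℕ))}
    (hrows : rows.Perm ((D i).map fun t => (extend (A i) t, (pre (extend (A i) t), [])))) :
    (joinChildren T bot (T.children i) rows).Spec
      (fun r => ∃ vs : List (∀ a, dom a), vs.Perm ((D i).map (extend (A i))) ∧
        r = vs.map fun v => (v, (pre v, (T.children i).map (botCount D T · v))))
      ((T.children i).length * (4 * sortCost (D i).length Λ) +
        ((T.children i).map fun j => (D j).length).sum + 1) W := by
  have hW (c : Fin m) : (T.sep c).card + 1 ≤ W := by
    have := hB.card_sep_le T c
    omega
  have hbot (c) (hc : c ∈ T.children i) : IsBot T D c (bot c) := hbot c (T.mem_children.1 hc)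
  have hlen : rows.length = (D i).length := by rw [hrows.length_eq, List.length_map]
  refine (joinChildren_spec hW (hlen ▸ hB.clog_le i) (T.children i) fun c hc =>
    ⟨(hbot c hc).strict, (hbot c hc).length_le⟩).mono (fun r hr => ?_) (by rw [hlen])
  have hr' : r.Perm (((D i).map (extend (A i))).map fun v =>
      (v, (pre v, (T.children i).map (botCount D T · v)))) := by
    rw [List.map_map]
    refine (hr.trans (hrows.map _)).trans (.of_eq ?_)
    rw [List.map_map]
    refine List.map_congr_left fun t _ => ?_
    simp only [Function.comp_apply, List.append_nil]
    rw [List.map_congr_left fun c hc => (hbot c hc).count _]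
    rfl
  obtain ⟨vs, rfl, hvs⟩ := (congrFun₂ (List.eq_map_comp_perm _) r _).mpr hr'
  exact ⟨vs, hvs, rfl⟩

theorem mapT_others_spec {X : Type} (out : List ℕ × ℕ → X) {pre : (∀ a, dom a) → ℕ}
    (hpre : ∀ v, (pre v).size ≤ z) {vs : List (∀ a, dom a)} {q : ℕ} (hvs : vs.length = q) :
    (mapT (fun r : Row dom (ℕ × List ℕ) => do
      let x ← others r.2.1 r.2.2
      pure (r.1, out x))
      (vs.map fun v => (v, (pre v, (T.children i).map (botCount D T · v))))).Spec
    (· = vs.map fun v => (v, out (((T.children i).map fun c =>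
      pre v * (((T.children i).erase c).map (botCount D T · v)).prod),
      ((T.children i).map (botCount D T · v)).prod)))
    (q * (3 * (T.children i).length + 2) + 1) W := by
  have hWZ : (Z + 1) ^ 2 + 1 ≤ W := by
    have := hB.le_work
    omega
  have hZ : z + (T.children i).length * z + 1 ≤ Z := by
    have := Nat.mul_le_mul_right z (T.length_children_lt i).le
    have hsize := hB.le_size
    rw [mul_add_one, mul_comm z] at hsize
    omega
  have hothers (v : ∀ a, dom a) := others_spec hWZ (botCount D T · v) (T.children i) (pre v)
    (T.nodup_children i) (fun c _ => hB.size_botCount_le c v) (by linarith [hpre v])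
  refine (Spec.mapT (t := 3 * (T.children i).length + 1)
    (g := fun r => (r.1, out (((T.children i).map fun c =>
      pre r.1 * (((T.children i).erase c).map (botCount D T · r.1)).prod),
      ((T.children i).map (botCount D T · r.1)).prod)))
    hB.one_le _ ?_).mono (fun r hr => ?_) ?_
  · simp only [List.forall_mem_map]
    exact fun v _ => (hothers v).bind fun x hx => Spec.pure (by rw [hx])
  · rw [hr, List.map_map]
    rfl
  · rw [List.length_map, hvs]

theorem botStep_spec {bot : Fin m → List (Row dom ℕ)}
    (hbot : ∀ c, T.parent c = some i → IsBot T D c (bot c)) :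
    (botStep T D bot i).Spec (fun bot' => ∃ b, bot' = Function.update bot i b ∧ IsBot T D i b)
      (10 * (((T.nbrs i).length + 1) * sortCost (D i).length Λ) +
        ((T.nbrs i).map fun j => (D j).length).sum) W := by
  have hlength := succ_le_sortCost (D i).length Λ
  have hchildren := Nat.mul_le_mul_right (sortCost (D i).length Λ) (T.length_children_le i)
  have hmul := Nat.mul_le_mul_right (T.children i).length
    (Nat.le_of_succ_le (succ_le_sortCost (D i).length Λ))
  have hsum := T.sum_children_le i fun j => (D j).length
  rw [botStep]
  refine ((readRel_spec hB i).bind fun rows hrows =>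
    (joinChildren_children_spec hB hbot (pre := fun _ => 1) (.of_eq hrows)).bind
      (t' := (3 * (T.children i).length + 7) * sortCost (D i).length Λ)
      fun rows hrows => ?_).mono_steps (by nlinarith)
  obtain ⟨vs, hvs, rfl⟩ := hrows
  have hlen : vs.length = (D i).length := by rw [hvs.length_eq, List.length_map]
  refine ((mapT_others_spec hB Prod.snd (pre := fun _ => 1) (fun _ => hB.size_one_le) hlen).bind
    (t' := 4 * ((D i).length * Λ) + (D i).length + 3) fun rows hrows => ?_).mono_steps
    (by linarith [le_sortCost (D i).length Λ])
  subst hrows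
  refine ((groupBy_addRow_spec (Λ := Λ) (hB.card_sep_le T i) _ ?_ ?_).bind fun b hb =>
    Spec.tick_pure hB.one_le ⟨b, rfl, isBot_of_grouped hvs hb.1 hb.2⟩).mono_steps ?_
  · rw [List.map_map]
    refine hB.size_sum_prod_le hlen (fun _ => ?_) fun v => ?_
    · rw [List.length_map]
      exact (T.length_children_lt i).le.trans (Nat.le_succ m)
    · simp only [List.forall_mem_map]
      exact fun c _ => hB.size_botCount_le c v
  · rw [List.length_map, hlen]
    exact hB.clog_le i
  · rw [List.length_map, hlen]

theorem distribute_spec (vs : List (∀ a, dom a)) (hΛ : Nat.clog 2 vs.length ≤ Λ)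
    (h : (∀ a, dom a) → Fin m → ℕ) : ∀ (cs : List (Fin m)) (top : Fin m → List (Row dom ℕ)),
      cs.Nodup → (∀ c ∈ cs, (vs.map (h · c)).sum.size ≤ Z) →
      (distribute T cs (vs.map fun v => (v, cs.map (h v))) top).Spec
        (fun top' => (∀ c ∈ cs, Grouped (T.sep c) (vs.map fun v => (v, h v c)) (top' c) ∧
          ∀ u, tableCount (T.sep c) (top' c) u =
            tableCount (T.sep c) (vs.map fun v => (v, h v c)) u) ∧ ∀ c ∉ cs, top' c = top c)
        (cs.length * (5 * sortCost vs.length Λ) + 1) W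
  | [], top, _, _ => by
      rw [distribute]
      exact (Spec.tick_pure hB.one_le (by simp)).mono_steps (by simp)
  | c :: cs, top, hcs, hsize => by
      obtain ⟨hc, hcs⟩ := List.nodup_cons.1 hcs
      obtain ⟨hsizec, hsize⟩ := List.forall_mem_cons.1 hsize
      have hsort := le_sortCost vs.length Λ
      have hlength := succ_le_sortCost vs.length Λ
      rw [distribute]
      refine ((Spec.mapT (t := 1) (g := fun r : Row dom (List ℕ) => (r.1, r.2.headD 0)) hB.one_le _
        fun r _ => Spec.tick_pure hB.one_le rfl).bind fun col hcol =>
          (Spec.mapT (t := 1) (g := fun r : Row dom (List ℕ) => (r.1, r.2.tail)) hB.one_le _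
            fun r _ => Spec.tick_pure hB.one_le rfl).bind
          (t' := 4 * (vs.length * Λ) + vs.length + 2 + (cs.length * (5 * sortCost vs.length Λ) + 1))
          fun rest hrest => ?_).mono_steps ?_
      · rw [List.map_map] at hcol hrest
        obtain rfl : col = vs.map fun v => (v, h v c) := hcol
        obtain rfl : rest = vs.map fun v => (v, cs.map (h v)) := hrest
        refine ((groupBy_addRow_spec (hB.card_sep_le T c) (vs.map fun v => (v, h v c))
          (by rwa [List.map_map]) (Λ := Λ) (by rwa [List.length_map])).bind fun g hg =>
            (distribute_spec vs hΛ h cs _ hcs hsize).mono ?_ le_rfl).mono_steps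
              (by rw [List.length_map])
        rintro top' ⟨hmem, hnotMem⟩
        refine ⟨List.forall_mem_cons.2 ⟨?_, hmem⟩, fun c' hc' => ?_⟩
        · rwa [hnotMem c hc, Function.update_self]
        · simp only [List.mem_cons, not_or] at hc'
          rw [hnotMem c' hc'.2, Function.update_of_ne hc'.1]
      · simp only [List.length_map, List.length_cons]
        linarith

/-- The part of a step from the root to the leaves that follows the join with the topjoin. -/
noncomputable def distributeChildren (T : JoinTree A) (bot top : Fin m → List (Row dom ℕ))
    (p : Fin m) (rows : List (Row dom (ℕ × List ℕ))) : Timed (Fin m → List (Row dom ℕ)) := do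
  let rows ← joinChildren T bot (T.children p) rows
  let rows ← mapT (fun r => do
    let x ← others r.2.1 r.2.2
    pure (r.1, x.1)) rows
  distribute T (T.children p) rows top

theorem distributeChildren_spec {bot : Fin m → List (Row dom ℕ)}
    (hbot : ∀ c, T.parent c = some i → IsBot T D c (bot c)) (top : Fin m → List (Row dom ℕ))
    {rows : List (Row dom (ℕ × List ℕ))}
    (hrows : rows.Perm ((D i).map fun t =>
      (extend (A i) t, (topCount D T i (extend (A i) t), [])))) :
    (distributeChildren T bot top i rows).Spec
      (fun top' => (∀ c, T.parent c = some i → IsTop T D c (top' c)) ∧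
        ∀ c, T.parent c ≠ some i → top' c = top c)
      ((12 * (T.children i).length + 5) * sortCost (D i).length Λ +
        ((T.children i).map fun j => (D j).length).sum) W := by
  have hlength := succ_le_sortCost (D i).length Λ
  have hmul := Nat.mul_le_mul_right (T.children i).length
    (Nat.le_of_succ_le (succ_le_sortCost (D i).length Λ))
  refine ((joinChildren_children_spec hB hbot hrows).bind
    (t' := (8 * (T.children i).length + 4) * sortCost (D i).length Λ)
    fun rows hrows => ?_).mono_steps (by linarith)
  obtain ⟨vs, hvs, rfl⟩ := hrows
  have hlen : vs.length = (D i).length := by rw [hvs.length_eq, List.length_map]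
  refine ((mapT_others_spec hB Prod.fst (hB.size_topCount_le i) hlen).bind
    (t' := (T.children i).length * (5 * sortCost (D i).length Λ) + 1)
    fun rows hrows => ?_).mono_steps (by linarith)
  subst hrows
  refine (distribute_spec hB vs (hlen ▸ hB.clog_le i) (fun v c =>
    topCount D T i v * (((T.children i).erase c).map (botCount D T · v)).prod) (T.children i) top
    (T.nodup_children i) fun c _ => ?_).mono ?_ (by rw [hlen])
  · refine hB.size_sum_prod_le hlen
      (g := fun v => topCount D T i v :: ((T.children i).erase c).map (botCount D T · v))
      (fun _ => ?_) fun v => ?_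
    · have := T.length_children_lt i
      have := (List.erase_sublist (a := c) (l := T.children i)).length_le
      rw [List.length_cons, List.length_map]
      omega
    · simp only [List.forall_mem_cons, List.forall_mem_map]
      exact ⟨hB.size_topCount_le i v, fun _ _ => hB.size_botCount_le _ v⟩
  · rintro top' ⟨hmem, hnotMem⟩
    refine ⟨fun c hc => ?_, fun c hc => hnotMem c (mt T.mem_children.1 hc)⟩
    obtain ⟨hg, hcount⟩ := hmem c (T.mem_children.2 hc)
    exact isTop_of_grouped hvs hc hg hcount

theorem lookupJoin_top_spec {top : List (Row dom ℕ)} {p : Fin m} (hp : T.parent i = some p)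
    (htop : IsTop T D i top) :
    (do
      let j ← lookupJoin (T.sep i) ((D i).map fun t => (extend (A i) t, (1, ([] : List ℕ)))) top
      mapT (fun r : Row dom (ℕ × List ℕ) × Option (Row dom ℕ) => do
        tick 0
        pure (r.1.1, (countOf r.2, r.1.2.2))) j).Spec
    (·.Perm ((D i).map fun t => (extend (A i) t, (topCount D T i (extend (A i) t), []))))
    (4 * sortCost (D i).length Λ + (D p).length) W := by
  have hsep : (T.sep i).card + 1 ≤ W := by
    have := hB.card_sep_le T i
    omega
  refine ((lookupJoin_spec hsep _ (htop p hp).strict (Λ := Λ) ?_).bind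
    (t' := (D i).length * 2 + 1) fun j hj => (Spec.mapT (t := 1)
      (g := fun r => (r.1.1, (countOf r.2, r.1.2.2))) hB.one_le j
      fun b _ => Spec.tick_pure hB.one_le rfl).mono (fun r hr => ?_) ?_).mono_steps ?_
  · rw [List.length_map]
    exact hB.clog_le i
  · rw [hr]
    refine (hj.map _).trans (.of_eq ?_)
    rw [List.map_map, List.map_map]
    refine List.map_congr_left fun t _ => ?_
    simp only [Function.comp_apply, (htop p hp).strict.countOf_lookup, (htop p hp).count]
    rfl
  · rw [hj.length_eq, List.length_map, List.length_map]
  · have := (htop p hp).length_le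
    have := le_sortCost (D i).length Λ
    rw [List.length_map]
    omega

theorem topStep_spec {bot top : Fin m → List (Row dom ℕ)}
    (hbot : ∀ c, T.parent c = some i → IsBot T D c (bot c)) (htop : IsTop T D i (top i)) :
    (topStep T D bot top i).Spec
      (fun top' => (∀ c, T.parent c = some i → IsTop T D c (top' c)) ∧
        ∀ c, T.parent c ≠ some i → top' c = top c)
      (12 * (((T.nbrs i).length + 1) * sortCost (D i).length Λ) +
        ((T.nbrs i).map fun j => (D j).length).sum) W := by
  have hlength := succ_le_sortCost (D i).length Λ
  have hchildren := Nat.mul_le_mul_right (sortCost (D i).length Λ) (T.length_children_le i)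
  have hsum : (((T.parent i).toList).map fun j => (D j).length).sum +
      ((T.children i).map fun j => (D j).length).sum =
      ((T.nbrs i).map fun j => (D j).length).sum := by
    rw [JoinTree.nbrs, List.map_append, List.sum_append]
  have htail {rows} := distributeChildren_spec hB hbot top (rows := rows)
  rw [topStep]
  refine ((readRel_spec hB i).bind (t' := (12 * (T.children i).length + 9) *
    sortCost (D i).length Λ + ((T.nbrs i).map fun j => (D j).length).sum)
    fun rows hrows => ?_).mono_steps (by nlinarith)
  subst hrows
  cases hi : T.parent i with
  | none =>
    refine (((Spec.tick_pure hB.one_le (P := (· = _)) rfl).bind fun rows hrows =>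
      htail (.of_eq ?_)).mono_steps ?_).bind_assoc
    · obtain rfl := (T.parent_eq_none i).1 hi
      simp only [hrows, topCount_root]
    · linarith [T.sum_children_le i fun j => (D j).length]
  | some p =>
    refine (((lookupJoin_top_spec hB hi htop).bind fun rows hrows =>
      htail hrows).mono_steps ?_).bind_assoc
    simp only [hi, Option.toList_some, List.map_cons, List.map_nil, List.sum_cons,
      List.sum_nil] at hsum
    linarith

end Node

theorem foldT_botStep_spec (hB : CostBounds D z Z W Λ) :
    (foldT (botStep T D) T.postOrder fun _ => []).Spec (fun bot => ∀ i, IsBot T D i (bot i))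
      (∑ i, (10 * (((T.nbrs i).length + 1) * sortCost (D i).length Λ) +
        ((T.nbrs i).map fun j => (D j).length).sum + 1) + 1) W := by
  refine (Spec.foldT (f := botStep T D) hB.one_le (I := fun l bot => ∀ i ∈ l, IsBot T D i (bot i))
    (cost := fun i => 10 * (((T.nbrs i).length + 1) * sortCost (D i).length Λ) +
      ((T.nbrs i).map fun j => (D j).length).sum) T.postOrder (fun l i r hl bot hbot =>
    (botStep_spec hB fun c hc => hbot c ?_).mono ?_ le_rfl) ?_).mono
    (fun bot h i => h i (T.mem_postOrder i)) ?_
  · exact (JoinTree.mem_left_iff hl).2 (T.parent_later c i hc)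
  · rintro _ ⟨b, rfl, hb⟩ j hj
    by_cases hji : j = i
    · rwa [hji, Function.update_self]
    · rw [Function.update_of_ne hji]
      exact hbot j (by simpa [hji] using hj)
  · simp
  · rw [T.sum_map_postOrder]

theorem foldT_topStep_spec (hB : CostBounds D z Z W Λ) {bot : Fin m → List (Row dom ℕ)}
    (hbot : ∀ i, IsBot T D i (bot i)) :
    (foldT (topStep T D bot) T.postOrder.reverse fun _ => []).Spec
      (fun top => ∀ i, IsTop T D i (top i))
      (∑ i, (12 * (((T.nbrs i).length + 1) * sortCost (D i).length Λ) +
        ((T.nbrs i).map fun j => (D j).length).sum + 1) + 1) W := by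
  refine (Spec.foldT (f := topStep T D bot) hB.one_le
    (I := fun l top => ∀ p ∈ l, ∀ i, T.parent i = some p → IsTop T D i (top i))
    (cost := fun i => 12 * (((T.nbrs i).length + 1) * sortCost (D i).length Λ) +
      ((T.nbrs i).map fun j => (D j).length).sum) T.postOrder.reverse (fun l p r hl top htop =>
    (topStep_spec hB (fun c _ => hbot c) fun q hq => htop q ?_ p hq q hq).mono ?_ le_rfl) ?_).mono
    (fun top h i p hp => h p (List.mem_reverse.2 (T.mem_postOrder p)) i hp p hp) ?_
  · have hl' : T.postOrder = r.reverse ++ p :: l.reverse := by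
      rw [← List.reverse_reverse T.postOrder, hl]
      simp
    exact List.mem_reverse.1 ((JoinTree.mem_right_iff hl').2 (T.parent_later p q hq))
  · rintro top' ⟨hchild, hother⟩ p' hp' i hi
    by_cases hpp : p' = p
    · exact hchild i (hpp ▸ hi)
    · rw [hother i (by simpa [hi] using hpp)]
      exact htop p' (by simpa [hpp] using hp') i hi
  · simp
  · rw [List.map_reverse, List.sum_reverse, T.sum_map_postOrder]

theorem multTable_eq_joinCount {bot top : Fin m → List (Row dom ℕ)}
    (hbot : ∀ i, IsBot T D i (bot i)) (htop : ∀ i, IsTop T D i (top i)) (i : Fin m)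
    (t : Tup dom (A i)) : multTable T bot top i t =
      joinCount D (Finset.univ.erase i).toList (A i) (extend (A i) t) := by
  have hchildren (v) : ((T.children i).map fun c => tableCount (T.sep c) (bot c) v) =
      (T.children i).map (botCount D T · v) := List.map_congr_left fun c _ => (hbot c).count v
  rw [multTable, joinCount_univ_erase D T, hchildren]
  congr 1
  cases hi : T.parent i with
  | none =>
    obtain rfl := (T.parent_eq_none i).1 hi
    rw [if_pos rfl, topCount_root]
  | some p =>
    rw [if_neg (Option.some_ne_none p), (htop i p hi).count, topCount]

end Messages

/-! ### The largest entry of a multiplicity table -/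

section MaxRows

variable {α : Type} {dom : α → Type}

/-- The row `r` is a largest value of `f`, a function of the attributes in `R` whose values have at
most `e` bits, together with a place where `f` attains it. -/
structure IsMaxRow (R : Finset α) (e : ℕ) (f : (∀ a, dom a) → ℕ) (r : Row dom ℕ) : Prop where
  dependsOn : DependsOn f (R : Set α)
  size_le : ∀ v, (f v).size ≤ e
  snd_eq : r.2 = f r.1
  le : ∀ v, f v ≤ r.2

theorem IsMaxRow.of_eq_zero {R : Finset α} {e : ℕ} {f : (∀ a, dom a) → ℕ} (hf : ∀ v, f v = 0)
    (v : ∀ a, dom a) : IsMaxRow R e f (v, 0) where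
  dependsOn _ _ _ := by rw [hf, hf]
  size_le v := by simp [hf]
  snd_eq := (hf v).symm
  le v := (hf v).le

/-- The table `tbl` of at most `q` rows has values of `f` as counts, among them, for each value of
the attributes in `S`, a largest one unless `f` vanishes there. The function `f` depends on the
attributes in `R`, and its values have at most `e` bits. -/
structure IsMaxTable (S R : Finset α) (q e : ℕ) (f : (∀ a, dom a) → ℕ) (tbl : List (Row dom ℕ)) :
    Prop where
  dependsOn : DependsOn f (R : Set α)
  size_le : ∀ v, (f v).size ≤ e
  snd_eq : ∀ r ∈ tbl, r.2 = f r.1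
  exists_le : ∀ v, f v ≠ 0 → ∃ r ∈ tbl, key S r.1 = key S v ∧ f v ≤ r.2
  length_le : tbl.length ≤ q

variable {S S' K R R' : Finset α} {q q' e e' : ℕ} {f f' : (∀ a, dom a) → ℕ}
  {tbl tbl' : List (Row dom ℕ)}

theorem IsMaxTable.eq_zero_of_nil (ht : IsMaxTable S R q e f []) (v : ∀ a, dom a) : f v = 0 := by
  by_contra hv
  obtain ⟨r, hr, -⟩ := ht.exists_le v hv
  exact List.not_mem_nil hr

section Mul

variable [DecidableEq α]

theorem dependsOn_mul (hf : DependsOn f (R : Set α)) (hf' : DependsOn f' (R' : Set α)) :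
    DependsOn (fun v => f v * f' v) ((R ∪ R' : Finset α) : Set α) := fun v v' hv => by
  rw [Finset.coe_union] at hv
  exact congrArg₂ _ (hf fun a ha => hv a (.inl ha)) (hf' fun a ha => hv a (.inr ha))

theorem IsMaxRow.mul {r y : Row dom ℕ} (hr : IsMaxRow R e f r)
    (ht : IsMaxTable S R' q e' f' tbl) (hR : Disjoint R R') (hy : y ∈ tbl)
    (hmax : ∀ y' ∈ tbl, y'.2 ≤ y.2) :
    IsMaxRow (R ∪ R') (e + e') (fun v => f v * f' v) (R.piecewise r.1 y.1, r.2 * y.2) where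
  dependsOn := dependsOn_mul hr.dependsOn ht.dependsOn
  size_le v := (size_mul_le _ _).trans (Nat.add_le_add (hr.size_le v) (ht.size_le v))
  snd_eq := by
    have hfst : f (R.piecewise r.1 y.1) = r.2 := hr.snd_eq ▸
      hr.dependsOn fun a ha => Finset.piecewise_eq_of_mem _ _ _ ha
    have hsnd : f' (R.piecewise r.1 y.1) = y.2 := ht.snd_eq y hy ▸ ht.dependsOn fun a ha =>
      Finset.piecewise_eq_of_notMem _ _ _ (Finset.disjoint_right.1 hR ha)
    rw [hfst, hsnd]
  le v := by
    refine Nat.mul_le_mul (hr.le v) ?_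
    by_cases hv : f' v = 0
    · exact hv.trans_le (Nat.zero_le _)
    · obtain ⟨y', hy', -, hle⟩ := ht.exists_le v hv
      exact hle.trans (hmax y' hy')

end Mul

variable [LinearOrder α] [∀ a, LinearOrder (dom a)]

theorem IsMaxTable.exists_lookup (ht : IsMaxTable S R q e f tbl) (hK : K ⊆ S)
    {msg : List (Row dom ℕ)} (hmsg : StrictBy K msg)
    (hmax : ∀ r ∈ tbl, ∃ r' ∈ msg, key K r'.1 = key K r.1 ∧ r.2 ≤ r'.2) {u v : ∀ a, dom a}
    (huv : key K u = key K v) (hv : f v ≠ 0) : ∃ y, lookup K msg u = some y ∧ f v ≤ y.2 := by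
  obtain ⟨r, hr, hrv, hle⟩ := ht.exists_le v hv
  obtain ⟨y', hy', hyr, hle'⟩ := hmax r hr
  have huy : key K y'.1 = key K u := by rw [hyr, key_eq_mono hK hrv, huv]
  obtain ⟨y, hy⟩ : ∃ y, lookup K msg u = some y := Option.ne_none_iff_exists'.1 fun hnone =>
    lookup_eq_none_iff.1 hnone y' hy' huy.symm
  obtain ⟨hymem, hyu⟩ := mem_of_lookup_eq_some hy
  refine ⟨y, hy, (hle.trans hle').trans_eq ?_⟩
  rw [← hmsg.tableCount_eq hy' huy, ← hmsg.tableCount_eq hymem hyu.symm]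

/-- The row `r`, which assigns the attributes in `R`, joined with the row of `msg` that agrees with
it on `K`. -/
noncomputable def joinRow (K R : Finset α) (msg : List (Row dom ℕ)) (r : Row dom ℕ) :
    Option (Row dom ℕ) :=
  (lookup K msg r.1).map fun y => (R.piecewise r.1 y.1, r.2 * y.2)

theorem perm_filterMap_joinRow {msg : List (Row dom ℕ)} {l : List (Row dom ℕ × Option (Row dom ℕ))}
    (hl : l.Perm (tbl.map fun r => (r, lookup K msg r.1))) :
    (l.map fun r => r.2.map fun y => (R.piecewise r.1.1 y.1, r.1.2 * y.2)).reduceOption.Perm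
      (tbl.filterMap (joinRow K R msg)) := by
  have hperm := (hl.map fun r => r.2.map fun y => (R.piecewise r.1.1 y.1, r.1.2 * y.2)).filterMap id
  rwa [List.map_map, List.filterMap_map (l := tbl)] at hperm

theorem IsMaxTable.join (ht : IsMaxTable S R q e f tbl) (ht' : IsMaxTable S' R' q' e' f' tbl')
    (hKS : K ⊆ S) (hKS' : K ⊆ S') (hSR : S ⊆ R) (hRR' : R ∩ R' ⊆ K) {msg rows : List (Row dom ℕ)}
    (hmsg : StrictBy K msg) (hmem : ∀ r ∈ msg, r ∈ tbl')
    (hmax : ∀ r ∈ tbl', ∃ r' ∈ msg, key K r'.1 = key K r.1 ∧ r.2 ≤ r'.2)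
    (hrows : rows.Perm (tbl.filterMap (joinRow K R msg))) :
    IsMaxTable S (R ∪ R') q (e + e') (fun v => f v * f' v) rows where
  dependsOn := dependsOn_mul ht.dependsOn ht'.dependsOn
  size_le v := (size_mul_le _ _).trans (Nat.add_le_add (ht.size_le v) (ht'.size_le v))
  snd_eq x hx := by
    obtain ⟨r, hr, hrx⟩ := List.mem_filterMap.1 (hrows.mem_iff.1 hx)
    obtain ⟨y, hy, rfl⟩ := Option.map_eq_some_iff.1 hrx
    obtain ⟨hymem, hykey⟩ := mem_of_lookup_eq_some hy
    refine congrArg₂ _ ((ht.snd_eq r hr).trans ?_) ((ht'.snd_eq y (hmem y hymem)).trans ?_)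
    · exact ht.dependsOn fun a ha => (Finset.piecewise_eq_of_mem _ _ _ ha).symm
    · refine ht'.dependsOn fun a ha => ?_
      by_cases haR : a ∈ R
      · exact (key_eq_iff.1 hykey a (hRR' (Finset.mem_inter.2 ⟨haR, ha⟩))).symm.trans
          (Finset.piecewise_eq_of_mem _ _ _ haR).symm
      · exact (Finset.piecewise_eq_of_notMem _ _ _ haR).symm
  exists_le v hv := by
    obtain ⟨r, hr, hrv, hle⟩ := ht.exists_le v (left_ne_zero_of_mul hv)
    obtain ⟨y, hy, hle'⟩ := ht'.exists_lookup hKS' hmsg hmax (key_eq_mono hKS hrv)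
      (right_ne_zero_of_mul hv)
    refine ⟨(R.piecewise r.1 y.1, r.2 * y.2), hrows.mem_iff.2 (List.mem_filterMap.2
      ⟨r, hr, by rw [joinRow, hy]; rfl⟩), ?_, Nat.mul_le_mul hle hle'⟩
    exact hrv ▸ key_eq_iff.2 fun a ha => Finset.piecewise_eq_of_mem _ _ _ (hSR ha)
  length_le := hrows.length_eq.trans_le ((List.length_filterMap_le _ _).trans ht.length_le)

end MaxRows

section MaxInv

variable {α : Type} [DecidableEq α] {dom : α → Type} {m : ℕ}

@[to_additive]
theorem prod_erase_update {ι M : Type} [DecidableEq ι] [CommMonoid M] {s : Finset ι} {j w : ι}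
    (hj : j ∈ s) (hw : w ∈ s) (hwj : w ≠ j) (φ : ι → M) :
    ∏ x ∈ s.erase j, Function.update φ w (φ w * φ j) x = ∏ x ∈ s, φ x := by
  have hw' : w ∈ s.erase j := Finset.mem_erase.2 ⟨hwj, hw⟩
  rw [Finset.prod_update_of_mem hw', ← Finset.mul_prod_erase s φ hj,
    ← Finset.mul_prod_erase _ φ hw', Finset.sdiff_singleton_eq_erase, ← mul_assoc,
    mul_comm (φ w)]

/-- The invariant of the search for the largest value of `F`: it is the product of `f`, for which
the state holds a largest value, and of the `g j` for `j ∈ s`, for which the state holds tables.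
The tables may meet only in the attributes that they share as hyperedges `E j`, and the bit lengths
add up to at most `Z`. -/
structure MaxInv (E : Fin m → Finset α) (F : (∀ a, dom a) → ℕ) (Z : ℕ) (q : Fin m → ℕ)
    (s : Finset (Fin m)) (st : MaxState m dom) (g : Fin m → (∀ a, dom a) → ℕ)
    (f : (∀ a, dom a) → ℕ) (e : Fin m → ℕ) (eb : ℕ) : Prop where
  prod : ∀ v, f v * ∏ j ∈ s, g j v = F v
  size_sum : eb + ∑ j ∈ s, e j ≤ Z
  table : ∀ j ∈ s, IsMaxTable (E j) (st.reg j) (q j) (e j) (g j) (st.tbl j)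
  best : IsMaxRow st.bestReg eb f st.best
  subset_reg : ∀ j ∈ s, E j ⊆ st.reg j
  reg_inter : ∀ j ∈ s, ∀ j' ∈ s, j ≠ j' → st.reg j ∩ st.reg j' ⊆ E j
  disjoint_best : ∀ j ∈ s, Disjoint st.bestReg (st.reg j)

namespace MaxInv

variable {E : Fin m → Finset α} {F : (∀ a, dom a) → ℕ} {Z : ℕ} {q : Fin m → ℕ}
  {s : Finset (Fin m)} {st : MaxState m dom} {g : Fin m → (∀ a, dom a) → ℕ}
  {f : (∀ a, dom a) → ℕ} {e : Fin m → ℕ} {eb : ℕ}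

theorem size_row (h : MaxInv E F Z q s st g f e eb) {j : Fin m} (hj : j ∈ s) {r : Row dom ℕ}
    (hr : r ∈ st.tbl j) : r.2.size ≤ Z := by
  have hle : e j ≤ ∑ x ∈ s, e x := Finset.single_le_sum (fun _ _ => Nat.zero_le _) hj
  rw [(h.table j hj).snd_eq r hr]
  exact (((h.table j hj).size_le _).trans hle).trans ((Nat.le_add_left _ _).trans h.size_sum)

theorem size_best (h : MaxInv E F Z q s st g f e eb) : st.best.2.size ≤ Z := by
  rw [h.best.snd_eq]
  exact (h.best.size_le _).trans ((Nat.le_add_right _ _).trans h.size_sum)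

theorem inter_reg_subset (h : MaxInv E F Z q s st g f e eb) {j x : Fin m} (hj : j ∈ s) (hx : x ∈ s)
    (hxj : x ≠ j) : st.reg j ∩ st.reg x ⊆ E j ∩ E x :=
  Finset.subset_inter (h.reg_inter j hj x hx hxj.symm)
    (Finset.inter_comm (st.reg j) _ ▸ h.reg_inter x hx j hj hxj)

theorem removeIsolated (h : MaxInv E F Z q s st g f e eb) {j : Fin m}
    (hear : IsEarWitness E s j none) {b : Row dom ℕ} {R : Finset α}
    (hb : IsMaxRow R (eb + e j) (fun v => f v * g j v) b) (hR : R ⊆ st.bestReg ∪ st.reg j) :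
    MaxInv E F Z q (s.erase j) { st with best := b, bestReg := R } g (fun v => f v * g j v) e
      (eb + e j) where
  prod v := by rw [mul_assoc, Finset.mul_prod_erase s (g · v) hear.mem, h.prod]
  size_sum := by rw [add_assoc, Finset.add_sum_erase s e hear.mem]; exact h.size_sum
  table x hx := h.table x (Finset.mem_of_mem_erase hx)
  best := hb
  subset_reg x hx := h.subset_reg x (Finset.mem_of_mem_erase hx)
  reg_inter x hx y hy := h.reg_inter x (Finset.mem_of_mem_erase hx) y (Finset.mem_of_mem_erase hy)
  disjoint_best x hx := by
    obtain ⟨hxj, hxs⟩ := Finset.mem_erase.1 hx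
    have hjx : Disjoint (st.reg j) (st.reg x) := Finset.disjoint_iff_inter_eq_empty.2
      (Finset.subset_empty.1 ((h.inter_reg_subset hear.mem hxs hxj).trans
        (hear.inter_subset x hxs hxj)))
    exact (Finset.disjoint_union_left.2 ⟨h.disjoint_best x hxs, hjx⟩).mono_left hR

theorem removeEar (h : MaxInv E F Z q s st g f e eb) {j w : Fin m}
    (hear : IsEarWitness E s j (some w)) {tbl : List (Row dom ℕ)}
    (ht : IsMaxTable (E w) (st.reg w ∪ st.reg j) (q w) (e w + e j) (fun v => g w v * g j v) tbl) :
    MaxInv E F Z q (s.erase j)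
      { st with
        tbl := Function.update st.tbl w tbl
        reg := Function.update st.reg w (st.reg w ∪ st.reg j) }
      (Function.update g w fun v => g w v * g j v) f (Function.update e w (e w + e j)) eb where
  prod v := by
    rw [← h.prod v, ← prod_erase_update hear.mem (hear.witness_mem w rfl) (hear.witness_ne w rfl)
      (g · v)]
    refine congrArg _ (Finset.prod_congr rfl fun x _ => ?_)
    obtain rfl | hxw := eq_or_ne x w
    · simp only [Function.update_self]
    · simp only [Function.update_of_ne hxw]
  size_sum := by
    rw [sum_erase_update hear.mem (hear.witness_mem w rfl) (hear.witness_ne w rfl)]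
    exact h.size_sum
  table x hx := by
    obtain rfl | hxw := eq_or_ne x w
    · simpa only [Function.update_self] using ht
    · simpa only [Function.update_of_ne hxw] using h.table x (Finset.mem_of_mem_erase hx)
  best := h.best
  subset_reg x hx := by
    have := h.subset_reg
    dsimp only
    grind
  reg_inter x hx y hy hxy := by
    have hjw : ∀ z ∈ s, z ≠ j → st.reg j ∩ st.reg z ⊆ E w := fun z hz hzj =>
      (h.inter_reg_subset hear.mem hz hzj).trans (hear.inter_subset z hz hzj)
    have hmem := hear.mem
    have := h.reg_inter
    dsimp only
    grind
  disjoint_best x hx := by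
    obtain rfl | hxw := eq_or_ne x w
    · simpa only [Function.update_self] using Finset.disjoint_union_right.2
        ⟨h.disjoint_best x (Finset.mem_of_mem_erase hx), h.disjoint_best j hear.mem⟩
    · simpa only [Function.update_of_ne hxw] using h.disjoint_best x (Finset.mem_of_mem_erase hx)

end MaxInv

end MaxInv

section NodeMax

variable {α : Type} [LinearOrder α] {dom : α → Type} [∀ a, LinearOrder (dom a)]
  {m : ℕ} {A : Fin m → Finset α} {i : Fin m} {F : (∀ a, dom a) → ℕ}
  {Z W Λ : ℕ} {q : Fin m → ℕ} {s : Finset (Fin m)} {st : MaxState m dom}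
  {g : Fin m → (∀ a, dom a) → ℕ} {f : (∀ a, dom a) → ℕ} {e : Fin m → ℕ} {eb : ℕ}

theorem maxStep_none_spec (hW : (A i).card + (Z + 1) ^ 2 + 1 ≤ W)
    (h : MaxInv (A i ∩ A ·) F Z q s st g f e eb) {j : Fin m}
    (hear : IsEarWitness (A i ∩ A ·) s j none) :
    (maxStep A i st (j, none)).Spec
      (fun st' => MaxInv (A i ∩ A ·) F Z q (s.erase j) st' g (fun v => f v * g j v) e (eb + e j))
      (q j + 2) W := by
  have htbl := h.table j hear.mem
  unfold maxStep
  refine ((bestRow_spec (Z := Z) (by omega) (st.tbl j) fun r hr => h.size_row hear.mem hr).bind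
    (t' := 1) ?_).mono_steps (by have := htbl.length_le; omega)
  rintro _ (⟨rfl, hnil⟩ | ⟨y, hy, rfl, hmax⟩)
  · rw [hnil] at htbl
    have hzero : ∀ v, f v * g j v = 0 := fun v => by rw [htbl.eq_zero_of_nil, mul_zero]
    exact Spec.tick_pure (by omega)
      (h.removeIsolated hear (IsMaxRow.of_eq_zero hzero _) Finset.subset_union_left)
  · have harith := arith_le h.size_best (h.size_row hear.mem hy)
    exact Spec.tick_pure (by omega)
      (h.removeIsolated hear (h.best.mul htbl (h.disjoint_best j hear.mem) hy hmax) subset_rfl)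

theorem maxStep_some_spec (hW : (A i).card + (Z + 1) ^ 2 + 1 ≤ W)
    (hΛ : ∀ j ∈ s, Nat.clog 2 (q j) ≤ Λ)
    (h : MaxInv (A i ∩ A ·) F Z q s st g f e eb) {j w : Fin m}
    (hear : IsEarWitness (A i ∩ A ·) s j (some w)) :
    (maxStep A i st (j, some w)).Spec
      (fun st' => MaxInv (A i ∩ A ·) F Z q (s.erase j) st'
        (Function.update g w fun v => g w v * g j v) f (Function.update e w (e w + e j)) eb)
      (4 * (sortCost (q j) Λ + sortCost (q w) Λ)) W := by
  have hj := hear.mem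
  have hw := hear.witness_mem w rfl
  have hclog : ∀ x ∈ s, Nat.clog 2 (st.tbl x).length ≤ Λ := fun x hx =>
    (Nat.clog_mono_right 2 (h.table x hx).length_le).trans (hΛ x hx)
  have hcard : (A i ∩ A j ∩ A w).card ≤ (A i).card :=
    Finset.card_le_card (Finset.inter_subset_left.trans Finset.inter_subset_left)
  have hKw : A i ∩ A j ∩ A w ⊆ A i ∩ A w :=
    Finset.inter_subset_inter_right Finset.inter_subset_left
  have hreg : st.reg w ∩ st.reg j ⊆ A i ∩ A j ∩ A w := by
    rw [Finset.inter_comm, Finset.inter_assoc, Finset.inter_inter_distrib_left]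
    exact h.inter_reg_subset hj hw (hear.witness_ne w rfl)
  have hone : 1 ≤ W := by omega
  unfold maxStep
  refine ((groupBy_maxRow_spec (S := A i ∩ A j ∩ A w) (Z := Z) (by omega) (st.tbl j)
    (fun r hr => h.size_row hj hr) (hclog j hj)).bind fun msg hmsg =>
    ((lookupJoin_spec (by omega) (st.tbl w) hmsg.1.strict (hclog w hw)).mono_steps
      (Nat.add_le_add_right (Nat.add_le_add_left hmsg.1.length_le _) 2)).bind
    (t' := 2 * (st.tbl w).length + 1 + ((st.tbl w).length + 1)) fun l hl => ?_).mono_steps ?_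
  · have hlen : l.length = (st.tbl w).length := by rw [hl.length_eq, List.length_map]
    refine ((Spec.mapT (t := 1) (g := fun r => r.2.map fun y =>
      ((st.reg w).piecewise r.1.1 y.1, r.1.2 * y.2)) hone l ?_).bind
      (t' := (st.tbl w).length + 1) ?_).mono_steps (by rw [hlen]; omega)
    · rintro ⟨r, _ | y⟩ hx
      · exact Spec.tick_pure (by omega) rfl
      · obtain ⟨r, hr, hry⟩ := List.mem_map.1 (hl.mem_iff.1 hx)
        obtain ⟨rfl, hy⟩ := Prod.mk.inj hry
        have harith := arith_le (h.size_row hw hr)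
          (h.size_row hj (hmsg.2.1 y (mem_of_lookup_eq_some hy).1))
        exact Spec.tick_pure (by dsimp only; omega) rfl
    · rintro rows rfl
      have hinv := h.removeEar hear ((h.table w hw).join (h.table j hj) hKw
        Finset.inter_subset_left (h.subset_reg w hw) hreg hmsg.1.strict hmsg.2.1 hmsg.2.2
        (perm_filterMap_joinRow hl))
      refine ((Spec.ticks hone).bind (t' := 1) fun _ _ => Spec.tick_pure
        (P := fun st' => MaxInv _ _ _ _ _ st' _ _ _ eb) (by omega) hinv).mono_steps ?_
      rw [List.length_map, hlen]
  · have hlj := (h.table j hj).length_le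
    have hlw := (h.table w hw).length_le
    have hsj := le_sortCost (q j) Λ
    have hsw := le_sortCost (q w) Λ
    have hmj := Nat.mul_le_mul_right Λ hlj
    have hmw := Nat.mul_le_mul_right Λ hlw
    omega

theorem foldT_maxStep_spec (hW : (A i).card + (Z + 1) ^ 2 + 1 ≤ W) {N : ℕ}
    {P : List (Fin m × Option (Fin m))} (hP : GYOSeq (A i ∩ A ·) s P)
    (hΛ : ∀ j ∈ s, Nat.clog 2 (q j) ≤ Λ) (hN : ∀ j ∈ s, q j ≤ N)
    (h : MaxInv (A i ∩ A ·) F Z q s st g f e eb) :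
    (foldT (maxStep A i) P st).Spec (fun st' => st'.best.2 = F st'.best.1 ∧ ∀ v, F v ≤ st'.best.2)
      (P.length * (8 * sortCost N Λ + 1) + 1) W := by
  have hcost : ∀ j ∈ s, sortCost (q j) Λ ≤ sortCost N Λ := fun j hj =>
    Nat.mul_le_mul_right _ (Nat.succ_le_succ (hN j hj))
  induction hP generalizing st g f e eb with
  | nil =>
    obtain rfl : F = f := funext fun v => by rw [← h.prod v, Finset.prod_empty, mul_one]
    exact (Spec.tick_pure (by omega) ⟨h.best.snd_eq, h.best.le⟩).mono_steps (Nat.le_add_left _ _)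
  | @cons s j w P hear _ ih =>
    have hs : ∀ {x}, x ∈ s.erase j → x ∈ s := Finset.mem_of_mem_erase
    have ih {st' g' f' e' eb'} := ih (st := st') (g := g') (f := f') (e := e') (eb := eb')
      (fun x hx => hΛ x (hs hx)) (fun x hx => hN x (hs hx))
    rw [foldT, List.length_cons, add_one_mul]
    cases w with
    | none =>
      refine ((Spec.tick (w := 0) (by omega)).bind fun _ _ => (maxStep_none_spec hW h hear).bind
        fun st' h' => ih h' fun x hx => hcost x (hs hx)).mono_steps ?_
      have := hcost j hear.mem
      have := succ_le_sortCost (q j) Λ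
      omega
    | some w =>
      refine ((Spec.tick (w := 0) (by omega)).bind fun _ _ => (maxStep_some_spec hW hΛ h hear).bind
        fun st' h' => ih h' fun x hx => hcost x (hs hx)).mono_steps ?_
      have := hcost j hear.mem
      have := hcost w (hear.witness_mem w rfl)
      omega

section Init

variable [∀ a, Inhabited (dom a)] {D : ∀ i, List (Tup dom (A i))} {z : ℕ} {T : JoinTree A}

theorem IsGroupedJoin.isMaxTable {U : List (Fin m)} {S : Finset α} {n : ℕ} {tbl : List (Row dom ℕ)}
    (h : IsGroupedJoin D U S n tbl) (hz : ∀ v, (joinCount D U S v).size ≤ z) :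
    IsMaxTable S S n z (joinCount D U S) tbl where
  dependsOn _ _ hv := joinCount_congr (fun _ _ => rfl) fun _ _ =>
    key_eq_iff.2 fun a ha => hv a (Finset.mem_inter.1 ha).1
  size_le := hz
  snd_eq r hr := by rw [← h.count, h.strict.tableCount_eq hr rfl]
  exists_le v hv := by
    by_contra! hlt
    rw [← h.count] at hv
    refine hv (tableCount_eq_zero fun r hr hk => (hlt r hr hk).ne ?_)
    rw [← h.count, h.strict.tableCount_eq hr hk]
  length_le := h.length_le

/-- The sensitivity of the projection of `v` to the attributes of relation `i`. -/
noncomputable def sensCount (D : ∀ i, List (Tup dom (A i))) (i : Fin m) (v : ∀ a, dom a) : ℕ :=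
  joinCount D (Finset.univ.erase i).toList (A i) v

/-- The relations on the side of the neighbour `j` of `i` in the join tree. -/
noncomputable def nbrSide (T : JoinTree A) (i j : Fin m) : List (Fin m) :=
  if T.parent i = some j then T.subCompl i else T.sub j

theorem nodup_nbrSide (T : JoinTree A) (i j : Fin m) : (nbrSide T i j).Nodup := by
  unfold nbrSide
  split_ifs
  exacts [T.nodup_subCompl i, T.nodup_sub j]

theorem nbrSide_of_parent {j : Fin m} (h : T.parent i = some j) : nbrSide T i j = T.subCompl i :=
  if_pos h

theorem nbrSide_of_child {j : Fin m} (h : T.parent j = some i) : nbrSide T i j = T.sub j :=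
  if_neg fun h' => lt_asymm (T.parent_later i j h') (T.parent_later j i h)

/-- The number of ways to extend `v` to the relations on the side of the neighbour `j` of `i`: the
topjoin of `i` if `j` is its parent, the botjoin of `j` otherwise. -/
noncomputable def nbrCount (D : ∀ i, List (Tup dom (A i))) (T : JoinTree A) (i j : Fin m)
    (v : ∀ a, dom a) : ℕ :=
  joinCount D (nbrSide T i j) (A i ∩ A j) v

theorem sensCount_eq_prod_nbrCount (i : Fin m) (v : ∀ a, dom a) :
    sensCount D i v = ∏ j ∈ (T.nbrs i).toFinset, nbrCount D T i j v := by
  rw [sensCount, joinCount_univ_erase D T, List.prod_toFinset _ (T.nodup_nbrs i), JoinTree.nbrs,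
    List.map_append, List.prod_append]
  congr 1
  · cases hp : T.parent i with
    | none => rw [(T.parent_eq_none i).1 hp, topCount_root]; rfl
    | some p =>
      simp only [Option.toList_some, List.map_singleton, List.prod_singleton, nbrCount, topCount,
        nbrSide_of_parent hp, T.sep_eq hp]
  · refine congrArg _ (List.map_congr_left fun c hc => ?_)
    have hp := T.mem_children.1 hc
    rw [nbrCount, botCount, nbrSide_of_child hp, T.sep_eq hp, Finset.inter_comm]

theorem isGroupedJoin_nbr {bot top : Fin m → List (Row dom ℕ)} (hbot : ∀ i, IsBot T D i (bot i))
    (htop : ∀ i, IsTop T D i (top i)) {j : Fin m} (hj : j ∈ T.nbrs i) :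
    IsGroupedJoin D (nbrSide T i j) (A i ∩ A j) (D j).length
      (if T.parent i = some j then top i else bot j) := by
  obtain hp | hc := T.mem_nbrs.1 hj
  · rw [if_pos hp, nbrSide_of_parent hp, ← T.sep_eq hp]
    exact htop i j hp
  · rw [if_neg fun hp => lt_asymm (T.parent_later i j hp) (T.parent_later j i hc),
      nbrSide_of_child hc, Finset.inter_comm, ← T.sep_eq hc]
    exact hbot j

theorem maxInv_init (hB : CostBounds D z Z W Λ) {bot top : Fin m → List (Row dom ℕ)}
    (hbot : ∀ i, IsBot T D i (bot i)) (htop : ∀ i, IsTop T D i (top i)) (i : Fin m) :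
    MaxInv (A i ∩ A ·) (sensCount D i) Z (fun j => (D j).length) (T.nbrs i).toFinset
      { tbl := fun j => if T.parent i = some j then top i else bot j
        reg := fun j => A i ∩ A j
        best := (fun _ => default, 1)
        bestReg := ∅ }
      (nbrCount D T i) (fun _ => 1) (fun _ => z) 1 where
  prod v := by rw [one_mul, sensCount_eq_prod_nbrCount]
  size_sum := by
    rw [Finset.sum_const, smul_eq_mul, List.toFinset_card_of_nodup (T.nodup_nbrs i)]
    have hlen := Nat.mul_le_mul_right z (T.length_nbrs_lt i).le
    have hZ := hB.le_size
    rw [mul_add_one, mul_comm z m] at hZ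
    omega
  table j hj := (isGroupedJoin_nbr hbot htop (List.mem_toFinset.1 hj)).isMaxTable fun v =>
    hB.size_joinCount_le _ (nodup_nbrSide T i j) _ v
  best :=
    { dependsOn := fun _ _ _ => rfl
      size_le := fun _ => Nat.size_one.le
      snd_eq := rfl
      le := fun _ => le_rfl }
  subset_reg _ _ := subset_rfl
  reg_inter _ _ _ _ _ := Finset.inter_subset_left
  disjoint_best _ _ := Finset.disjoint_empty_left _

theorem nodeMax_spec (hB : CostBounds D z Z W Λ) (hT : T.NbrsAcyclic)
    {bot top : Fin m → List (Row dom ℕ)} (hbot : ∀ i, IsBot T D i (bot i))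
    (htop : ∀ i, IsTop T D i (top i)) (i : Fin m) :
    (nodeMax T bot top i).Spec
      (fun r => r.2 = sensCount D i r.1 ∧ ∀ v, sensCount D i v ≤ r.2)
      (8 * (((T.nbrs i).length + 1) * sortCost ((T.nbrs i).map fun j => (D j).length).sum Λ) +
        6 * ((T.nbrs i).length + 1) ^ 2) W := by
  have hcard : ∀ j, (A i ∩ A j).card ≤ (allAttrs A).card := fun j =>
    Finset.card_le_card (Finset.inter_subset_left.trans (subset_allAttrs A i))
  have hW : 2 * (allAttrs A).card + 1 ≤ W := by have := hB.le_work; omega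
  have hN : ∀ j ∈ (T.nbrs i).toFinset, (D j).length ≤ ((T.nbrs i).map fun j => (D j).length).sum :=
    fun j hj => List.single_le_sum (fun _ _ => Nat.zero_le _) _
      (List.mem_map_of_mem (List.mem_toFinset.1 hj))
  unfold nodeMax
  refine ((Spec.ticks hB.one_le).bind fun _ _ => (gyo_spec hcard hW (2 * (T.nbrs i).length)
    (T.nbrs i) (T.nbrs i) (T.nodup_nbrs i) le_rfl (by omega)
    (fun j hj => List.mem_toFinset.1 hj.1) ((hT i).inter_left _)).bind
    (t' := (T.nbrs i).length * (8 * sortCost ((T.nbrs i).map fun j => (D j).length).sum Λ + 1) + 1)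
    fun P hP => ((foldT_maxStep_spec (hB.card_le subset_rfl) hP (fun j _ => hB.clog_le j) hN
      (maxInv_init hB hbot htop i)).bind fun st hst => Spec.pure hst).mono_steps ?_).mono_steps ?_
  · rw [hP.length_eq, List.toFinset_card_of_nodup (T.nodup_nbrs i), add_zero]
  · nlinarith

end Init

end NodeMax

/-! ### The algorithm -/

section Algorithm

variable {α : Type} [LinearOrder α] {dom : α → Type} [∀ a, LinearOrder (dom a)]
  [∀ a, Inhabited (dom a)] {m : ℕ} {A : Fin m → Finset α}
  {D : ∀ i, List (Tup dom (A i))} {z Z W Λ q : ℕ} {T : JoinTree A}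

theorem CostBounds.size_sensCount_le (hB : CostBounds D z Z W Λ) (i : Fin m) (v : ∀ a, dom a) :
    (sensCount D i v).size ≤ Z := by
  have hz := hB.size_joinCount_le _ (Finset.nodup_toList (Finset.univ.erase i)) (A i) v
  have hZ := hB.le_size
  rw [mul_add_one] at hZ
  unfold sensCount
  omega

theorem sensCount_extend_restrict (i : Fin m) (v : ∀ a, dom a) :
    sensCount D i (extend (A i) ((A i).restrict v)) = sensCount D i v :=
  joinCount_congr (fun _ _ => rfl) fun _ _ => key_eq_iff.2 fun _ ha =>
    dif_pos (Finset.mem_inter.1 ha).1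

theorem sensCount_eq_zero (h : ¬ m ≤ (∑ i, (D i).length) + 1) (i : Fin m) (v : ∀ a, dom a) :
    sensCount D i v = 0 := by
  obtain ⟨j, hj, hj0⟩ : ∃ j ∈ Finset.univ.erase i, D j = [] := by
    by_contra! hne
    have hcard : (Finset.univ.erase i).card • 1 ≤ ∑ j ∈ Finset.univ.erase i, (D j).length :=
      Finset.card_nsmul_le_sum _ _ _ fun j hj => List.length_pos_of_ne_nil (hne j hj)
    have hsum : ∑ j ∈ Finset.univ.erase i, (D j).length ≤ ∑ j, (D j).length :=
      Finset.sum_le_sum_of_subset (Finset.erase_subset _ _)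
    rw [smul_eq_mul, mul_one, Finset.card_erase_of_mem (Finset.mem_univ i), Finset.card_univ,
      Fintype.card_fin] at hcard
    omega
  exact joinCount_eq_zero hj0 (Finset.mem_toList.2 hj) _ _

/-- The candidate `b` of the search over the nodes has at least the sensitivity of every tuple of
the relations in `l`; it is a genuine tuple sensitivity unless it is the initial value `0`. -/
structure IsMaxSens (D : ∀ i, List (Tup dom (A i))) (l : List (Fin m)) (b : Fin m × Row dom ℕ) :
    Prop where
  eq_zero_or : b.2.2 = 0 ∨ b.2.2 = sensCount D b.1 b.2.1
  le : ∀ i ∈ l, ∀ v, sensCount D i v ≤ b.2.2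

theorem IsMaxSens.eq_sensCount {l : List (Fin m)} {b : Fin m × Row dom ℕ} (hb : IsMaxSens D l b)
    (hl : b.1 ∈ l) : b.2.2 = sensCount D b.1 b.2.1 := by
  obtain h0 | h := hb.eq_zero_or
  · have := hb.le b.1 hl b.2.1
    omega
  · exact h

theorem IsMaxSens.select_spec (hB : CostBounds D z Z W Λ) {l : List (Fin m)}
    {b : Fin m × Row dom ℕ} (hb : IsMaxSens D l b) {i : Fin m} {r : Row dom ℕ}
    (hr : r.2 = sensCount D i r.1) (hmax : ∀ v, sensCount D i v ≤ r.2) :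
    (do tick (arith b.2.2 r.2); if b.2.2 < r.2 then pure (i, r) else pure b : Timed _).Spec
      (IsMaxSens D (l ++ [i])) 1 W := by
  have hbZ : b.2.2.size ≤ Z := by
    obtain h | h := hb.eq_zero_or <;> rw [h]
    exacts [Nat.size_zero.trans_le (Nat.zero_le _), hB.size_sensCount_le _ _]
  have harith : arith b.2.2 r.2 ≤ (Z + 1) ^ 2 := arith_le hbZ (hr ▸ hB.size_sensCount_le _ _)
  have hW := hB.le_work
  refine (Spec.tick (by omega)).bind (t' := 0) fun _ _ => ?_
  split_ifs with hlt
  · refine Spec.pure ⟨.inr hr, fun j hj v => ?_⟩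
    obtain hj | hj := List.mem_append.1 hj
    · exact (hb.le j hj v).trans hlt.le
    · exact List.mem_singleton.1 hj ▸ hmax v
  · refine Spec.pure ⟨hb.eq_zero_or, fun j hj v => ?_⟩
    obtain hj | hj := List.mem_append.1 hj
    · exact hb.le j hj v
    · exact (List.mem_singleton.1 hj ▸ hmax v).trans (not_lt.1 hlt)

theorem selectMax_spec (hB : CostBounds D z Z W Λ) (hT : T.NbrsAcyclic)
    {bot top : Fin m → List (Row dom ℕ)} (hbot : ∀ i, IsBot T D i (bot i))
    (htop : ∀ i, IsTop T D i (top i)) :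
    (selectMax T bot top).Spec (IsMaxSens D T.postOrder)
      (∑ i, (8 * (((T.nbrs i).length + 1) * sortCost ((T.nbrs i).map fun j => (D j).length).sum Λ) +
        6 * ((T.nbrs i).length + 1) ^ 2 + 2) + 1) W := by
  rw [← T.sum_map_postOrder]
  exact Spec.foldT hB.one_le (I := IsMaxSens D) T.postOrder
    (fun l i _ _ b hb => (nodeMax_spec hB hT hbot htop i).bind fun _ hr =>
      hb.select_spec hB hr.1 hr.2)
    ⟨.inl rfl, fun _ hi => absurd hi List.not_mem_nil⟩

/-- The output of the algorithm holds a largest tuple sensitivity, a tuple that attains it, and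
tables from which all tuple sensitivities can be read off. -/
structure IsCorrectOutput (T : JoinTree A) (D : ∀ i, List (Tup dom (A i))) (out : Output A dom) :
    Prop where
  ls_eq : out.ls = sensCount D out.rel (extend _ out.tuple)
  le_ls : ∀ i v, sensCount D i v ≤ out.ls
  multTable_eq : ∀ i t, multTable T out.bot out.top i t = sensCount D i (extend _ t)

namespace IsCorrectOutput

variable {out : Output A dom}

theorem multTable_eq_upSens (h : IsCorrectOutput T D out) (i : Fin m) (t : Tup dom (A i)) :
    multTable T out.bot out.top i t = upSens (fun i => (D i : Multiset (Tup dom (A i)))) i t :=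
  (h.multTable_eq i t).trans (upSens_eq_joinCount D i t).symm

theorem tupleSens_eq_ls (h : IsCorrectOutput T D out) :
    tupleSens (fun i => (D i : Multiset (Tup dom (A i)))) out.rel out.tuple = out.ls := by
  rw [tupleSens_eq_upSens, upSens_eq_joinCount, h.ls_eq, sensCount]

theorem isLocalSensitivity (h : IsCorrectOutput T D out) :
    IsLocalSensitivity (fun i => (D i : Multiset (Tup dom (A i)))) out.ls := by
  refine ⟨⟨_, _, h.tupleSens_eq_ls⟩, ?_⟩
  rintro _ ⟨i, t, rfl⟩
  rw [tupleSens_eq_upSens, upSens_eq_joinCount]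
  exact h.le_ls i _

end IsCorrectOutput

theorem output_spec (hB : CostBounds D z Z W Λ) {bot top : Fin m → List (Row dom ℕ)}
    (hbot : ∀ i, IsBot T D i (bot i)) (htop : ∀ i, IsTop T D i (top i)) {b : Fin m × Row dom ℕ}
    (hb : IsMaxSens D T.postOrder b) :
    (do tick (A b.1).card; pure ⟨b.2.2, b.1, (A b.1).restrict b.2.1, bot, top⟩ : Timed _).Spec
      (IsCorrectOutput T D) 1 W := by
  have hcard := hB.card_le (i := b.1) subset_rfl
  exact Spec.tick_pure (by omega)
    { ls_eq := (hb.eq_sensCount (T.mem_postOrder _)).trans (sensCount_extend_restrict _ _).symm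
      le_ls := fun i => hb.le i (T.mem_postOrder i)
      multTable_eq := multTable_eq_joinCount hbot htop }

end Algorithm

/-! ### The number of steps -/

section Steps

variable {α : Type} [DecidableEq α] {dom : α → Type} {m : ℕ} {A : Fin m → Finset α}
  {D : ∀ i, List (Tup dom (A i))} {T : JoinTree A} {n q Λ : ℕ}

/-- The conditions on the degrees in the join tree under which the algorithm takes `O(q n log n)`
steps. -/
structure DegreeBound (T : JoinTree A) (n q : ℕ) : Prop where
  deg : ∀ i, (T.nbrs i).length + 1 ≤ q
  deg_nbrs : ∀ j, ((T.nbrs j).map fun i => (T.nbrs i).length + 1).sum ≤ q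
  sum_deg : ∑ i, ((T.nbrs i).length + 1) ≤ q * (n + 1)
  sum_sq : m ≤ n + 1 → ∑ i, ((T.nbrs i).length + 1) ^ 2 ≤ q * (n + 1)

theorem degreeBound_card (T : JoinTree A) (n : ℕ) : DegreeBound T n (3 * m) := by
  have hsum : ∑ i, ((T.nbrs i).length + 1) ≤ 3 * m := by
    have := T.sum_length_nbrs_le
    rw [Finset.sum_add_distrib, Finset.sum_const, Finset.card_univ, Fintype.card_fin, smul_eq_mul]
    omega
  refine ⟨fun i => ?_, fun j => ?_, ?_, fun hm => ?_⟩
  · have := T.length_nbrs_lt i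
    omega
  · rw [← List.sum_toFinset _ (T.nodup_nbrs j)]
    exact (Finset.sum_le_sum_of_subset (Finset.subset_univ _)).trans hsum
  · exact hsum.trans (Nat.le_mul_of_pos_right _ (Nat.succ_pos _))
  · calc ∑ i, ((T.nbrs i).length + 1) ^ 2 ≤ ∑ i, m * ((T.nbrs i).length + 1) :=
          Finset.sum_le_sum fun i _ => sq ((T.nbrs i).length + 1) ▸
            Nat.mul_le_mul_right _ (T.length_nbrs_lt i)
      _ = m * ∑ i, ((T.nbrs i).length + 1) := (Finset.mul_sum _ _ _).symm
      _ ≤ m * (3 * m) := Nat.mul_le_mul_left _ hsum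
      _ = 3 * m * m := mul_comm _ _
      _ ≤ 3 * m * (n + 1) := Nat.mul_le_mul_left _ hm

theorem degreeBound_of_degree_le (T : JoinTree A) {d : ℕ} (hd : ∀ i, (T.nbrs i).length ≤ d)
    (hm : m ≤ n) : DegreeBound T n ((d + 1) ^ 2) := by
  have hle : d + 1 ≤ (d + 1) ^ 2 := Nat.le_self_pow two_ne_zero _
  have hsum : ∀ φ : Fin m → ℕ, (∀ i, φ i ≤ (d + 1) ^ 2) → ∑ i, φ i ≤ (d + 1) ^ 2 * (n + 1) := by
    intro φ hφ
    refine (Finset.sum_le_card_nsmul _ _ _ fun i _ => hφ i).trans ?_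
    rw [Finset.card_univ, Fintype.card_fin, smul_eq_mul, mul_comm]
    exact Nat.mul_le_mul_left _ (hm.trans (Nat.le_succ n))
  refine ⟨fun i => (Nat.succ_le_succ (hd i)).trans hle, fun j => ?_,
    hsum _ fun i => (Nat.succ_le_succ (hd i)).trans hle,
    fun _ => hsum _ fun i => Nat.pow_le_pow_left (Nat.succ_le_succ (hd i)) 2⟩
  calc ((T.nbrs j).map fun i => (T.nbrs i).length + 1).sum
      ≤ ((T.nbrs j).map fun _ => d + 1).sum :=
        List.sum_le_sum fun i _ => Nat.succ_le_succ (hd i)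
    _ = (T.nbrs j).length * (d + 1) := by rw [List.map_const', List.sum_replicate, smul_eq_mul]
    _ ≤ (d + 1) * (d + 1) := Nat.mul_le_mul_right _ ((hd j).trans (Nat.le_succ _))
    _ = (d + 1) ^ 2 := (sq _).symm

namespace DegreeBound

theorem one_le (hq : DegreeBound T n q) : 1 ≤ q :=
  (Nat.le_add_left _ _).trans (hq.deg T.root)

theorem le_mul_sortCost (hq : DegreeBound T n q) (Λ : ℕ) : n + 1 ≤ q * sortCost n Λ :=
  (succ_le_sortCost n Λ).trans (Nat.le_mul_of_pos_left _ hq.one_le)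

theorem card_le (hq : DegreeBound T n q) : m ≤ q * (n + 1) := by
  refine le_trans ?_ hq.sum_deg
  rw [Finset.sum_add_distrib, Finset.sum_const, Finset.card_univ, Fintype.card_fin, smul_eq_mul]
  omega

theorem sum_deg_mul_length_le (hq : DegreeBound T (∑ i, (D i).length) q) :
    ∑ i, ((T.nbrs i).length + 1) * (D i).length ≤ q * ∑ i, (D i).length := by
  rw [Finset.mul_sum]
  exact Finset.sum_le_sum fun i _ => Nat.mul_le_mul_right _ (hq.deg i)

theorem sum_deg_mul_length_nbrs_le (hq : DegreeBound T (∑ i, (D i).length) q) :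
    ∑ i, ((T.nbrs i).length + 1) * ((T.nbrs i).map fun j => (D j).length).sum ≤
      q * ∑ i, (D i).length := by
  simp_rw [← List.sum_map_mul_left]
  rw [T.sum_nbrs_comm fun i j => ((T.nbrs i).length + 1) * (D j).length, Finset.mul_sum]
  refine Finset.sum_le_sum fun j _ => ?_
  rw [List.sum_map_mul_right]
  exact Nat.mul_le_mul_right _ (hq.deg_nbrs j)

theorem sum_length_nbrs_le (hq : DegreeBound T (∑ i, (D i).length) q) :
    ∑ i, ((T.nbrs i).map fun j => (D j).length).sum ≤ q * ∑ i, (D i).length :=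
  (Finset.sum_le_sum fun _ _ => Nat.le_mul_of_pos_left _ (Nat.succ_pos _)).trans
    hq.sum_deg_mul_length_nbrs_le

theorem sum_deg_mul_sortCost_le (hq : DegreeBound T n q) {φ : Fin m → ℕ}
    (hφ : ∑ i, ((T.nbrs i).length + 1) * φ i ≤ q * n) :
    ∑ i, ((T.nbrs i).length + 1) * sortCost (φ i) Λ ≤ 2 * (q * sortCost n Λ) := by
  simp_rw [sortCost, ← mul_assoc, mul_add_one (_ + 1) (φ _)]
  rw [← Finset.sum_mul, Finset.sum_add_distrib]
  refine Nat.mul_le_mul_right _ ?_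
  linarith [hq.sum_deg]

theorem sum_message_steps_le (hq : DegreeBound T (∑ i, (D i).length) q) (c Λ : ℕ) :
    ∑ i, (c * (((T.nbrs i).length + 1) * sortCost (D i).length Λ) +
      ((T.nbrs i).map fun j => (D j).length).sum + 1) + 1 ≤
      (2 * c + 3) * (q * sortCost (∑ i, (D i).length) Λ) := by
  have hsort := Nat.mul_le_mul_left c (hq.sum_deg_mul_sortCost_le (Λ := Λ) hq.sum_deg_mul_length_le)
  have hX := Nat.mul_le_mul_left q (succ_le_sortCost (∑ i, (D i).length) Λ)
  have hnbrs := hq.sum_length_nbrs_le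
  have hm := hq.card_le
  have hone := (Nat.le_add_left 1 _).trans (hq.le_mul_sortCost Λ)
  rw [Finset.sum_add_distrib, Finset.sum_add_distrib, ← Finset.mul_sum, Finset.sum_const,
    Finset.card_univ, Fintype.card_fin, smul_eq_mul]
  linarith

theorem sum_nodeMax_steps_le (hq : DegreeBound T (∑ i, (D i).length) q)
    (hm : m ≤ ∑ i, (D i).length + 1) (Λ : ℕ) :
    ∑ i, (8 * (((T.nbrs i).length + 1) * sortCost ((T.nbrs i).map fun j => (D j).length).sum Λ) +
      6 * ((T.nbrs i).length + 1) ^ 2 + 2) + 1 ≤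
      25 * (q * sortCost (∑ i, (D i).length) Λ) := by
  have hsort := hq.sum_deg_mul_sortCost_le (Λ := Λ) hq.sum_deg_mul_length_nbrs_le
  have hX := Nat.mul_le_mul_left q (succ_le_sortCost (∑ i, (D i).length) Λ)
  have hsq := hq.sum_sq hm
  have hone := (Nat.le_add_left 1 _).trans (hq.le_mul_sortCost Λ)
  have hcard := hq.card_le
  rw [Finset.sum_add_distrib, Finset.sum_add_distrib, ← Finset.mul_sum, ← Finset.mul_sum,
    Finset.sum_const, Finset.card_univ, Fintype.card_fin, smul_eq_mul]
  linarith

end DegreeBound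

end Steps

section Cost

variable {α : Type} [LinearOrder α] {dom : α → Type} [∀ a, LinearOrder (dom a)]
  [∀ a, Inhabited (dom a)] {m : ℕ} {A : Fin m → Finset α}
  {D : ∀ i, List (Tup dom (A i))} {z Z W Λ q : ℕ} {T : JoinTree A}

theorem lsAcyclicJoin_spec (hB : CostBounds D z Z W Λ) (hT : T.NbrsAcyclic)
    (hq : DegreeBound T (∑ i, (D i).length) q) :
    (lsAcyclicJoin T D).Spec (IsCorrectOutput T D)
      (78 * (q * sortCost (∑ i, (D i).length) Λ)) W := by
  have hn := hq.le_mul_sortCost Λ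
  have hm := hq.card_le.trans (Nat.mul_le_mul_left q (succ_le_sortCost (∑ i, (D i).length) Λ))
  have hbot := hq.sum_message_steps_le 10 Λ
  have htop := hq.sum_message_steps_le 12 Λ
  unfold lsAcyclicJoin
  refine ((foldT_botStep_spec hB).bind fun bot hbot => (foldT_topStep_spec hB hbot).bind
    fun top htop => (Spec.ticks hB.one_le).bind
    (t' := 25 * (q * sortCost (∑ i, (D i).length) Λ) + 1) fun _ _ => ?_).mono_steps ?_
  · split_ifs with hmn
    · exact ((selectMax_spec hB hT hbot htop).bind fun b hb =>
        output_spec hB hbot htop hb).mono_steps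
        (Nat.add_le_add_right (hq.sum_nodeMax_steps_le hmn Λ) 1)
    · refine ((Spec.pure (P := IsMaxSens D T.postOrder) ⟨.inl rfl, fun i _ v => ?_⟩).bind
        fun b hb => output_spec hB hbot htop hb).mono_steps (by omega)
      exact (sensCount_eq_zero hmn i v).le
  · omega

theorem size_joinCount_le {n : ℕ} (hn : ∀ j, (D j).length ≤ n) {U : List (Fin m)} (hU : U.Nodup)
    (S : Finset α) (v : ∀ a, dom a) : (joinCount D U S v).size ≤ n * m + 1 := by
  rw [Nat.size_le]
  calc joinCount D U S v ≤ n ^ U.length := joinCount_le hn U S v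
    _ ≤ (2 ^ n) ^ U.length := Nat.pow_le_pow_left Nat.lt_two_pow_self.le _
    _ = 2 ^ (n * U.length) := (pow_mul _ _ _).symm
    _ ≤ 2 ^ (n * m) := Nat.pow_le_pow_right two_pos (Nat.mul_le_mul_left _
        (hU.length_le_card.trans_eq (Fintype.card_fin m)))
    _ < 2 ^ (n * m + 1) := Nat.pow_lt_pow_right one_lt_two (Nat.lt_succ_self _)

theorem costBounds_sum_length (D : ∀ i, List (Tup dom (A i))) {n : ℕ}
    (hn : n = ∑ i, (D i).length) :
    CostBounds D (n * m + 1) ((n * m + 1) * (m + 1) + n + 2)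
      (2 * (allAttrs A).card + ((n * m + 1) * (m + 1) + n + 2 + 1) ^ 2 + 1) (Nat.clog 2 n) where
  size_joinCount_le U hU S v := size_joinCount_le (fun j => hn ▸ length_le_sum_length D j) hU S v
  le_size := by rw [hn]
  le_work := le_rfl
  clog_le i := Nat.clog_mono_right 2 (hn ▸ length_le_sum_length D i)

end Cost

section Estimates

theorem sortCost_clog_le {n : ℕ} (hn : 2 ≤ n) :
    (sortCost n (Nat.clog 2 n) : ℝ) ≤ 10 * (n * Real.log n) := by
  have hn' : (2 : ℝ) ≤ n := by exact_mod_cast hn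
  have hlog_two : (0.69 : ℝ) < Real.log 2 := lt_trans (by norm_num) Real.log_two_gt_d9
  have hlog : Real.log 2 ≤ Real.log n := Real.log_le_log two_pos hn'
  have hclog : (Nat.clog 2 n : ℝ) ≤ Nat.log 2 n + 1 := by
    exact_mod_cast Nat.clog_le_of_le_pow (Nat.lt_pow_succ_log_self one_lt_two n).le
  have hmul_log : (Nat.log 2 n : ℝ) * Real.log 2 ≤ Real.log n := by
    rw [← Real.log_pow]
    exact Real.log_le_log (by positivity) (by exact_mod_cast Nat.pow_log_le_self 2 (by omega))
  have hclog_log : (Nat.clog 2 n : ℝ) + 1 ≤ 5 * Real.log n := by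
    have : (0 : ℝ) ≤ Nat.log 2 n := Nat.cast_nonneg _
    nlinarith
  rw [sortCost]
  push_cast
  calc ((n : ℝ) + 1) * (Nat.clog 2 n + 1) ≤ (2 * n) * (5 * Real.log n) :=
        mul_le_mul (by linarith) hclog_log (by positivity) (by positivity)
    _ = 10 * (n * Real.log n) := by ring

theorem cast_steps_le {s q n : ℕ} {c : ℝ} (hs : s ≤ 78 * (q * sortCost n (Nat.clog 2 n)))
    (hn : 2 ≤ n) (hc : 780 * (q : ℝ) ≤ c) : (s : ℝ) ≤ c * n * Real.log n := by
  have hlog : 0 ≤ n * Real.log n := mul_nonneg (Nat.cast_nonneg _) (Real.log_natCast_nonneg _)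
  calc (s : ℝ) ≤ 78 * (q * (sortCost n (Nat.clog 2 n) : ℝ)) := by exact_mod_cast hs
    _ ≤ 78 * (q * (10 * (n * Real.log n))) := by gcongr; exact sortCost_clog_le hn
    _ = 780 * q * (n * Real.log n) := by ring
    _ ≤ c * (n * Real.log n) := mul_le_mul_of_nonneg_right hc hlog
    _ = c * n * Real.log n := (mul_assoc _ _ _).symm

theorem work_le {m k n M : ℕ} (hm : 1 ≤ m) (hM : M = m + k + n) :
    (2 * k + ((n * m + 1) * (m + 1) + n + 2 + 1) ^ 2 + 1) *
      (78 * (3 * m * sortCost n (Nat.clog 2 n))) ≤ 62712 * M ^ 9 := by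
  have hM1 : 1 ≤ M := by omega
  have hmM : m ≤ M := by omega
  have hnM : n ≤ M := by omega
  have hclog : Nat.clog 2 n ≤ M := (Nat.clog_le_of_le_pow Nat.lt_two_pow_self.le).trans hnM
  have hM2 : 1 ≤ M ^ 2 := Nat.one_le_pow _ _ hM1
  have hM3 : M ≤ M ^ 3 := Nat.le_self_pow three_ne_zero _
  have hM6 : M ≤ M ^ 6 := Nat.le_self_pow (by norm_num) _
  have hnm : n * m ≤ M ^ 2 := sq M ▸ Nat.mul_le_mul hnM hmM
  have hcount : (n * m + 1) * (m + 1) ≤ 4 * M ^ 3 :=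
    calc (n * m + 1) * (m + 1) ≤ (2 * M ^ 2) * (2 * M) := Nat.mul_le_mul (by omega) (by omega)
      _ = 4 * M ^ 3 := by ring
  have harith : ((n * m + 1) * (m + 1) + n + 2 + 1) ^ 2 ≤ 64 * M ^ 6 :=
    calc ((n * m + 1) * (m + 1) + n + 2 + 1) ^ 2 ≤ (8 * M ^ 3) ^ 2 :=
          Nat.pow_le_pow_left (by omega) 2
      _ = 64 * M ^ 6 := by ring
  have hsteps : 3 * m * sortCost n (Nat.clog 2 n) ≤ 3 * M * ((2 * M) * (2 * M)) :=
    Nat.mul_le_mul (by omega) (Nat.mul_le_mul (by omega) (by omega))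
  calc (2 * k + ((n * m + 1) * (m + 1) + n + 2 + 1) ^ 2 + 1) *
        (78 * (3 * m * sortCost n (Nat.clog 2 n)))
      ≤ (67 * M ^ 6) * (78 * (3 * M * ((2 * M) * (2 * M)))) :=
        Nat.mul_le_mul (by omega) (Nat.mul_le_mul_left _ hsteps)
    _ = 62712 * M ^ 9 := by ring

end Estimates

end JoinLS

open JoinLS in
theorem mainTheorem5 :
    -- the join that defines the multiplicity table of a node is acyclic
    (∀ (α : Type) [DecidableEq α] (m : ℕ) (A : Fin m → Finset α) (T : JoinTree A),
      T.NbrsAcyclic → ∀ i, GYOAcyclic (fun j => A i ∩ A j) (T.nbrs i).toFinset) ∧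
    -- the algorithm is correct, and its running time
    (∃ (C : ℝ) (c : ℕ), ∀ (α : Type) [LinearOrder α] (dom : α → Type)
      [∀ a, LinearOrder (dom a)] [∀ a, Inhabited (dom a)]
      (m : ℕ) (A : Fin m → Finset α) (T : JoinTree A), T.NbrsAcyclic →
        ∀ (D : ∀ i, List (Tup dom (A i))) (n : ℕ), n = ∑ i, (D i).length →
        ∀ run : Timed (Output A dom), run = lsAcyclicJoin T D →
        ∀ bag : ∀ i, Multiset (Tup dom (A i)), (∀ i, bag i = (D i : Multiset (Tup dom (A i)))) →
          IsLocalSensitivity bag run.val.ls ∧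
          tupleSens bag run.val.rel run.val.tuple = run.val.ls ∧
          (∀ i t, multTable T run.val.bot run.val.top i t = upSens bag i t) ∧
          (2 ≤ n → (run.steps : ℝ) ≤ C * m * n * Real.log n) ∧
          (∀ d : ℕ, (∀ i, (T.nbrs i).length ≤ d) → 2 ≤ n → m ≤ n →
            (run.steps : ℝ) ≤ C * (d + 1) ^ 2 * n * Real.log n) ∧
          ((run.work : ℝ) ≤ C * ((m : ℝ) + (allAttrs A).card + n) ^ c)) ∧
    -- path queries are doubly acyclic, with a join tree of degree at most two
    (∀ m : ℕ, 1 ≤ m → DoublyAcyclic (pathQuery m) ∧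
      ∃ T : JoinTree (pathQuery m), T.NbrsAcyclic ∧ ∀ i, (T.nbrs i).length ≤ 2) := by
  refine ⟨fun α _ m A T hT i => (hT i).inter_left _, ⟨62712, 9, ?_⟩, fun m hm =>
    ⟨⟨(pathTree m hm).gyoAcyclic_univ, pathTree m hm, nbrsAcyclic_pathTree hm⟩, pathTree m hm,
      nbrsAcyclic_pathTree hm, length_nbrs_pathTree hm⟩⟩
  rintro α _ dom _ _ m A T hT D n hn _ rfl bag hbag
  obtain rfl : bag = _ := funext hbag
  have hspec {q} (hq : DegreeBound T n q) :=
    lsAcyclicJoin_spec (costBounds_sum_length D hn) hT (hn ▸ hq)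
  rw [← hn] at hspec
  have hrun := hspec (degreeBound_card T n)
  have hout := hrun.val
  have hm : 1 ≤ m := Nat.one_le_of_lt T.root.2
  refine ⟨hout.isLocalSensitivity, hout.tupleSens_eq_ls, hout.multTable_eq_upSens,
    fun hn2 => cast_steps_le hrun.steps hn2 ?_, fun d hd hn2 hmn =>
      cast_steps_le (hspec (degreeBound_of_degree_le T hd hmn)).steps hn2 ?_, ?_⟩
  · push_cast
    linarith [(Nat.cast_nonneg m : (0 : ℝ) ≤ m)]
  · push_cast
    linarith [sq_nonneg ((d : ℝ) + 1)]
  · exact_mod_cast (hrun.work.trans (Nat.mul_le_mul_left _ hrun.steps)).trans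
      (work_le (k := (allAttrs A).card) hm rfl)
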